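/- Let $q\in\mathbb C\setminus\{0\}$ be not a root of unity and fix a square root $q^{1/2}$; write $[a]=(q^a-q^{-a})/(q-q^{-1})$. **Algebras.** $U_q(\mathrm{sl}_2)$ is generated by $e,f,q^{\pm H}$ with $q^He=q\,eq^H$, $q^Hf=q^{-1}fq^H$, $[e,f]=(q^{2H}-q^{-2H})/(q-q^{-1})$, with comultiplication $\Delta(q^{\pm H})=q^{\pm H}\otimes q^{\pm H}$, $\Delta(e)=e\otimes q^H+q^{-H}\otimes e$, $\Delta(f)=f\otimes q^H+q^{-H}\otimes f$, and Casimir element $c=ef+(q^{2H-1}+q^{-2H+1})/(q-q^{-1})^2$. The algebra $\hat U_q(\mathrm{sl}_2)^{\otimes 2,\mathrm{ext}}$ is obtained from two commuting copies ($i=1,2$) of $U_q(\mathrm{sl}_2)$ by adjoining elements $x_1,x_2$, commuting with each other and with both copies and satisfying $q^{-1}x_i^4-c_i(q-q^{-1})^2x_i^2+q=0$, and the (mutually commuting) inverses of $q^{H_1+H_2+j}+q^{-H_1-H_2-j}$ and of $q^{H_1-H_2+j}+q^{-H_1+H_2-j}$ for all $j\in\mathbb Z$. The algebra $U'_q(\mathrm{so}_4)$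 is generated by $I_{21},I_{32},I_{43}$ with $I_{21}I_{43}=I_{43}I_{21}$ and $AB^2-(q+q^{-1})BAB+B^2A=-A$ for $(A,B)=(I_{21},I_{32}),(I_{32},I_{21}),(I_{32},I_{43}),(I_{43},I_{32})$. **The homomorphism.** There is a unique algebra homomorphism $\phi:U'_q(\mathrm{so}_4)\to\hat U_q(\mathrm{sl}_2)^{\otimes 2,\mathrm{ext}}$ with $\phi(I_{21})=\mathrm i[H_1+H_2]$, $\phi(I_{43})=\mathrm i[H_1-H_2]$ and $$\phi(I_{32})=-\frac{x_1^{-1}q^{-H_2+1}+x_1q^{H_2-1}}{D^+_{-1}D^-_{1}}e_2+\frac{x_1^{-1}q^{H_2+1}+x_1q^{-H_2-1}}{D^+_{1}D^-_{-1}}f_2+\frac{x_2^{-1}q^{-H_1+1}+x_2q^{H_1-1}}{D^+_{-1}D^-_{-1}}e_1-\frac{x_2^{-1}q^{H_1+1}+x_2q^{-H_1-1}}{D^+_{1}D^-_{1}}f_1,$$ where $D^{\pm}_j=q^{H_1\pm H_2+j}+q^{-H_1\mp H_2-j}$. **Representations.** For $l\in\frac12\mathbb Z_{\ge0}$ let $T_l$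 be the representation of $U_q(\mathrm{sl}_2)$ with basis $|l,m\rangle$, $m=-l,\dots,l$, and $q^H|l,m\rangle=q^m|l,m\rangle$, $e|l,m\rangle=[l-m]|l,m+1\rangle$, $f|l,m\rangle=[l+m]|l,m-1\rangle$. Let $T^{(1,1)}_{jj'}=T_j\otimes T_{j'}$, extended to $\hat U_q(\mathrm{sl}_2)^{\otimes 2,\mathrm{ext}}$ by $x_1\mapsto q^{-j}$, $x_2\mapsto q^{-j'}$, and let $R_{jj'}=T^{(1,1)}_{jj'}\circ\phi$. These representations of $U'_q(\mathrm{so}_4)$ are irreducible. **Tensor products.** Let $j,j',s,s'\in\frac12\mathbb Z_{\ge0}$, and let $T=T^{(1,1)}_{jj'}\otimes T^{(1,1)}_{ss'}$ be the tensor product representation of $U_q(\mathrm{sl}_2)^{\otimes2}$ formed by means of the comultiplication. There are operators $X_1,X_2$ that commute with each other and with the image of $T$ and satisfy $$q^{-1}X_i^4-T(c_i)(q-q^{-1})^2X_i^2+q=0,\qquad i=1,2.$$ For every such choice of $X_1,X_2$ there is exactly one extension of $T$ to a representation of $\hat U_q(\mathrm{sl}_2)^{\otimes 2,\mathrm{ext}}$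 with $x_i\mapsto X_i$, and its composition with $\phi$, denoted $R_{jj'}\otimes R_{ss'}$, is equivalent to $$\bigoplus_{k=|j-s|}^{j+s}\ \bigoplus_{k'=|j'-s'|}^{j'+s'}R_{kk'},$$ where $k$ and $k'$ run in integer steps. -/

import Mathlib

open scoped TensorProduct

namespace QSo4

noncomputable section

/-! ### Representations of associative algebras -/

section Representations

variable {A : Type*} [Semiring A] [Algebra ℂ A]

/-- Equivalence of two representations of `A`. -/
def RepEquiv {V W : Type*} [AddCommMonoid V] [Module ℂ V] [AddCommMonoid W] [Module ℂ W]
    (ρ : A →ₐ[ℂ] Module.End ℂ V) (σ : A →ₐ[ℂ] Module.End ℂ W) : Prop :=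
  ∃ Ψ : V ≃ₗ[ℂ] W, ∀ (a : A) (v : V), Ψ (ρ a v) = σ a (Ψ v)

/-- Irreducibility: the space is nonzero and has no proper nonzero invariant subspace. -/
def RepIrreducible {V : Type*} [AddCommMonoid V] [Module ℂ V]
    (ρ : A →ₐ[ℂ] Module.End ℂ V) : Prop :=
  Nontrivial V ∧ ∀ W : Submodule ℂ V, (∀ a : A, ∀ v ∈ W, ρ a v ∈ W) → W = ⊥ ∨ W = ⊤

/-- The direct sum of a family of representations, on the product of the spaces (the index sets
used below are finite, so that this is the direct sum of the spaces). -/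
def repSum {ι : Type*} {V : ι → Type*} [∀ i, AddCommMonoid (V i)] [∀ i, Module ℂ (V i)]
    (ρ : ∀ i, A →ₐ[ℂ] Module.End ℂ (V i)) : A →ₐ[ℂ] Module.End ℂ (∀ i, V i) where
  toFun a := LinearMap.pi fun i => (ρ i a).comp (LinearMap.proj i)
  map_one' := by ext; simp
  map_mul' a b := by ext; simp
  map_zero' := by ext; simp
  map_add' a b := by ext; simp
  commutes' c := by ext; simp [Module.algebraMap_end_apply]

/-- The outer tensor product of a representation of `A` and a representation of `B`. -/
def repTensor {B : Type*} [Semiring B] [Algebra ℂ B]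
    {V W : Type*} [AddCommMonoid V] [Module ℂ V] [AddCommMonoid W] [Module ℂ W]
    (ρ : A →ₐ[ℂ] Module.End ℂ V) (σ : B →ₐ[ℂ] Module.End ℂ W) :
    A ⊗[ℂ] B →ₐ[ℂ] Module.End ℂ (V ⊗[ℂ] W) :=
  (Module.endTensorEndAlgHom (R := ℂ) (S := ℂ) (A := ℂ)).comp (Algebra.TensorProduct.map ρ σ)

theorem repTensor_tmul {B : Type*} [Semiring B] [Algebra ℂ B]
    {V W : Type*} [AddCommMonoid V] [Module ℂ V] [AddCommMonoid W] [Module ℂ W]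
    (ρ : A →ₐ[ℂ] Module.End ℂ V) (σ : B →ₐ[ℂ] Module.End ℂ W) (a : A) (b : B) :
    repTensor ρ σ (a ⊗ₜ b) = TensorProduct.map (ρ a) (σ b) := by
  simp [repTensor, Module.endTensorEndAlgHom_apply]
  rfl

end Representations

/-! ### The algebra `U_q(sl₂)` -/

/-- The generators `e`, `f`, `k = q^H`, `kinv = q^{-H}`. -/
inductive Sl2Gen
  | e | f | k | kinv

/-- The defining relations of `U_q(sl₂)`. -/
inductive Sl2Rel (q : ℂ) : FreeAlgebra ℂ Sl2Gen → FreeAlgebra ℂ Sl2Gen → Prop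
  | k_kinv : Sl2Rel q (FreeAlgebra.ι ℂ .k * FreeAlgebra.ι ℂ .kinv) 1
  | kinv_k : Sl2Rel q (FreeAlgebra.ι ℂ .kinv * FreeAlgebra.ι ℂ .k) 1
  | k_e : Sl2Rel q (FreeAlgebra.ι ℂ .k * FreeAlgebra.ι ℂ .e)
      (q • (FreeAlgebra.ι ℂ .e * FreeAlgebra.ι ℂ .k))
  | k_f : Sl2Rel q (FreeAlgebra.ι ℂ .k * FreeAlgebra.ι ℂ .f)
      (q⁻¹ • (FreeAlgebra.ι ℂ .f * FreeAlgebra.ι ℂ .k))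
  | e_f : Sl2Rel q
      (FreeAlgebra.ι ℂ .e * FreeAlgebra.ι ℂ .f - FreeAlgebra.ι ℂ .f * FreeAlgebra.ι ℂ .e)
      ((q - q⁻¹)⁻¹ • (FreeAlgebra.ι ℂ .k ^ 2 - FreeAlgebra.ι ℂ .kinv ^ 2))

/-- The quantum algebra `U_q(sl₂)`. -/
abbrev UqSl2 (q : ℂ) : Type := RingQuot (Sl2Rel q)

/-- The images of the generators in `U_q(sl₂)`. -/
def sl2 (q : ℂ) (g : Sl2Gen) : UqSl2 q := RingQuot.mkAlgHom ℂ (Sl2Rel q) (FreeAlgebra.ι ℂ g)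

section Sl2Lift

variable {B : Type*} [Ring B] [Algebra ℂ B]

/-- The homomorphism out of `U_q(sl₂)` with prescribed values on the generators. -/
def sl2Lift (q : ℂ) (g : Sl2Gen → B) (h1 : g .k * g .kinv = 1) (h2 : g .kinv * g .k = 1)
    (h3 : g .k * g .e = q • (g .e * g .k)) (h4 : g .k * g .f = q⁻¹ • (g .f * g .k))
    (h5 : g .e * g .f - g .f * g .e = (q - q⁻¹)⁻¹ • (g .k ^ 2 - g .kinv ^ 2)) :
    UqSl2 q →ₐ[ℂ] B :=
  RingQuot.liftAlgHom ℂ ⟨FreeAlgebra.lift ℂ g, by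
    intro a b h
    cases h <;> simp [h1, h2, h3, h4, h5]⟩

theorem sl2Lift_gen (q : ℂ) (g : Sl2Gen → B) (h1 h2 h3 h4 h5) (x : Sl2Gen) :
    sl2Lift q g h1 h2 h3 h4 h5 (sl2 q x) = g x := by
  simp [sl2Lift, sl2]

theorem sl2_k_kinv (q : ℂ) : sl2 q .k * sl2 q .kinv = 1 := by
  simpa [sl2] using RingQuot.mkAlgHom_rel ℂ (Sl2Rel.k_kinv (q := q))

theorem sl2_kinv_k (q : ℂ) : sl2 q .kinv * sl2 q .k = 1 := by
  simpa [sl2] using RingQuot.mkAlgHom_rel ℂ (Sl2Rel.kinv_k (q := q))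

theorem sl2_k_e (q : ℂ) : sl2 q .k * sl2 q .e = q • (sl2 q .e * sl2 q .k) := by
  simpa [sl2] using RingQuot.mkAlgHom_rel ℂ (Sl2Rel.k_e (q := q))

theorem sl2_k_f (q : ℂ) : sl2 q .k * sl2 q .f = q⁻¹ • (sl2 q .f * sl2 q .k) := by
  simpa [sl2] using RingQuot.mkAlgHom_rel ℂ (Sl2Rel.k_f (q := q))

theorem sl2_e_f (q : ℂ) : sl2 q .e * sl2 q .f - sl2 q .f * sl2 q .e =
    (q - q⁻¹)⁻¹ • (sl2 q .k ^ 2 - sl2 q .kinv ^ 2) := by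
  simpa [sl2] using RingQuot.mkAlgHom_rel ℂ (Sl2Rel.e_f (q := q))

/-- An induction principle: `U_q(sl₂)` is generated by `e, f, q^{±H}`. -/
theorem sl2_induction (q : ℂ) {P : UqSl2 q → Prop} (hc : ∀ c : ℂ, P (algebraMap ℂ _ c))
    (hg : ∀ g, P (sl2 q g)) (hm : ∀ a b, P a → P b → P (a * b))
    (ha : ∀ a b, P a → P b → P (a + b)) (u : UqSl2 q) : P u := by
  obtain ⟨a, rfl⟩ := RingQuot.mkAlgHom_surjective ℂ (Sl2Rel q) u
  induction a using FreeAlgebra.induction with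
  | grade0 c => simpa using hc c
  | grade1 g => exact hg g
  | mul a b h1 h2 => simpa using hm _ _ h1 h2
  | add a b h1 h2 => simpa using ha _ _ h1 h2

end Sl2Lift

/-- The Casimir element `c = e f + (q^{2H-1} + q^{-2H+1}) / (q - q⁻¹)²`. -/
def casimir (q : ℂ) : UqSl2 q :=
  sl2 q .e * sl2 q .f +
    ((q - q⁻¹) ^ 2)⁻¹ • (q⁻¹ • sl2 q .k ^ 2 + q • sl2 q .kinv ^ 2)

/-- Values of the comultiplication on the generators. -/
def comulGen (q : ℂ) : Sl2Gen → UqSl2 q ⊗[ℂ] UqSl2 q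
  | .e => sl2 q .e ⊗ₜ sl2 q .k + sl2 q .kinv ⊗ₜ sl2 q .e
  | .f => sl2 q .f ⊗ₜ sl2 q .k + sl2 q .kinv ⊗ₜ sl2 q .f
  | .k => sl2 q .k ⊗ₜ sl2 q .k
  | .kinv => sl2 q .kinv ⊗ₜ sl2 q .kinv


theorem sl2_e_kinv (q : ℂ) : sl2 q .e * sl2 q .kinv = q • (sl2 q .kinv * sl2 q .e) := by
  calc sl2 q .e * sl2 q .kinv
      = sl2 q .kinv * (sl2 q .k * sl2 q .e) * sl2 q .kinv := by
        rw [← mul_assoc, sl2_kinv_k, one_mul]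
    _ = q • (sl2 q .kinv * sl2 q .e) := by
        rw [sl2_k_e, mul_smul_comm, smul_mul_assoc, mul_assoc, mul_assoc, sl2_k_kinv, mul_one]

theorem sl2_f_kinv (q : ℂ) : sl2 q .f * sl2 q .kinv = q⁻¹ • (sl2 q .kinv * sl2 q .f) := by
  calc sl2 q .f * sl2 q .kinv
      = sl2 q .kinv * (sl2 q .k * sl2 q .f) * sl2 q .kinv := by
        rw [← mul_assoc, sl2_kinv_k, one_mul]
    _ = q⁻¹ • (sl2 q .kinv * sl2 q .f) := by
        rw [sl2_k_f, mul_smul_comm, smul_mul_assoc, mul_assoc, mul_assoc, sl2_k_kinv, mul_one]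

theorem sl2_kinv_e {q : ℂ} (hq : q ≠ 0) :
    sl2 q .kinv * sl2 q .e = q⁻¹ • (sl2 q .e * sl2 q .kinv) := by
  rw [sl2_e_kinv, smul_smul, inv_mul_cancel₀ hq, one_smul]

theorem sl2_kinv_f {q : ℂ} (hq : q ≠ 0) :
    sl2 q .kinv * sl2 q .f = q • (sl2 q .f * sl2 q .kinv) := by
  rw [sl2_f_kinv, smul_smul, mul_inv_cancel₀ hq, one_smul]

/-- The comultiplication of `U_q(sl₂)`. -/
def comul (q : ℂ) (hq : q ≠ 0) : UqSl2 q →ₐ[ℂ] UqSl2 q ⊗[ℂ] UqSl2 q :=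
  sl2Lift q (comulGen q)
    (by simp [comulGen, sl2_k_kinv, Algebra.TensorProduct.one_def])
    (by simp [comulGen, sl2_kinv_k, Algebra.TensorProduct.one_def])
    (by
      simp only [comulGen, mul_add, add_mul, Algebra.TensorProduct.tmul_mul_tmul, sl2_k_e,
        sl2_k_kinv, sl2_kinv_k, smul_add, TensorProduct.smul_tmul', TensorProduct.tmul_smul])
    (by
      simp only [comulGen, mul_add, add_mul, Algebra.TensorProduct.tmul_mul_tmul, sl2_k_f,
        sl2_k_kinv, sl2_kinv_k, smul_add, TensorProduct.smul_tmul', TensorProduct.tmul_smul])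
    (by
      have h1 : sl2 q .e * sl2 q .f = sl2 q .f * sl2 q .e +
          (q - q⁻¹)⁻¹ • (sl2 q .k ^ 2 - sl2 q .kinv ^ 2) := by
        rw [← sl2_e_f]; abel
      simp only [comulGen, mul_add, add_mul, Algebra.TensorProduct.tmul_mul_tmul, pow_two] at h1 ⊢
      rw [h1, sl2_e_kinv, sl2_f_kinv, sl2_k_e, sl2_k_f]
      simp only [TensorProduct.smul_tmul', TensorProduct.tmul_smul, TensorProduct.tmul_add,
        TensorProduct.add_tmul, TensorProduct.sub_tmul, TensorProduct.tmul_sub, smul_smul,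
        mul_inv_cancel₀ hq, inv_mul_cancel₀ hq, one_smul, smul_sub]
      abel)

theorem comul_gen (q : ℂ) (hq : q ≠ 0) (g : Sl2Gen) : comul q hq (sl2 q g) = comulGen q g :=
  sl2Lift_gen ..

/-! ### The algebra `U_q(sl₂)^{⊗2}` -/

/-- `U_q(sl₂) ⊗ U_q(sl₂)`. -/
abbrev UqSl2Two (q : ℂ) : Type := UqSl2 q ⊗[ℂ] UqSl2 q

/-- The comultiplication of `U_q(sl₂)^{⊗2}`. -/
def comulTwo (q : ℂ) (hq : q ≠ 0) : UqSl2Two q →ₐ[ℂ] UqSl2Two q ⊗[ℂ] UqSl2Two q :=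
  (Algebra.TensorProduct.tensorTensorTensorComm ℂ ℂ ℂ ℂ
    (UqSl2 q) (UqSl2 q) (UqSl2 q) (UqSl2 q)).toAlgHom.comp
    (Algebra.TensorProduct.map (comul q hq) (comul q hq))

/-- The two embeddings of `U_q(sl₂)` as the first and the second factor of `U_q(sl₂)^{⊗2}`. -/
def incl (q : ℂ) : Fin 2 → (UqSl2 q →ₐ[ℂ] UqSl2Two q)
  | 0 => Algebra.TensorProduct.includeLeft
  | 1 => Algebra.TensorProduct.includeRight

/-- `q^{H₁+H₂+j} + q^{-H₁-H₂-j}`. -/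
def sumEl (q : ℂ) (j : ℤ) : UqSl2Two q :=
  q ^ j • (sl2 q .k ⊗ₜ[ℂ] sl2 q .k) + q ^ (-j) • (sl2 q .kinv ⊗ₜ[ℂ] sl2 q .kinv)

/-- `q^{H₁-H₂+j} + q^{-H₁+H₂-j}`. -/
def diffEl (q : ℂ) (j : ℤ) : UqSl2Two q :=
  q ^ j • (sl2 q .k ⊗ₜ[ℂ] sl2 q .kinv) + q ^ (-j) • (sl2 q .kinv ⊗ₜ[ℂ] sl2 q .k)

/-! ### The extended algebra `Û_q(sl₂)^{⊗2,ext}` -/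

/-- The generators: `s i g` is the generator `g` of the `i`-th copy of `U_q(sl₂)`, `x i` is the
root of the quartic polynomial of the `i`-th copy, and `sumInv j`, `diffInv j` are
`(q^{H₁+H₂+j} + q^{-H₁-H₂-j})⁻¹` and `(q^{H₁-H₂+j} + q^{-H₁+H₂-j})⁻¹`. -/
inductive ExtGen
  | s (i : Fin 2) (g : Sl2Gen)
  | x (i : Fin 2)
  | sumInv (j : ℤ)
  | diffInv (j : ℤ)

/-- The generators as elements of the free algebra. -/
abbrev fs (i : Fin 2) (g : Sl2Gen) : FreeAlgebra ℂ ExtGen := FreeAlgebra.ι ℂ (.s i g)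
abbrev fx (i : Fin 2) : FreeAlgebra ℂ ExtGen := FreeAlgebra.ι ℂ (.x i)
abbrev fp (j : ℤ) : FreeAlgebra ℂ ExtGen := FreeAlgebra.ι ℂ (.sumInv j)
abbrev fm (j : ℤ) : FreeAlgebra ℂ ExtGen := FreeAlgebra.ι ℂ (.diffInv j)

/-- The sign `ε`: `1` for the first copy and `-1` for the second. -/
def eps : Fin 2 → ℤ
  | 0 => 1
  | 1 => -1

/-- The defining relations of `Û_q(sl₂)^{⊗2,ext}`. -/
inductive ExtRel (q : ℂ) : FreeAlgebra ℂ ExtGen → FreeAlgebra ℂ ExtGen → Prop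
  | sl2 (i : Fin 2) (a b : FreeAlgebra ℂ Sl2Gen) (h : Sl2Rel q a b) :
      ExtRel q (FreeAlgebra.lift ℂ (fs i) a) (FreeAlgebra.lift ℂ (fs i) b)
  | comm (g h : Sl2Gen) : ExtRel q (fs 0 g * fs 1 h) (fs 1 h * fs 0 g)
  | x_s (i j : Fin 2) (g : Sl2Gen) : ExtRel q (fx i * fs j g) (fs j g * fx i)
  | x_x : ExtRel q (fx 0 * fx 1) (fx 1 * fx 0)
  | quartic (i : Fin 2) : ExtRel q
      (q⁻¹ • fx i ^ 4 + q • (1 : FreeAlgebra ℂ ExtGen))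
      ((q - q⁻¹) ^ 2 • ((fs i .e * fs i .f + ((q - q⁻¹) ^ 2)⁻¹ •
            (q⁻¹ • fs i .k ^ 2 + q • fs i .kinv ^ 2)) * fx i ^ 2))
  | sumInv_mul (j : ℤ) : ExtRel q
      (fp j * (q ^ j • (fs 0 .k * fs 1 .k) + q ^ (-j) • (fs 0 .kinv * fs 1 .kinv))) 1
  | diffInv_mul (j : ℤ) : ExtRel q
      (fm j * (q ^ j • (fs 0 .k * fs 1 .kinv) + q ^ (-j) • (fs 0 .kinv * fs 1 .k))) 1
  | sumInv_k (i : Fin 2) (j : ℤ) : ExtRel q (fp j * fs i .k) (fs i .k * fp j)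
  | sumInv_kinv (i : Fin 2) (j : ℤ) : ExtRel q (fp j * fs i .kinv) (fs i .kinv * fp j)
  | diffInv_k (i : Fin 2) (j : ℤ) : ExtRel q (fm j * fs i .k) (fs i .k * fm j)
  | diffInv_kinv (i : Fin 2) (j : ℤ) : ExtRel q (fm j * fs i .kinv) (fs i .kinv * fm j)
  | sumInv_e (i : Fin 2) (j : ℤ) : ExtRel q (fp j * fs i .e) (fs i .e * fp (j + 1))
  | sumInv_f (i : Fin 2) (j : ℤ) : ExtRel q (fp j * fs i .f) (fs i .f * fp (j - 1))
  | diffInv_e (i : Fin 2) (j : ℤ) : ExtRel q (fm j * fs i .e) (fs i .e * fm (j + eps i))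
  | diffInv_f (i : Fin 2) (j : ℤ) : ExtRel q (fm j * fs i .f) (fs i .f * fm (j - eps i))
  | sumInv_sumInv (j k : ℤ) : ExtRel q (fp j * fp k) (fp k * fp j)
  | sumInv_diffInv (j k : ℤ) : ExtRel q (fp j * fm k) (fm k * fp j)
  | diffInv_diffInv (j k : ℤ) : ExtRel q (fm j * fm k) (fm k * fm j)

/-- The algebra `Û_q(sl₂)^{⊗2,ext}`. -/
abbrev UqExt (q : ℂ) : Type := RingQuot (ExtRel q)

/-- The images of the generators in `Û_q(sl₂)^{⊗2,ext}`. -/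
def ext (q : ℂ) (g : ExtGen) : UqExt q := RingQuot.mkAlgHom ℂ (ExtRel q) (FreeAlgebra.ι ℂ g)

/-- The natural homomorphism of the `i`-th copy of `U_q(sl₂)` to `Û_q(sl₂)^{⊗2,ext}`. -/
def extOf (q : ℂ) (i : Fin 2) : UqSl2 q →ₐ[ℂ] UqExt q :=
  RingQuot.liftAlgHom ℂ ⟨(RingQuot.mkAlgHom ℂ (ExtRel q)).comp (FreeAlgebra.lift ℂ (fs i)),
    by
    intro a b h
    simpa using RingQuot.mkAlgHom_rel ℂ (ExtRel.sl2 i a b h)⟩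

theorem extOf_gen (q : ℂ) (i : Fin 2) (g : Sl2Gen) : extOf q i (sl2 q g) = ext q (.s i g) := by
  simp [extOf, sl2, ext]

theorem extOf_commute (q : ℂ) (u v : UqSl2 q) : Commute (extOf q 0 u) (extOf q 1 v) := by
  induction u using sl2_induction with
  | hc c => simpa using Algebra.commute_algebraMap_left c (extOf q 1 v)
  | hm a b h1 h2 => simpa using h1.mul_left h2
  | ha a b h1 h2 => simpa using h1.add_left h2
  | hg g =>
    induction v using sl2_induction with
    | hc c => simpa using Algebra.commute_algebraMap_right c (extOf q 0 (sl2 q g))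
    | hm a b h1 h2 => simpa using h1.mul_right h2
    | ha a b h1 h2 => simpa using h1.add_right h2
    | hg h =>
      rw [extOf_gen, extOf_gen]
      simpa [ext, Commute, SemiconjBy] using RingQuot.mkAlgHom_rel ℂ (ExtRel.comm (q := q) g h)

/-- The natural homomorphism `U_q(sl₂)^{⊗2} → Û_q(sl₂)^{⊗2,ext}`. -/
def extIncl (q : ℂ) : UqSl2Two q →ₐ[ℂ] UqExt q :=
  Algebra.TensorProduct.lift (extOf q 0) (extOf q 1) (extOf_commute q)

/-- `X 0` and `X 1` are admissible values of `x₁` and `x₂` for the representation `ρ` of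
`U_q(sl₂)^{⊗2}`: they commute with each other and with all operators `ρ u`, and they solve
`q⁻¹ X⁴ - ρ(c_i) (q - q⁻¹)² X² + q = 0` (with the middle term on the right-hand side), with `c_i` the Casimir element of the `i`-th copy. -/
structure IsQuarticSolution {q : ℂ} {B : Type*} [Semiring B] [Algebra ℂ B]
    (ρ : UqSl2Two q →ₐ[ℂ] B) (X : Fin 2 → B) : Prop where
  comm_rep : ∀ i u, X i * ρ u = ρ u * X i
  comm : X 0 * X 1 = X 1 * X 0
  quartic : ∀ i, q⁻¹ • X i ^ 4 + q • (1 : B) =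
    (q - q⁻¹) ^ 2 • (ρ (incl q i (casimir q)) * X i ^ 2)

/-- `T` extends the representation `ρ` of `U_q(sl₂)^{⊗2}` to `Û_q(sl₂)^{⊗2,ext}` by means of the
operators `X i` as the values on `x_i`. -/
def IsExtension {q : ℂ} {B : Type*} [Semiring B] [Algebra ℂ B]
    (ρ : UqSl2Two q →ₐ[ℂ] B) (X : Fin 2 → B) (T : UqExt q →ₐ[ℂ] B) : Prop :=
  T.comp (extIncl q) = ρ ∧ ∀ i, T (ext q (.x i)) = X i

/-! ### Construction of extensions -/

theorem inverse_swap {B : Type*} [Semiring B] {d d' a : B} (hd : IsUnit d) (hd' : IsUnit d')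
    (h : d * a = a * d') : Ring.inverse d * a = a * Ring.inverse d' := by
  calc Ring.inverse d * a = Ring.inverse d * (a * d') * Ring.inverse d' := by
        rw [mul_assoc, mul_assoc, Ring.mul_inverse_cancel _ hd', mul_one]
    _ = a * Ring.inverse d' := by
        rw [← h, ← mul_assoc, Ring.inverse_mul_cancel _ hd, one_mul]

theorem sumEl_comm_k {q : ℂ} (i : Fin 2) (j : ℤ) :
    sumEl q j * incl q i (sl2 q .k) = incl q i (sl2 q .k) * sumEl q j := by
  fin_cases i <;>
    simp [sumEl, incl, add_mul, mul_add, sl2_k_kinv, sl2_kinv_k, TensorProduct.smul_tmul']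

theorem sumEl_comm_kinv {q : ℂ} (i : Fin 2) (j : ℤ) :
    sumEl q j * incl q i (sl2 q .kinv) = incl q i (sl2 q .kinv) * sumEl q j := by
  fin_cases i <;>
    simp [sumEl, incl, add_mul, mul_add, sl2_k_kinv, sl2_kinv_k, TensorProduct.smul_tmul']

theorem diffEl_comm_k {q : ℂ} (i : Fin 2) (j : ℤ) :
    diffEl q j * incl q i (sl2 q .k) = incl q i (sl2 q .k) * diffEl q j := by
  fin_cases i <;>
    simp [diffEl, incl, add_mul, mul_add, sl2_k_kinv, sl2_kinv_k, TensorProduct.smul_tmul']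

theorem diffEl_comm_kinv {q : ℂ} (i : Fin 2) (j : ℤ) :
    diffEl q j * incl q i (sl2 q .kinv) = incl q i (sl2 q .kinv) * diffEl q j := by
  fin_cases i <;>
    simp [diffEl, incl, add_mul, mul_add, sl2_k_kinv, sl2_kinv_k, TensorProduct.smul_tmul']

theorem sumEl_e {q : ℂ} (hq : q ≠ 0) (i : Fin 2) (j : ℤ) :
    sumEl q j * incl q i (sl2 q .e) = incl q i (sl2 q .e) * sumEl q (j + 1) := by
  fin_cases i <;>
    simp [sumEl, incl, add_mul, mul_add, sl2_k_e, sl2_kinv_e hq, TensorProduct.smul_tmul',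
      smul_smul, zpow_add₀ hq, mul_comm]

theorem sumEl_f {q : ℂ} (hq : q ≠ 0) (i : Fin 2) (j : ℤ) :
    sumEl q j * incl q i (sl2 q .f) = incl q i (sl2 q .f) * sumEl q (j - 1) := by
  fin_cases i <;>
    simp [sumEl, incl, add_mul, mul_add, sl2_k_f, sl2_kinv_f hq, TensorProduct.smul_tmul',
      smul_smul, zpow_sub₀ hq, mul_comm, div_eq_mul_inv]

theorem diffEl_e {q : ℂ} (hq : q ≠ 0) (i : Fin 2) (j : ℤ) :
    diffEl q j * incl q i (sl2 q .e) = incl q i (sl2 q .e) * diffEl q (j + eps i) := by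
  fin_cases i <;>
    simp [diffEl, incl, eps, add_mul, mul_add, sl2_k_e, sl2_kinv_e hq, TensorProduct.smul_tmul',
      smul_smul, zpow_add₀ hq, mul_comm]

theorem diffEl_f {q : ℂ} (hq : q ≠ 0) (i : Fin 2) (j : ℤ) :
    diffEl q j * incl q i (sl2 q .f) = incl q i (sl2 q .f) * diffEl q (j - eps i) := by
  fin_cases i <;>
    simp [diffEl, incl, eps, add_mul, mul_add, sl2_k_f, sl2_kinv_f hq, TensorProduct.smul_tmul',
      smul_smul, zpow_sub₀ hq, zpow_add₀ hq, mul_comm, div_eq_mul_inv]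

theorem incl_zero_mul_one {q : ℂ} (u v : UqSl2 q) : incl q 0 u * incl q 1 v = u ⊗ₜ v := by
  simp [incl]

theorem sumEl_eq {q : ℂ} (j : ℤ) : sumEl q j =
    q ^ j • (incl q 0 (sl2 q .k) * incl q 1 (sl2 q .k)) +
      q ^ (-j) • (incl q 0 (sl2 q .kinv) * incl q 1 (sl2 q .kinv)) := by
  simp only [sumEl, incl_zero_mul_one]

theorem diffEl_eq {q : ℂ} (j : ℤ) : diffEl q j =
    q ^ j • (incl q 0 (sl2 q .k) * incl q 1 (sl2 q .kinv)) +
      q ^ (-j) • (incl q 0 (sl2 q .kinv) * incl q 1 (sl2 q .k)) := by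
  simp only [diffEl, incl_zero_mul_one]

theorem comm_sumEl {q : ℂ} {w : UqSl2Two q}
    (h1 : ∀ i, w * incl q i (sl2 q .k) = incl q i (sl2 q .k) * w)
    (h2 : ∀ i, w * incl q i (sl2 q .kinv) = incl q i (sl2 q .kinv) * w) (j : ℤ) :
    w * sumEl q j = sumEl q j * w := by
  have h1' : ∀ i, Commute w (incl q i (sl2 q .k)) := h1
  have h2' : ∀ i, Commute w (incl q i (sl2 q .kinv)) := h2
  rw [sumEl_eq]
  exact ((((h1' 0).mul_right (h1' 1)).smul_right _).add_right
    (((h2' 0).mul_right (h2' 1)).smul_right _)).eq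

theorem comm_diffEl {q : ℂ} {w : UqSl2Two q}
    (h1 : ∀ i, w * incl q i (sl2 q .k) = incl q i (sl2 q .k) * w)
    (h2 : ∀ i, w * incl q i (sl2 q .kinv) = incl q i (sl2 q .kinv) * w) (j : ℤ) :
    w * diffEl q j = diffEl q j * w := by
  have h1' : ∀ i, Commute w (incl q i (sl2 q .k)) := h1
  have h2' : ∀ i, Commute w (incl q i (sl2 q .kinv)) := h2
  rw [diffEl_eq]
  exact ((((h1' 0).mul_right (h2' 1)).smul_right _).add_right
    (((h2' 0).mul_right (h1' 1)).smul_right _)).eq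

section ExtLift

variable {q : ℂ} {B : Type*} [Semiring B] [Algebra ℂ B]

/-- The values on the generators of the extension of `ρ`: the elements `sumInv j`, `diffInv j` go
to the inverses of the operators `ρ (q^{H₁±H₂+j} + q^{-H₁∓H₂-j})`. -/
def extLiftGen (ρ : UqSl2Two q →ₐ[ℂ] B) (X : Fin 2 → B) : ExtGen → B
  | .s i g => ρ (incl q i (sl2 q g))
  | .x i => X i
  | .sumInv j => Ring.inverse (ρ (sumEl q j))
  | .diffInv j => Ring.inverse (ρ (diffEl q j))

theorem extLiftGen_comp (ρ : UqSl2Two q →ₐ[ℂ] B) (X : Fin 2 → B) (i : Fin 2)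
    (a : FreeAlgebra ℂ Sl2Gen) :
    FreeAlgebra.lift ℂ (extLiftGen ρ X) (FreeAlgebra.lift ℂ (fs i) a) =
      ρ (incl q i (RingQuot.mkAlgHom ℂ (Sl2Rel q) a)) := by
  have : (FreeAlgebra.lift ℂ (extLiftGen ρ X)).comp (FreeAlgebra.lift ℂ (fs i)) =
      (ρ.comp (incl q i)).comp (RingQuot.mkAlgHom ℂ (Sl2Rel q)) := by
    ext g
    simp [extLiftGen, sl2]
  exact DFunLike.congr_fun this a

/-- The extension to `Û_q(sl₂)^{⊗2,ext}` of a representation `ρ` of `U_q(sl₂)^{⊗2}`, given values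
of `x₁, x₂`, when all the elements to be inverted act by invertible operators. -/
def extLift (hq : q ≠ 0) (ρ : UqSl2Two q →ₐ[ℂ] B) (X : Fin 2 → B) (hX : IsQuarticSolution ρ X)
    (hs : ∀ j, IsUnit (ρ (sumEl q j))) (hd : ∀ j, IsUnit (ρ (diffEl q j))) :
    UqExt q →ₐ[ℂ] B :=
  RingQuot.liftAlgHom ℂ ⟨FreeAlgebra.lift ℂ (extLiftGen ρ X), by
    intro a b h
    cases h with
    | sl2 i a b h => rw [extLiftGen_comp, extLiftGen_comp, RingQuot.mkAlgHom_rel ℂ h]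
    | comm g h =>
      simp only [map_mul, FreeAlgebra.lift_ι_apply, extLiftGen]
      rw [← map_mul, ← map_mul]
      simp [incl]
    | x_s i j g => simpa [extLiftGen] using hX.comm_rep i _
    | x_x => simpa [extLiftGen] using hX.comm
    | quartic i => simpa [extLiftGen, casimir] using hX.quartic i
    | sumInv_mul j =>
      have := Ring.inverse_mul_cancel _ (hs j)
      nth_rw 2 [sumEl_eq] at this
      simpa [extLiftGen] using this
    | diffInv_mul j =>
      have := Ring.inverse_mul_cancel _ (hd j)
      nth_rw 2 [diffEl_eq] at this
      simpa [extLiftGen] using this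
    | sumInv_k i j =>
      simpa [extLiftGen] using inverse_swap (hs j) (hs j)
        (by rw [← map_mul, ← map_mul, sumEl_comm_k])
    | sumInv_kinv i j =>
      simpa [extLiftGen] using inverse_swap (hs j) (hs j)
        (by rw [← map_mul, ← map_mul, sumEl_comm_kinv])
    | diffInv_k i j =>
      simpa [extLiftGen] using inverse_swap (hd j) (hd j)
        (by rw [← map_mul, ← map_mul, diffEl_comm_k])
    | diffInv_kinv i j =>
      simpa [extLiftGen] using inverse_swap (hd j) (hd j)
        (by rw [← map_mul, ← map_mul, diffEl_comm_kinv])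
    | sumInv_e i j =>
      simpa [extLiftGen] using inverse_swap (hs j) (hs (j + 1))
        (by rw [← map_mul, ← map_mul, sumEl_e hq])
    | sumInv_f i j =>
      simpa [extLiftGen] using inverse_swap (hs j) (hs (j - 1))
        (by rw [← map_mul, ← map_mul, sumEl_f hq])
    | diffInv_e i j =>
      simpa [extLiftGen] using inverse_swap (hd j) (hd (j + eps i))
        (by rw [← map_mul, ← map_mul, diffEl_e hq])
    | diffInv_f i j =>
      simpa [extLiftGen] using inverse_swap (hd j) (hd (j - eps i))
        (by rw [← map_mul, ← map_mul, diffEl_f hq])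
    | sumInv_sumInv j k =>
      have h0 : ρ (sumEl q k) * ρ (sumEl q j) = ρ (sumEl q j) * ρ (sumEl q k) := by
        rw [← map_mul, ← map_mul,
          comm_sumEl (fun i => sumEl_comm_k i k) (fun i => sumEl_comm_kinv i k)]
      simpa [extLiftGen] using
        inverse_swap (hs j) (hs j) (inverse_swap (hs k) (hs k) h0).symm
    | sumInv_diffInv j k =>
      have h0 : ρ (diffEl q k) * ρ (sumEl q j) = ρ (sumEl q j) * ρ (diffEl q k) := by
        rw [← map_mul, ← map_mul,
          comm_sumEl (fun i => diffEl_comm_k i k) (fun i => diffEl_comm_kinv i k)]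
      simpa [extLiftGen] using
        inverse_swap (hs j) (hs j) (inverse_swap (hd k) (hd k) h0).symm
    | diffInv_diffInv j k =>
      have h0 : ρ (diffEl q k) * ρ (diffEl q j) = ρ (diffEl q j) * ρ (diffEl q k) := by
        rw [← map_mul, ← map_mul,
          comm_diffEl (fun i => diffEl_comm_k i k) (fun i => diffEl_comm_kinv i k)]
      simpa [extLiftGen] using
        inverse_swap (hd j) (hd j) (inverse_swap (hd k) (hd k) h0).symm⟩

theorem extLift_gen (hq : q ≠ 0) (ρ : UqSl2Two q →ₐ[ℂ] B) (X : Fin 2 → B) (hX hs hd)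
    (g : ExtGen) : extLift hq ρ X hX hs hd (ext q g) = extLiftGen ρ X g := by
  rw [extLift, ext, RingQuot.liftAlgHom_mkAlgHom_apply]
  simp

end ExtLift

/-! ### The representations `T_l` and `T_{jj'}` -/

/-- The `q`-number `[a]`, for an integer `a`. -/
def qnum (q : ℂ) (a : ℤ) : ℂ := (q ^ a - q ^ (-a)) / (q - q⁻¹)

/-- The space of `T_l` with `n = 2l`: the basis vector `|l,m⟩` is `Pi.single i 1`, where
`i = l + m` runs from `0` to `n`. -/
abbrev SpinSpace (n : ℕ) : Type := Fin (n + 1) → ℂ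

/-- The operator on the space of `T_l` with prescribed values on the basis vectors. -/
def spinOp (n : ℕ) (F : Fin (n + 1) → SpinSpace n) : Module.End ℂ (SpinSpace n) :=
  (Pi.basisFun ℂ (Fin (n + 1))).constr ℂ F

theorem spinOp_single (n : ℕ) (F : Fin (n + 1) → SpinSpace n) (i : Fin (n + 1)) :
    spinOp n F (Pi.single i 1) = F i := by
  have := (Pi.basisFun ℂ (Fin (n + 1))).constr_basis ℂ F i
  simpa only [spinOp, Pi.basisFun_apply] using this

/-- The operators of `T_l`, `n = 2l`, with `q = p²`:
`q^H |l,m⟩ = q^m |l,m⟩`, `e |l,m⟩ = [l-m] |l,m+1⟩`, `f |l,m⟩ = [l+m] |l,m-1⟩`. -/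
def spinGen (p : ℂ) (n : ℕ) : Sl2Gen → Module.End ℂ (SpinSpace n)
  | .k => spinOp n fun i => p ^ (2 * (i : ℤ) - n) • Pi.single i 1
  | .kinv => spinOp n fun i => p ^ (-(2 * (i : ℤ) - n)) • Pi.single i 1
  | .e => spinOp n fun i =>
      if h : (i : ℕ) < n then qnum (p ^ 2) ((n : ℤ) - i) • Pi.single ⟨i + 1, by omega⟩ 1 else 0
  | .f => spinOp n fun i =>
      if h : 0 < (i : ℕ) then qnum (p ^ 2) i • Pi.single ⟨i - 1, by omega⟩ 1 else 0

theorem spin_ext {n : ℕ} {V : Type*} [AddCommGroup V] [Module ℂ V]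
    {A B : SpinSpace n →ₗ[ℂ] V}
    (h : ∀ i, A (Pi.single i 1) = B (Pi.single i 1)) : A = B :=
  (Pi.basisFun ℂ (Fin (n + 1))).ext fun i => by simpa using h i

theorem spinGen_k (p : ℂ) (n : ℕ) (i : Fin (n + 1)) : spinGen p n .k (Pi.single i 1) =
    p ^ (2 * (i : ℤ) - n) • Pi.single i 1 := by
  simp only [spinGen, spinOp_single]

theorem spinGen_kinv (p : ℂ) (n : ℕ) (i : Fin (n + 1)) : spinGen p n .kinv (Pi.single i 1) =
    p ^ (-(2 * (i : ℤ) - n)) • Pi.single i 1 := by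
  simp only [spinGen, spinOp_single]

theorem spinGen_e (p : ℂ) (n : ℕ) (i : Fin (n + 1)) : spinGen p n .e (Pi.single i 1) =
    if h : (i : ℕ) < n then
      qnum (p ^ 2) ((n : ℤ) - i) • Pi.single ⟨i + 1, by omega⟩ 1 else 0 := by
  simp only [spinGen, spinOp_single]

theorem spinGen_f (p : ℂ) (n : ℕ) (i : Fin (n + 1)) : spinGen p n .f (Pi.single i 1) =
    if h : 0 < (i : ℕ) then
      qnum (p ^ 2) i • Pi.single ⟨i - 1, by omega⟩ 1 else 0 := by
  simp only [spinGen, spinOp_single]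

theorem spinGen_ef (p : ℂ) (n : ℕ) (i : Fin (n + 1)) :
    spinGen p n .e (spinGen p n .f (Pi.single i 1)) =
      (qnum (p ^ 2) i * qnum (p ^ 2) ((n : ℤ) - i + 1)) • Pi.single i 1 := by
  rw [spinGen_f]
  obtain ⟨i, hi⟩ := i
  rcases i with _ | i
  · simp [qnum]
  · have h1 : i < n := by omega
    simp only [Nat.succ_pos, dif_pos, map_smul, Nat.add_sub_cancel, spinGen_e, h1, smul_smul]
    congr 3
    push_cast
    ring

theorem spinGen_fe (p : ℂ) (n : ℕ) (i : Fin (n + 1)) :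
    spinGen p n .f (spinGen p n .e (Pi.single i 1)) =
      (qnum (p ^ 2) ((n : ℤ) - i) * qnum (p ^ 2) ((i : ℤ) + 1)) • Pi.single i 1 := by
  rw [spinGen_e]
  obtain ⟨i, hi⟩ := i
  by_cases h : i < n
  · simp only [h, Nat.succ_pos, dif_pos, map_smul, Nat.add_sub_cancel, spinGen_f, smul_smul]
    push_cast
    rfl
  · have : i = n := by omega
    subst this
    simp [qnum]

theorem qnum_identity {p : ℂ} (hp : p ≠ 0) (n i : ℤ) :
    qnum (p ^ 2) i * qnum (p ^ 2) (n - i + 1) - qnum (p ^ 2) (n - i) * qnum (p ^ 2) (i + 1) =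
      (p ^ 2 - (p ^ 2)⁻¹)⁻¹ * ((p ^ (2 * i - n)) ^ 2 - (p ^ (-(2 * i - n))) ^ 2) := by
  have hq : p ^ 2 ≠ 0 := pow_ne_zero 2 hp
  have e1 : (p ^ (2 * i - n)) ^ 2 = (p ^ 2) ^ i * (p ^ 2) ^ i / (p ^ 2) ^ n := by
    rw [← zpow_add₀ hq, ← zpow_sub₀ hq, ← zpow_natCast, ← zpow_mul, ← zpow_natCast p 2,
      ← zpow_mul]
    congr 1; push_cast; ring
  have e2 : (p ^ (-(2 * i - n))) ^ 2 = (p ^ 2) ^ n / ((p ^ 2) ^ i * (p ^ 2) ^ i) := by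
    rw [← zpow_add₀ hq, ← zpow_sub₀ hq, ← zpow_natCast, ← zpow_mul, ← zpow_natCast p 2,
      ← zpow_mul]
    congr 1; push_cast; ring
  rw [e1, e2]
  generalize p ^ 2 = q at hq
  simp only [qnum, neg_add, neg_sub, zpow_add₀ hq, zpow_sub₀ hq, zpow_neg, zpow_one]
  by_cases hs : q - q⁻¹ = 0
  · simp [hs]
  have hi : q ^ i ≠ 0 := zpow_ne_zero _ hq
  have hn : q ^ n ≠ 0 := zpow_ne_zero _ hq
  generalize q ^ i = u at hi
  generalize q ^ n = v at hn
  have hs' : q ^ 2 - 1 ≠ 0 := by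
    intro h
    apply hs
    field_simp
    simpa using h
  field_simp
  ring

/-- The representation `T_l = T_l^{(1)}` of `U_q(sl₂)`, where `n = 2l` and `q = p²`. -/
def spinRep (p : ℂ) (hp : p ≠ 0) (n : ℕ) : UqSl2 (p ^ 2) →ₐ[ℂ] Module.End ℂ (SpinSpace n) :=
  sl2Lift (p ^ 2) (spinGen p n)
    (spin_ext fun i => by
      simp only [Module.End.mul_apply, spinGen_k, spinGen_kinv, map_smul, smul_smul,
        ← zpow_add₀ hp, neg_add_cancel, zpow_zero, one_smul, Module.End.one_apply])
    (spin_ext fun i => by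
      simp only [Module.End.mul_apply, spinGen_k, spinGen_kinv, map_smul, smul_smul,
        ← zpow_add₀ hp, add_neg_cancel, zpow_zero, one_smul, Module.End.one_apply])
    (spin_ext fun i => by
      simp only [Module.End.mul_apply, LinearMap.smul_apply, spinGen_e, spinGen_k, map_smul]
      split_ifs with h
      · simp only [map_smul, spinGen_k, smul_smul]
        congr 1
        rw [← zpow_natCast p 2, ← mul_assoc, ← zpow_add₀ hp, mul_comm]
        congr 2
        push_cast
        ring
      · simp)
    (spin_ext fun i => by
      simp only [Module.End.mul_apply, LinearMap.smul_apply, spinGen_f, spinGen_k, map_smul]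
      split_ifs with h
      · simp only [map_smul, spinGen_k, smul_smul]
        congr 1
        rw [← zpow_natCast p 2, ← zpow_neg, ← mul_assoc, ← zpow_add₀ hp, mul_comm]
        congr 2
        push_cast [Nat.cast_pred h]
        ring
      · simp)
    (spin_ext fun i => by
      simp only [Module.End.mul_apply, LinearMap.smul_apply, LinearMap.sub_apply, pow_two,
        spinGen_k, spinGen_kinv, map_smul, smul_smul]
      rw [← pow_two p, spinGen_ef, spinGen_fe, ← sub_smul, ← sub_smul, smul_smul,
        qnum_identity hp, pow_two (p ^ (2 * (i : ℤ) - n)), pow_two (p ^ (-(2 * (i : ℤ) - n)))])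

theorem spinRep_gen (p : ℂ) (hp : p ≠ 0) (n : ℕ) (g : Sl2Gen) :
    spinRep p hp n (sl2 (p ^ 2) g) = spinGen p n g := sl2Lift_gen ..

/-- `q` is not a root of unity. -/
def NotRootOfUnity (q : ℂ) : Prop := ∀ n : ℕ, 0 < n → q ^ n ≠ 1

theorem NotRootOfUnity.sub_inv_ne_zero {q : ℂ} (h : NotRootOfUnity q) (hq : q ≠ 0) :
    q - q⁻¹ ≠ 0 := by
  intro h0
  apply h 2 (by norm_num)
  field_simp at h0
  linear_combination h0

theorem casimir_identity {p : ℂ} (hp : p ≠ 0) (hq : NotRootOfUnity (p ^ 2)) (n i : ℤ) :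
    qnum (p ^ 2) i * qnum (p ^ 2) (n - i + 1) + ((p ^ 2 - (p ^ 2)⁻¹) ^ 2)⁻¹ *
        ((p ^ 2)⁻¹ * (p ^ (2 * i - n)) ^ 2 + p ^ 2 * (p ^ (-(2 * i - n))) ^ 2) =
      ((p ^ 2) ^ (n + 1) + (p ^ 2) ^ (-(n + 1))) / (p ^ 2 - (p ^ 2)⁻¹) ^ 2 := by
  have hq0 : p ^ 2 ≠ 0 := pow_ne_zero 2 hp
  have hs := hq.sub_inv_ne_zero hq0
  have e1 : (p ^ (2 * i - n)) ^ 2 = (p ^ 2) ^ i * (p ^ 2) ^ i / (p ^ 2) ^ n := by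
    rw [← zpow_add₀ hq0, ← zpow_sub₀ hq0, ← zpow_natCast, ← zpow_mul, ← zpow_natCast p 2,
      ← zpow_mul]
    congr 1; push_cast; ring
  have e2 : (p ^ (-(2 * i - n))) ^ 2 = (p ^ 2) ^ n / ((p ^ 2) ^ i * (p ^ 2) ^ i) := by
    rw [← zpow_add₀ hq0, ← zpow_sub₀ hq0, ← zpow_natCast, ← zpow_mul, ← zpow_natCast p 2,
      ← zpow_mul]
    congr 1; push_cast; ring
  rw [e1, e2]
  clear hq
  generalize p ^ 2 = q at hq0 hs
  simp only [qnum, neg_add, neg_sub, zpow_add₀ hq0, zpow_sub₀ hq0, zpow_neg, zpow_one]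
  have hi : q ^ i ≠ 0 := zpow_ne_zero _ hq0
  have hn : q ^ n ≠ 0 := zpow_ne_zero _ hq0
  generalize q ^ i = u at hi
  generalize q ^ n = v at hn
  have hs' : q ^ 2 - 1 ≠ 0 := by
    intro h
    apply hs
    field_simp
    simpa using h
  field_simp
  ring

theorem spinRep_casimir {p : ℂ} (hp : p ≠ 0) (hq : NotRootOfUnity (p ^ 2)) (n : ℕ) :
    spinRep p hp n (casimir (p ^ 2)) =
      (((p ^ 2) ^ ((n : ℤ) + 1) + (p ^ 2) ^ (-((n : ℤ) + 1))) / (p ^ 2 - (p ^ 2)⁻¹) ^ 2) •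
        (1 : Module.End ℂ (SpinSpace n)) := by
  refine spin_ext fun i => ?_
  rw [← casimir_identity hp hq n i]
  simp only [casimir, map_add, map_smul, map_mul, map_pow, spinRep_gen, LinearMap.add_apply,
    LinearMap.smul_apply, Module.End.mul_apply, spinGen_ef, pow_two (spinGen p n _), spinGen_k,
    spinGen_kinv, Module.End.one_apply, smul_smul, ← add_smul]
  congr 1
  ring

/-- `T_{jj'} = T_j ⊗ T_{j'}` as a representation of `U_q(sl₂)^{⊗2}`, `n = 2j`, `n' = 2j'`. -/
def spinRepTwo (p : ℂ) (hp : p ≠ 0) (n n' : ℕ) :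
    UqSl2Two (p ^ 2) →ₐ[ℂ] Module.End ℂ (SpinSpace n ⊗[ℂ] SpinSpace n') :=
  repTensor (spinRep p hp n) (spinRep p hp n')

theorem tensor_ext {n n' : ℕ} {A B : Module.End ℂ (SpinSpace n ⊗[ℂ] SpinSpace n')}
    (h : ∀ i i', A (Pi.single i 1 ⊗ₜ Pi.single i' 1) = B (Pi.single i 1 ⊗ₜ Pi.single i' 1)) :
    A = B :=
  ((Pi.basisFun ℂ (Fin (n + 1))).tensorProduct (Pi.basisFun ℂ (Fin (n' + 1)))).ext
    fun x => by
      rw [Module.Basis.tensorProduct_apply']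
      simpa using h x.1 x.2

/-- An operator that is diagonal in the basis `|k,l⟩` with nonzero entries is invertible. -/
theorem isUnit_of_diagonal {n n' : ℕ} {A : Module.End ℂ (SpinSpace n ⊗[ℂ] SpinSpace n')}
    (d : Fin (n + 1) → Fin (n' + 1) → ℂ) (hd : ∀ i i', d i i' ≠ 0)
    (h : ∀ i i', A (Pi.single i 1 ⊗ₜ Pi.single i' 1) =
      d i i' • (Pi.single i 1 ⊗ₜ Pi.single i' 1)) : IsUnit A := by
  let b := (Pi.basisFun ℂ (Fin (n + 1))).tensorProduct (Pi.basisFun ℂ (Fin (n' + 1)))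
  let C : Module.End ℂ (SpinSpace n ⊗[ℂ] SpinSpace n') :=
    b.constr ℂ fun x => (d x.1 x.2)⁻¹ • b x
  have hb : ∀ i i', b (i, i') = Pi.single i 1 ⊗ₜ Pi.single i' 1 := by
    intro i i'
    simp [b]
  have hC : ∀ i i', C (Pi.single i 1 ⊗ₜ Pi.single i' 1) =
      (d i i')⁻¹ • (Pi.single i 1 ⊗ₜ Pi.single i' 1) := by
    intro i i'
    rw [← hb]
    exact b.constr_basis ℂ _ (i, i')
  refine ⟨⟨A, C, ?_, ?_⟩, rfl⟩
  · refine tensor_ext fun i i' => ?_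
    rw [Module.End.mul_apply, hC, map_smul, h, smul_smul, inv_mul_cancel₀ (hd i i'), one_smul,
      Module.End.one_apply]
  · refine tensor_ext fun i i' => ?_
    rw [Module.End.mul_apply, h, map_smul, hC, smul_smul, mul_inv_cancel₀ (hd i i'), one_smul,
      Module.End.one_apply]

theorem zpow_add_zpow_neg_ne_zero {p : ℂ} (hp : p ≠ 0) (hq : NotRootOfUnity (p ^ 2)) (a : ℤ) :
    p ^ a + p ^ (-a) ≠ 0 := by
  intro h
  have h1 : p ^ (2 * a) = -1 := by
    have := congrArg (p ^ a * ·) h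
    simp only [mul_add, ← zpow_add₀ hp, add_neg_cancel, zpow_zero, mul_zero] at this
    rw [two_mul]
    linear_combination this
  have h2 : p ^ (4 * a) = 1 := by
    rw [show (4 * a) = 2 * a + 2 * a by ring, zpow_add₀ hp, h1]
    norm_num
  rcases eq_or_ne a 0 with rfl | ha
  · norm_num at h1
  · apply hq (2 * a.natAbs) (by omega)
    have h3 : p ^ (4 * (a.natAbs : ℤ)) = 1 := by
      rcases Int.natAbs_eq a with h' | h'
      · rw [← h']; exact h2
      · have : (a.natAbs : ℤ) = -a := by omega
        rw [this, mul_neg, zpow_neg, h2, inv_one]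
    rw [← pow_mul, ← h3, ← zpow_natCast]
    congr 1
    push_cast
    ring

theorem isUnit_sumEl {p : ℂ} (hp : p ≠ 0) (hq : NotRootOfUnity (p ^ 2)) (n n' : ℕ) (j : ℤ) :
    IsUnit (spinRepTwo p hp n n' (sumEl (p ^ 2) j)) := by
  refine isUnit_of_diagonal (fun i i' =>
    p ^ (2 * j + (2 * (i : ℤ) - n) + (2 * (i' : ℤ) - n')) +
      p ^ (-(2 * j + (2 * (i : ℤ) - n) + (2 * (i' : ℤ) - n'))))
    (fun i i' => zpow_add_zpow_neg_ne_zero hp hq _) fun i i' => ?_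
  simp only [spinRepTwo, sumEl, map_add, map_smul, repTensor_tmul, spinRep_gen,
    LinearMap.add_apply, LinearMap.smul_apply, TensorProduct.map_tmul, spinGen_k, spinGen_kinv,
    TensorProduct.smul_tmul', TensorProduct.tmul_smul, smul_smul]
  rw [← TensorProduct.add_tmul, ← add_smul]
  congr 2
  rw [← zpow_natCast p 2, ← zpow_mul, ← zpow_mul, ← zpow_add₀ hp, ← zpow_add₀ hp, ← zpow_add₀ hp,
    ← zpow_add₀ hp]
  congr 2 <;> push_cast <;> ring

theorem isUnit_diffEl {p : ℂ} (hp : p ≠ 0) (hq : NotRootOfUnity (p ^ 2)) (n n' : ℕ) (j : ℤ) :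
    IsUnit (spinRepTwo p hp n n' (diffEl (p ^ 2) j)) := by
  refine isUnit_of_diagonal (fun i i' =>
    p ^ (2 * j + (2 * (i : ℤ) - n) - (2 * (i' : ℤ) - n')) +
      p ^ (-(2 * j + (2 * (i : ℤ) - n) - (2 * (i' : ℤ) - n'))))
    (fun i i' => zpow_add_zpow_neg_ne_zero hp hq _) fun i i' => ?_
  simp only [spinRepTwo, diffEl, map_add, map_smul, repTensor_tmul, spinRep_gen,
    LinearMap.add_apply, LinearMap.smul_apply, TensorProduct.map_tmul, spinGen_k, spinGen_kinv,
    TensorProduct.smul_tmul', TensorProduct.tmul_smul, smul_smul]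
  rw [← TensorProduct.add_tmul, ← add_smul]
  congr 2
  rw [← zpow_natCast p 2, ← zpow_mul, ← zpow_mul, ← zpow_add₀ hp, ← zpow_add₀ hp, ← zpow_add₀ hp,
    ← zpow_add₀ hp]
  congr 2 <;> push_cast <;> ring

/-- The operators `x₁ = q^{-j}` and `x₂ = q^{-j'}` on the space of `T_{jj'}`. -/
def spinX (p : ℂ) (n n' : ℕ) : Fin 2 → Module.End ℂ (SpinSpace n ⊗[ℂ] SpinSpace n')
  | 0 => p ^ (-(n : ℤ)) • 1
  | 1 => p ^ (-(n' : ℤ)) • 1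

theorem quartic_identity {p : ℂ} (hp : p ≠ 0) (hq : NotRootOfUnity (p ^ 2)) (n : ℤ) :
    (p ^ 2)⁻¹ * (p ^ (-n)) ^ 4 + p ^ 2 = (p ^ 2 - (p ^ 2)⁻¹) ^ 2 *
      (((p ^ 2) ^ (n + 1) + (p ^ 2) ^ (-(n + 1))) / (p ^ 2 - (p ^ 2)⁻¹) ^ 2 * (p ^ (-n)) ^ 2) := by
  have hs := hq.sub_inv_ne_zero (pow_ne_zero 2 hp)
  rw [← mul_assoc, mul_div_cancel₀ _ (pow_ne_zero 2 hs)]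
  have e : ∀ m : ℤ, (p ^ 2) ^ m = (p ^ m) ^ 2 := by
    intro m
    rw [← zpow_natCast, ← zpow_natCast, ← zpow_mul, ← zpow_mul, mul_comm]
  rw [e, e, neg_add, zpow_add₀ hp, zpow_add₀ hp, zpow_neg, zpow_neg, zpow_one]
  have hn : p ^ n ≠ 0 := zpow_ne_zero _ hp
  field_simp
  ring

theorem isQuarticSolution_spinX {p : ℂ} (hp : p ≠ 0) (hq : NotRootOfUnity (p ^ 2)) (n n' : ℕ) :
    IsQuarticSolution (spinRepTwo p hp n n') (spinX p n n') where
  comm_rep i u := by fin_cases i <;> simp [spinX]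
  comm := by simp [spinX, mul_comm, smul_smul]
  quartic i := by
    fin_cases i
    · have h : spinRepTwo p hp n n' (incl (p ^ 2) 0 (casimir (p ^ 2))) =
          (((p ^ 2) ^ ((n : ℤ) + 1) + (p ^ 2) ^ (-((n : ℤ) + 1))) / (p ^ 2 - (p ^ 2)⁻¹) ^ 2) •
            1 := by
        refine tensor_ext fun i i' => ?_
        simp only [spinRepTwo, incl, Algebra.TensorProduct.includeLeft_apply, repTensor_tmul,
          spinRep_casimir hp hq, map_one, TensorProduct.map_tmul, LinearMap.smul_apply,
          Module.End.one_apply, TensorProduct.smul_tmul']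
      simp only [Fin.zero_eta, h, spinX, smul_pow, one_pow, smul_mul_smul_comm, mul_one, smul_smul]
      rw [← quartic_identity hp hq, add_smul]
    · have h : spinRepTwo p hp n n' (incl (p ^ 2) 1 (casimir (p ^ 2))) =
          (((p ^ 2) ^ ((n' : ℤ) + 1) + (p ^ 2) ^ (-((n' : ℤ) + 1))) / (p ^ 2 - (p ^ 2)⁻¹) ^ 2) •
            1 := by
        refine tensor_ext fun i i' => ?_
        simp only [spinRepTwo, incl, Algebra.TensorProduct.includeRight_apply, repTensor_tmul,
          spinRep_casimir hp hq, map_one, TensorProduct.map_tmul, LinearMap.smul_apply,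
          Module.End.one_apply, TensorProduct.tmul_smul]
      simp only [Fin.mk_one, h, spinX, smul_pow, one_pow, smul_mul_smul_comm, mul_one, smul_smul]
      rw [← quartic_identity hp hq, add_smul]

/-- The representation `T^{(1,1)}_{jj'}` of `Û_q(sl₂)^{⊗2,ext}`, with `n = 2j`, `n' = 2j'`. -/
def extRep (p : ℂ) (hp : p ≠ 0) (hq : NotRootOfUnity (p ^ 2)) (n n' : ℕ) :
    UqExt (p ^ 2) →ₐ[ℂ] Module.End ℂ (SpinSpace n ⊗[ℂ] SpinSpace n') :=
  extLift (pow_ne_zero 2 hp) (spinRepTwo p hp n n') (spinX p n n')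
    (isQuarticSolution_spinX hp hq n n') (isUnit_sumEl hp hq n n') (isUnit_diffEl hp hq n n')

/-- The tensor product `T_{jj'} ⊗ T_{ss'}` of representations of `U_q(sl₂)^{⊗2}`, formed by means of
the comultiplication; `a = 2j`, `a' = 2j'`, `b = 2s`, `b' = 2s'`. -/
def tensorRep (p : ℂ) (hp : p ≠ 0) (a a' b b' : ℕ) : UqSl2Two (p ^ 2) →ₐ[ℂ]
    Module.End ℂ ((SpinSpace a ⊗[ℂ] SpinSpace a') ⊗[ℂ] (SpinSpace b ⊗[ℂ] SpinSpace b')) :=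
  (repTensor (spinRepTwo p hp a a') (spinRepTwo p hp b b')).comp
    (comulTwo (p ^ 2) (pow_ne_zero 2 hp))

/-! ### The algebra `U'_q(so₄)` and the homomorphism `φ` -/

/-- The generators `I₂₁, I₃₂, I₄₃`. -/
inductive So4Gen
  | I21 | I32 | I43

/-- For elements `A, B`: the expression `A B² - (q + q⁻¹) B A B + B² A`. -/
def serre {R : Type*} [Ring R] [Algebra ℂ R] (q : ℂ) (A B : R) : R :=
  A * B ^ 2 - (q + q⁻¹) • (B * A * B) + B ^ 2 * A

/-- The defining relations of `U'_q(so₄)`. -/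
inductive So4Rel (q : ℂ) : FreeAlgebra ℂ So4Gen → FreeAlgebra ℂ So4Gen → Prop
  | r2132 : So4Rel q (serre q (FreeAlgebra.ι ℂ .I21) (FreeAlgebra.ι ℂ .I32))
      (-FreeAlgebra.ι ℂ .I21)
  | r3221 : So4Rel q (serre q (FreeAlgebra.ι ℂ .I32) (FreeAlgebra.ι ℂ .I21))
      (-FreeAlgebra.ι ℂ .I32)
  | r3243 : So4Rel q (serre q (FreeAlgebra.ι ℂ .I32) (FreeAlgebra.ι ℂ .I43))
      (-FreeAlgebra.ι ℂ .I32)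
  | r4332 : So4Rel q (serre q (FreeAlgebra.ι ℂ .I43) (FreeAlgebra.ι ℂ .I32))
      (-FreeAlgebra.ι ℂ .I43)
  | comm : So4Rel q (FreeAlgebra.ι ℂ .I21 * FreeAlgebra.ι ℂ .I43)
      (FreeAlgebra.ι ℂ .I43 * FreeAlgebra.ι ℂ .I21)

/-- The nonstandard `q`-deformation `U'_q(so₄)`. -/
abbrev UqSo4 (q : ℂ) : Type := RingQuot (So4Rel q)

/-- The images of the generators in `U'_q(so₄)`. -/
def so4 (q : ℂ) (g : So4Gen) : UqSo4 q := RingQuot.mkAlgHom ℂ (So4Rel q) (FreeAlgebra.ι ℂ g)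

/-- The inverse of `x_i`: `x⁻¹ = (-x³ q⁻¹ + c (q - q⁻¹)² x) q⁻¹`. -/
def xInv (q : ℂ) (i : Fin 2) : UqExt q :=
  q⁻¹ • (-(q⁻¹ • ext q (.x i) ^ 3) + (q - q⁻¹) ^ 2 • (extOf q i (casimir q) * ext q (.x i)))

/-- The numerator `x_i⁻¹ q^{-H_m+1} + x_i q^{H_m-1}`. -/
def numDown (q : ℂ) (i m : Fin 2) : UqExt q :=
  q • (xInv q i * ext q (.s m .kinv)) + q⁻¹ • (ext q (.x i) * ext q (.s m .k))

/-- The numerator `x_i⁻¹ q^{H_m+1} + x_i q^{-H_m-1}`. -/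
def numUp (q : ℂ) (i m : Fin 2) : UqExt q :=
  q • (xInv q i * ext q (.s m .k)) + q⁻¹ • (ext q (.x i) * ext q (.s m .kinv))

/-- `φ` has the prescribed values on the generators:
`φ(I₂₁) = i [H₁+H₂]_q`, `φ(I₄₃) = i [H₁-H₂]_q`, and `φ(I₃₂)` is the sum of four fractions
(numerators and inverse denominators commute) multiplied from the right by `e₂, f₂, e₁, f₁`. -/
structure IsPhi (q : ℂ) (φ : UqSo4 q →ₐ[ℂ] UqExt q) : Prop where
  I21 : φ (so4 q .I21) = (Complex.I / (q - q⁻¹)) •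
    (ext q (.s 0 .k) * ext q (.s 1 .k) - ext q (.s 0 .kinv) * ext q (.s 1 .kinv))
  I43 : φ (so4 q .I43) = (Complex.I / (q - q⁻¹)) •
    (ext q (.s 0 .k) * ext q (.s 1 .kinv) - ext q (.s 0 .kinv) * ext q (.s 1 .k))
  I32 : φ (so4 q .I32) =
    -(numDown q 0 1 * ext q (.sumInv (-1)) * ext q (.diffInv 1) * ext q (.s 1 .e))
    + numUp q 0 1 * ext q (.sumInv 1) * ext q (.diffInv (-1)) * ext q (.s 1 .f)
    + numDown q 1 0 * ext q (.sumInv (-1)) * ext q (.diffInv (-1)) * ext q (.s 0 .e)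
    - numUp q 1 0 * ext q (.sumInv 1) * ext q (.diffInv 1) * ext q (.s 0 .f)

/-- The representation `R_{jj'} = T^{(1,1)}_{jj'} ∘ φ` of `U'_q(so₄)`, `n = 2j`, `n' = 2j'`. -/
def so4Rep (p : ℂ) (hp : p ≠ 0) (hq : NotRootOfUnity (p ^ 2))
    (φ : UqSo4 (p ^ 2) →ₐ[ℂ] UqExt (p ^ 2)) (n n' : ℕ) :
    UqSo4 (p ^ 2) →ₐ[ℂ] Module.End ℂ (SpinSpace n ⊗[ℂ] SpinSpace n') :=
  (extRep p hp hq n n').comp φ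

/-- The doubles `2k` of the numbers `k = |j-s|, |j-s|+1, …, j+s`, where `a = 2j`, `b = 2s`. -/
def spinRange (a b : ℕ) : Finset ℕ :=
  (Finset.Icc (max a b - min a b) (a + b)).filter fun K => K % 2 = (a + b) % 2

end

end QSo4

open QSo4

/-! Write q = p². In the extended algebra the elements q^{±H_i}, x_i and the inverse denominators
behave like functions on a weight lattice, while e_i and f_i shift the weights. Thus φ(I₂₁) and
φ(I₄₃) are multiples of the q-numbers of H₁+H₂ and H₁-H₂, and φ(I₃₂) is a combination of four
elementary shifts.

The relations linear in I₃₂ only use [h+1]² - (q+q⁻¹)[h][h+1] + [h]² = 1. In a relation quadratic in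
I₃₂ the terms that move the weight by ±2 cancel, because [h+2] + [h] = (q+q⁻¹)[h+1]. What remains is
essentially the commutator of the raising and the lowering part of I₃₂. It is evaluated by (q-q⁻¹)²
U_i W_i = (γ_j + A_i)(γ_i - A_i), where γ_i = q⁻¹x_i² + q x_i⁻² = (q-q⁻¹)²c_i and A_i depends on the
weight only; the γ's drop out (`comm_identity`, `bracket_up_down`). Replacing H₂ by -H₂ fixes φ(I₃₂)
and swaps φ(I₂₁) with φ(I₄₃), so only the relations with I₂₁ have to be computed
(`ShiftSystem.flip`).

In R_{jj'} the basis vectors have pairwise distinct joint eigenvalues under I₂₁ and I₄₃, since q is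
not a root of unity. A nonzero invariant subspace therefore contains a basis vector, and I₃₂ joins
neighbouring basis vectors with nonzero coefficients.

For the tensor product, exchanging the middle factors turns T into the outer product of T_j ⊗ T_s
and T_{j'} ⊗ T_{s'}. Clebsch–Gordan (`coupledRep_equiv`) makes it a multiplicity-free sum of the
T_{kk'}. The operators X_i commute with everything, so they are scalars on each summand
(`exists_scalars`), and since the inverses of the denominators are forced, the extension is the sum
of extensions of the T_{kk'} with scalar x₁, x₂. These scalars solve the quartic but need not be
q^{-k}, q^{-k'}. They enter I₃₂ through coefficients whose product along a step up and back down
depends on x only through q⁻¹x² + q x⁻², a number fixed by the Casimir element. Hence a diagonal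
change of basis in each factor carries any admissible roots to the standard ones (`exists_gauge`,
`repEquiv_extension`). -/

namespace QSo4

noncomputable section

/-! ### Relations of U'_q(so₄) from abstract weight shifts -/

/-- Elements `U i`, `W i` raising and lowering the weights `k i`, together with inverses `s j`,
`d j` of `q^j k₀ k₁ + q^{-j} k₀⁻¹ k₁⁻¹` and `q^j k₀ k₁⁻¹ + q^{-j} k₀⁻¹ k₁`. -/
structure ShiftSystem (q : ℂ) (B : Type*) [Ring B] [Algebra ℂ B] where
  k : Fin 2 → B
  k' : Fin 2 → B
  U : Fin 2 → B
  W : Fin 2 → B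
  γ : Fin 2 → B
  s : ℤ → B
  d : ℤ → B
  k_k' : ∀ i, k i * k' i = 1
  k'_k : ∀ i, k' i * k i = 1
  kk : Commute (k 0) (k 1)
  kk' : Commute (k 0) (k' 1)
  k'k : Commute (k' 0) (k 1)
  k'k' : Commute (k' 0) (k' 1)
  k_U : ∀ i, k i * U i = q • (U i * k i)
  k_W : ∀ i, k i * W i = q⁻¹ • (W i * k i)
  k'_U : ∀ i, k' i * U i = q⁻¹ • (U i * k' i)
  k'_W : ∀ i, k' i * W i = q • (W i * k' i)
  kU : ∀ i j, i ≠ j → Commute (k i) (U j)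
  kW : ∀ i j, i ≠ j → Commute (k i) (W j)
  k'U : ∀ i j, i ≠ j → Commute (k' i) (U j)
  k'W : ∀ i j, i ≠ j → Commute (k' i) (W j)
  UU : Commute (U 0) (U 1)
  UW : Commute (U 0) (W 1)
  WU : Commute (W 0) (U 1)
  WW : Commute (W 0) (W 1)
  sk : ∀ i j, Commute (s j) (k i)
  sk' : ∀ i j, Commute (s j) (k' i)
  dk : ∀ i j, Commute (d j) (k i)
  dk' : ∀ i j, Commute (d j) (k' i)
  ss : ∀ i j, Commute (s i) (s j)
  sd : ∀ i j, Commute (s i) (d j)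
  dd : ∀ i j, Commute (d i) (d j)
  s_mul : ∀ j, s j * (q ^ j • (k 0 * k 1) + q ^ (-j) • (k' 0 * k' 1)) = 1
  d_mul : ∀ j, d j * (q ^ j • (k 0 * k' 1) + q ^ (-j) • (k' 0 * k 1)) = 1
  s_U : ∀ i j, s j * U i = U i * s (j + 1)
  s_W : ∀ i j, s j * W i = W i * s (j - 1)
  d_U0 : ∀ j, d j * U 0 = U 0 * d (j + 1)
  d_W0 : ∀ j, d j * W 0 = W 0 * d (j - 1)
  d_U1 : ∀ j, d j * U 1 = U 1 * d (j - 1)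
  d_W1 : ∀ j, d j * W 1 = W 1 * d (j + 1)
  γk : ∀ i j, Commute (γ i) (k j)
  γk' : ∀ i j, Commute (γ i) (k' j)
  γs : ∀ i j, Commute (γ i) (s j)
  γd : ∀ i j, Commute (γ i) (d j)
  γγ : Commute (γ 0) (γ 1)
  U_W : ∀ i j, i ≠ j → (q - q⁻¹) ^ 2 • (U i * W i) =
    (γ j + (q⁻¹ • k i ^ 2 + q • k' i ^ 2)) * (γ i - (q⁻¹ • k i ^ 2 + q • k' i ^ 2))
  W_U : ∀ i j, i ≠ j → (q - q⁻¹) ^ 2 • (W i * U i) =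
    (γ j + (q • k i ^ 2 + q⁻¹ • k' i ^ 2)) * (γ i - (q • k i ^ 2 + q⁻¹ • k' i ^ 2))

namespace ShiftSystem

variable {q : ℂ} {B : Type*} [Ring B] [Algebra ℂ B] (D : ShiftSystem q B)

/-- The symmetry inverting the second weight. -/
def flip : ShiftSystem q B where
  k := ![D.k 0, D.k' 1]
  k' := ![D.k' 0, D.k 1]
  U := ![D.U 0, -D.W 1]
  W := ![D.W 0, -D.U 1]
  γ := D.γ
  s := D.d
  d := D.s
  k_k' := by simp [Fin.forall_fin_two, D.k_k', D.k'_k]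
  k'_k := by simp [Fin.forall_fin_two, D.k_k', D.k'_k]
  kk := D.kk'
  kk' := D.kk
  k'k := D.k'k'
  k'k' := D.k'k
  k_U := by simp [Fin.forall_fin_two, D.k_U, D.k'_W]
  k_W := by simp [Fin.forall_fin_two, D.k_W, D.k'_U]
  k'_U := by simp [Fin.forall_fin_two, D.k'_U, D.k_W]
  k'_W := by simp [Fin.forall_fin_two, D.k'_W, D.k_U]
  kU := by simp [Fin.forall_fin_two, D.kW, D.k'U]
  kW := by simp [Fin.forall_fin_two, D.kU, D.k'W]
  k'U := by simp [Fin.forall_fin_two, D.kU, D.k'W]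
  k'W := by simp [Fin.forall_fin_two, D.kW, D.k'U]
  UU := by simp [D.UW]
  UW := by simp [D.UU]
  WU := by simp [D.WW]
  WW := by simp [D.WU]
  sk := by simp [Fin.forall_fin_two, D.dk, D.dk']
  sk' := by simp [Fin.forall_fin_two, D.dk, D.dk']
  dk := by simp [Fin.forall_fin_two, D.sk, D.sk']
  dk' := by simp [Fin.forall_fin_two, D.sk, D.sk']
  ss := D.dd
  sd i j := (D.sd j i).symm
  dd := D.ss
  s_mul := D.d_mul
  d_mul := D.s_mul
  s_U := by simp [Fin.forall_fin_two, D.d_U0, D.d_W1]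
  s_W := by simp [Fin.forall_fin_two, D.d_W0, D.d_U1]
  d_U0 := D.s_U 0
  d_W0 := D.s_W 0
  d_U1 := by simp [D.s_W]
  d_W1 := by simp [D.s_U]
  γk := by simp [Fin.forall_fin_two, D.γk, D.γk']
  γk' := by simp [Fin.forall_fin_two, D.γk, D.γk']
  γs := D.γd
  γd := D.γs
  γγ := D.γγ
  U_W i j h := by
    fin_cases i
    · simpa using D.U_W 0 j h
    -- For the second weight U W becomes (-W)(-U), and inverting `k 1` exchanges the two right-hand
    -- sides of `U_W` and `W_U`.
    · simpa [add_comm] using D.W_U 1 j h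
  W_U i j h := by
    fin_cases i
    · simpa using D.W_U 0 j h
    · simpa [add_comm] using D.U_W 1 j h

/-- The part of the operator `I₃₂` raising the sum of the weights, without its first
denominator. -/
def up : B := D.d (-1) * D.U 0 - D.d 1 * D.U 1

/-- The part of the operator `I₃₂` lowering the sum of the weights, without its first
denominator. -/
def down : B := D.d (-1) * D.W 1 - D.d 1 * D.W 0

/-- The image of `I₃₂`. -/
def I32 : B := D.s (-1) * D.up + D.s 1 * D.down

/-- The image of `I₂₁`. -/
def I21 : B := (Complex.I / (q - q⁻¹)) • (D.k 0 * D.k 1 - D.k' 0 * D.k' 1)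

/-- The flip moves the terms with `U 1` and `W 1` between the raising and the lowering part, and the
signs in its definition match those in `up` and `down`. Hence every relation between I₂₁ and I₃₂
yields one between I₄₃ and I₃₂. -/
theorem I32_flip : D.flip.I32 = D.I32 := by
  simp only [I32, up, down, flip, Matrix.cons_val_zero, Matrix.cons_val_one, mul_neg, mul_sub,
    mul_add, sub_neg_eq_add, ← mul_assoc, (D.sd _ _).eq]
  abel

theorem weight_comm {a b c a' : B} {t : ℂ} (h1 : a * c = t • (c * a)) (h2 : Commute b c)
    (h : a' = a * b) : a' * c = t • (c * a') := by
  rw [h, mul_assoc, h2.eq, ← mul_assoc, h1, smul_mul_assoc, mul_assoc]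

theorem weight_comm' {a b c a' : B} {t : ℂ} (h1 : b * c = t • (c * b)) (h2 : Commute a c)
    (h : a' = a * b) : a' * c = t • (c * a') := by
  rw [h, mul_assoc, h1, mul_smul_comm, ← mul_assoc, h2.eq, mul_assoc]

theorem weight_U (i : Fin 2) : D.k 0 * D.k 1 * D.U i = q • (D.U i * (D.k 0 * D.k 1)) := by
  fin_cases i
  · exact weight_comm (D.k_U 0) (D.kU 1 0 (by decide)) rfl
  · exact weight_comm' (D.k_U 1) (D.kU 0 1 (by decide)) rfl

theorem weight_W (i : Fin 2) : D.k 0 * D.k 1 * D.W i = q⁻¹ • (D.W i * (D.k 0 * D.k 1)) := by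
  fin_cases i
  · exact weight_comm (D.k_W 0) (D.kW 1 0 (by decide)) rfl
  · exact weight_comm' (D.k_W 1) (D.kW 0 1 (by decide)) rfl

theorem weight'_U (i : Fin 2) :
    D.k' 0 * D.k' 1 * D.U i = q⁻¹ • (D.U i * (D.k' 0 * D.k' 1)) := by
  fin_cases i
  · exact weight_comm (D.k'_U 0) (D.k'U 1 0 (by decide)) rfl
  · exact weight_comm' (D.k'_U 1) (D.k'U 0 1 (by decide)) rfl

theorem weight'_W (i : Fin 2) :
    D.k' 0 * D.k' 1 * D.W i = q • (D.W i * (D.k' 0 * D.k' 1)) := by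
  fin_cases i
  · exact weight_comm (D.k'_W 0) (D.k'W 1 0 (by decide)) rfl
  · exact weight_comm' (D.k'_W 1) (D.k'W 0 1 (by decide)) rfl

theorem weight_mul_sub {a c₁ c₂ u₁ u₂ : B} {t : ℂ} (h1 : Commute a c₁) (h2 : Commute a c₂)
    (h3 : a * u₁ = t • (u₁ * a)) (h4 : a * u₂ = t • (u₂ * a)) :
    a * (c₁ * u₁ - c₂ * u₂) = t • ((c₁ * u₁ - c₂ * u₂) * a) := by
  rw [mul_sub, ← mul_assoc, ← mul_assoc, h1.eq, h2.eq, mul_assoc, mul_assoc, h3, h4, sub_mul,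
    smul_sub, mul_smul_comm, mul_smul_comm, mul_assoc, mul_assoc]

theorem sum_d (j : ℤ) : Commute (D.k 0 * D.k 1) (D.d j) :=
  ((D.dk 0 j).mul_right (D.dk 1 j)).symm

theorem sum'_d (j : ℤ) : Commute (D.k' 0 * D.k' 1) (D.d j) :=
  ((D.dk' 0 j).mul_right (D.dk' 1 j)).symm

theorem weight_up : D.k 0 * D.k 1 * D.up = q • (D.up * (D.k 0 * D.k 1)) :=
  weight_mul_sub (D.sum_d _) (D.sum_d _) (D.weight_U 0) (D.weight_U 1)

theorem weight_down : D.k 0 * D.k 1 * D.down = q⁻¹ • (D.down * (D.k 0 * D.k 1)) :=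
  weight_mul_sub (D.sum_d _) (D.sum_d _) (D.weight_W 1) (D.weight_W 0)

theorem weight'_up : D.k' 0 * D.k' 1 * D.up = q⁻¹ • (D.up * (D.k' 0 * D.k' 1)) :=
  weight_mul_sub (D.sum'_d _) (D.sum'_d _) (D.weight'_U 0) (D.weight'_U 1)

theorem weight'_down : D.k' 0 * D.k' 1 * D.down = q • (D.down * (D.k' 0 * D.k' 1)) :=
  weight_mul_sub (D.sum'_d _) (D.sum'_d _) (D.weight'_W 1) (D.weight'_W 0)

theorem s_up (j : ℤ) : D.s j * D.up = D.up * D.s (j + 1) := by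
  simp only [up, mul_sub, sub_mul, ← mul_assoc, (D.sd _ _).eq]
  simp only [mul_assoc, D.s_U]

theorem s_down (j : ℤ) : D.s j * D.down = D.down * D.s (j - 1) := by
  simp only [down, mul_sub, sub_mul, ← mul_assoc, (D.sd _ _).eq]
  simp only [mul_assoc, D.s_W]

/-- With P, Q the two weight expressions, (g₁+P)(g₀-P) - (g₀+Q)(g₁-Q) = (P+Q)(g₀-g₁-P+Q). The factor
P+Q contains exactly the denominator inverted by d₁ (by d₂ for the second bracket). After this
cancellation g₀-g₁ occurs with both signs and disappears, and the remaining difference of weights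
contains the denominator inverted by d₀. -/
theorem comm_identity {R : Type*} [CommRing R] {t t' a a' b b' g₀ g₁ d₀ d₁ d₂ : R}
    (ha : a * a' = 1) (hb : b * b' = 1)
    (h₀ : d₀ * (a * b' + a' * b) = 1) (h₁ : d₁ * (t * (a * b') + t' * (a' * b)) = 1)
    (h₂ : d₂ * (t' * (a * b') + t * (a' * b)) = 1) :
    d₀ * d₁ * ((g₁ + (t * a ^ 2 + t' * a' ^ 2)) * (g₀ - (t * a ^ 2 + t' * a' ^ 2)) -
        (g₀ + (t' * b ^ 2 + t * b' ^ 2)) * (g₁ - (t' * b ^ 2 + t * b' ^ 2))) +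
      d₀ * d₂ * ((g₀ + (t * b ^ 2 + t' * b' ^ 2)) * (g₁ - (t * b ^ 2 + t' * b' ^ 2)) -
        (g₁ + (t' * a ^ 2 + t * a' ^ 2)) * (g₀ - (t' * a ^ 2 + t * a' ^ 2))) =
      -((t - t') * ((a * b) ^ 2 - (a' * b') ^ 2)) := by
  have e₁ : t * a ^ 2 + t' * a' ^ 2 + (t' * b ^ 2 + t * b' ^ 2) =
      (t * (a * b') + t' * (a' * b)) * (a * b + a' * b') := by
    linear_combination (-t' * b ^ 2 - t * b' ^ 2) * ha + (-t * a ^ 2 - t' * a' ^ 2) * hb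
  have e₂ : t' * a ^ 2 + t * a' ^ 2 + (t * b ^ 2 + t' * b' ^ 2) =
      (t' * (a * b') + t * (a' * b)) * (a * b + a' * b') := by
    linear_combination (-t * b ^ 2 - t' * b' ^ 2) * ha + (-t' * a ^ 2 - t * a' ^ 2) * hb
  have e₃ : a ^ 2 - a' ^ 2 + b ^ 2 - b' ^ 2 = (a * b' + a' * b) * (a * b - a' * b') := by
    linear_combination (-b ^ 2 + b' ^ 2) * ha + (-a ^ 2 + a' ^ 2) * hb
  linear_combination
    (d₀ * d₁ * (g₀ - g₁ - (t * a ^ 2 + t' * a' ^ 2) + (t' * b ^ 2 + t * b' ^ 2))) * e₁ +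
    (d₀ * d₂ * (g₁ - g₀ + (t' * a ^ 2 + t * a' ^ 2) - (t * b ^ 2 + t' * b' ^ 2))) * e₂ +
    (d₀ * (a * b + a' * b') *
      (g₀ - g₁ - (t * a ^ 2 + t' * a' ^ 2) + (t' * b ^ 2 + t * b' ^ 2))) * h₁ +
    (d₀ * (a * b + a' * b') *
      (g₁ - g₀ + (t' * a ^ 2 + t * a' ^ 2) - (t * b ^ 2 + t' * b' ^ 2))) * h₂ -
    (d₀ * (a * b + a' * b') * (t - t')) * e₃ -
    ((a * b + a' * b') * (t - t') * (a * b - a' * b')) * h₀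

/-- The commuting elements among the data. -/
def torus : Set B := {D.k 0, D.k' 0, D.k 1, D.k' 1, D.γ 0, D.γ 1, D.d 0, D.d 1, D.d (-1)}

theorem torus_comm : ∀ a ∈ D.torus, ∀ b ∈ D.torus, a * b = b * a := by
  have h : ∀ i, D.k i * D.k' i = D.k' i * D.k i := fun i => by rw [D.k_k', D.k'_k]
  simp only [torus, Set.mem_insert_iff, Set.mem_singleton_iff, forall_eq_or_imp, forall_eq,
    h, D.kk.eq, D.kk'.eq, D.k'k.eq, D.k'k'.eq, D.γγ.eq, (D.dk _ _).eq, (D.dk' _ _).eq,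
    (D.γk _ _).eq, (D.γk' _ _).eq, (D.γd _ _).eq, (D.dd 0 1).eq, (D.dd 0 (-1)).eq,
    (D.dd 1 (-1)).eq, and_self]

/-- The mixed products of `U 0`, `W 1` and of `U 1`, `W 0` cancel in the commutator. The others are
products U W or W U, hence lie in the commutative subalgebra generated by `torus`, where
`comm_identity` applies with t = q, t' = q⁻¹. -/
theorem bracket_up_down (hs : q - q⁻¹ ≠ 0) :
    (q - q⁻¹) • (D.up * D.down - D.down * D.up) =
      -((D.k 0 * D.k 1) ^ 2 - (D.k' 0 * D.k' 1) ^ 2) := by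
  have h1 : D.up * D.down - D.down * D.up =
      D.d 0 * D.d 1 * (D.W 0 * D.U 0 - D.U 1 * D.W 1) +
        D.d 0 * D.d (-1) * (D.W 1 * D.U 1 - D.U 0 * D.W 0) := by
    -- Moving each d to the left shifts its index; all surviving terms carry `d 0` together with `d
    -- 1` or `d (-1)`.
    have a1 : ∀ j u, D.U 0 * (D.d j * u) = D.d (j - 1) * (D.U 0 * u) := fun j u => by
      rw [← mul_assoc, ← mul_assoc, D.d_U0, sub_add_cancel]
    have a2 : ∀ j u, D.U 1 * (D.d j * u) = D.d (j + 1) * (D.U 1 * u) := fun j u => by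
      rw [← mul_assoc, ← mul_assoc, D.d_U1, add_sub_cancel_right]
    have a3 : ∀ j u, D.W 0 * (D.d j * u) = D.d (j + 1) * (D.W 0 * u) := fun j u => by
      rw [← mul_assoc, ← mul_assoc, D.d_W0, add_sub_cancel_right]
    have a4 : ∀ j u, D.W 1 * (D.d j * u) = D.d (j - 1) * (D.W 1 * u) := fun j u => by
      rw [← mul_assoc, ← mul_assoc, D.d_W1, sub_add_cancel]
    have c1 : D.d 1 * D.d 0 = D.d 0 * D.d 1 := (D.dd 1 0).eq
    have c2 : D.d (-1) * D.d 0 = D.d 0 * D.d (-1) := (D.dd _ 0).eq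
    simp only [up, down, mul_sub, sub_mul, mul_assoc, a1, a2, a3, a4]
    simp only [← mul_assoc, Int.reduceNeg, Int.reduceSub, Int.reduceAdd, c1, c2]
    simp only [mul_assoc, D.UW.eq, D.WU.eq]
    abel
  have ht : ∀ x ∈ D.torus, x ∈ Algebra.adjoin ℂ D.torus := fun x hx => Algebra.subset_adjoin hx
  have hc := Algebra.isMulCommutative_adjoin ℂ D.torus_comm
  -- The identity is proved by commutative algebra, so it is applied inside the subalgebra and then
  -- pushed forward to `B`.
  let _ : CommRing (Algebra.adjoin ℂ D.torus) :=
    { (inferInstance : Ring (Algebra.adjoin ℂ D.torus)) with mul_comm := hc.is_comm.comm }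
  let A := Algebra.adjoin ℂ D.torus
  let a : A := ⟨D.k 0, ht _ (by simp [torus])⟩
  let a' : A := ⟨D.k' 0, ht _ (by simp [torus])⟩
  let b : A := ⟨D.k 1, ht _ (by simp [torus])⟩
  let b' : A := ⟨D.k' 1, ht _ (by simp [torus])⟩
  let g₀ : A := ⟨D.γ 0, ht _ (by simp [torus])⟩
  let g₁ : A := ⟨D.γ 1, ht _ (by simp [torus])⟩
  let d₀ : A := ⟨D.d 0, ht _ (by simp [torus])⟩
  let d₁ : A := ⟨D.d 1, ht _ (by simp [torus])⟩
  let d₂ : A := ⟨D.d (-1), ht _ (by simp [torus])⟩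
  have key := comm_identity (R := A) (t := algebraMap ℂ A q) (t' := algebraMap ℂ A q⁻¹)
    (a := a) (a' := a') (b := b) (b' := b') (g₀ := g₀) (g₁ := g₁) (d₀ := d₀) (d₁ := d₁) (d₂ := d₂)
    (Subtype.ext (D.k_k' 0)) (Subtype.ext (D.k_k' 1))
    (Subtype.ext (by simpa using D.d_mul 0))
    (Subtype.ext (by simpa [Algebra.smul_def] using D.d_mul 1))
    (Subtype.ext (by simpa [Algebra.smul_def] using D.d_mul (-1)))
  have key' := congrArg A.val key
  simp only [map_add, map_sub, map_mul, map_neg, map_pow, AlgHom.commutes, ← Algebra.smul_def,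
    map_smul, Subalgebra.coe_val, a, a', b, b', g₀, g₁, d₀, d₁, d₂] at key'
  rw [← map_sub, ← Algebra.smul_def, ← D.W_U 0 1 (by decide), ← D.W_U 1 0 (by decide),
    ← D.U_W 0 1 (by decide), ← D.U_W 1 0 (by decide), ← smul_sub, ← smul_sub, mul_smul_comm,
    mul_smul_comm, ← smul_add, ← h1, pow_two, mul_smul, ← smul_neg] at key'
  exact smul_right_injective B hs key'

/-- Moving P to the left replaces L, L' by t L, t⁻¹ L', i.e. shifts h to h+1 in c(L-L'), which is
i[h] in the intended case. What is left is the negative of [h+1]² - (q+q⁻¹)[h][h+1] + [h]² = 1, the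
sign coming from c²(t-t⁻¹)² = -1. -/
theorem serre_weight {t c : ℂ} {P L L' : B} (ht : t ≠ 0) (hc : c ^ 2 * (t - t⁻¹) ^ 2 = -1)
    (h1 : L * L' = 1) (h2 : L' * L = 1) (h3 : L * P = t • (P * L))
    (h4 : L' * P = t⁻¹ • (P * L')) :
    P * (c • (L - L')) ^ 2 - (t + t⁻¹) • (c • (L - L') * P * (c • (L - L'))) +
      (c • (L - L')) ^ 2 * P = -P := by
  have h5 : c • (L - L') * P = P * (c • (t • L - t⁻¹ • L')) := by
    rw [smul_mul_assoc, sub_mul, h3, h4, mul_smul_comm, mul_sub, mul_smul_comm, mul_smul_comm]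
  have h6 : (c • (L - L')) ^ 2 * P = P * (c • (t • L - t⁻¹ • L')) ^ 2 := by
    rw [pow_two, mul_assoc, h5, ← mul_assoc, h5, mul_assoc, ← pow_two]
  have h7 : (c • (L - L')) ^ 2 - (t + t⁻¹) • (c • (t • L - t⁻¹ • L') * (c • (L - L'))) +
      (c • (t • L - t⁻¹ • L')) ^ 2 = -1 := by
    rw [show (-1 : B) = (c ^ 2 * (t - t⁻¹) ^ 2) • 1 by rw [hc, neg_smul, one_smul]]
    simp only [pow_two (_ • _), mul_sub, sub_mul, mul_smul_comm,
      smul_mul_assoc, h1, h2]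
    match_scalars <;> field_simp <;> ring
  rw [h5, h6, mul_assoc, ← mul_smul_comm, ← mul_sub, ← mul_add, h7, mul_neg, mul_one]

/-- P raises and M lowers. The terms in P² and M² vanish by [h+2] + [h] = (q+q⁻¹)[h+1]. In the terms
with P M and M P, moving L and L' to the right leaves c times the left side of `h`. -/
theorem serre_bracket {c : ℂ} {P M L L' : B} (hq : q ≠ 0)
    (h1 : L * P = q • (P * L)) (h2 : L' * P = q⁻¹ • (P * L')) (h3 : L * M = q⁻¹ • (M * L))
    (h4 : L' * M = q • (M * L'))
    (h : (q - q⁻¹) • (P * M * (q⁻¹ • L + q • L') - M * P * (q • L + q⁻¹ • L')) = -(L - L')) :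
    serre q (c • (L - L')) (P + M) = -(c • (L - L')) := by
  have e1 : ∀ z, L * (P * z) = q • (P * (L * z)) := fun z => by
    rw [← mul_assoc, h1, smul_mul_assoc, mul_assoc]
  have e2 : ∀ z, L' * (P * z) = q⁻¹ • (P * (L' * z)) := fun z => by
    rw [← mul_assoc, h2, smul_mul_assoc, mul_assoc]
  have e3 : ∀ z, L * (M * z) = q⁻¹ • (M * (L * z)) := fun z => by
    rw [← mul_assoc, h3, smul_mul_assoc, mul_assoc]
  have e4 : ∀ z, L' * (M * z) = q • (M * (L' * z)) := fun z => by
    rw [← mul_assoc, h4, smul_mul_assoc, mul_assoc]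
  rw [← smul_neg, ← h]
  simp only [serre, pow_two, mul_add, add_mul, mul_sub, sub_mul, smul_mul_assoc, mul_smul_comm,
    mul_assoc, e1, e2, e3, e4, h1, h2, h3, h4, smul_add, smul_sub, smul_smul]
  match_scalars <;> field_simp <;> ring

theorem sum_inv : D.k 0 * D.k 1 * (D.k' 0 * D.k' 1) = 1 := by
  rw [mul_assoc, ← mul_assoc (D.k 1), ← D.k'k.eq, mul_assoc, D.k_k', mul_one, D.k_k']

theorem inv_sum : D.k' 0 * D.k' 1 * (D.k 0 * D.k 1) = 1 := by
  rw [mul_assoc, ← mul_assoc (D.k' 1), ← D.kk'.eq, mul_assoc, D.k'_k, mul_one, D.k'_k]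

theorem sum_s (j : ℤ) : Commute (D.k 0 * D.k 1) (D.s j) :=
  ((D.sk 0 j).mul_right (D.sk 1 j)).symm

theorem sum'_s (j : ℤ) : Commute (D.k' 0 * D.k' 1) (D.s j) :=
  ((D.sk' 0 j).mul_right (D.sk' 1 j)).symm

theorem weight_smul {a s u : B} {t : ℂ} (h1 : Commute a s) (h2 : a * u = t • (u * a)) :
    a * (s * u) = t • (s * u * a) := by
  rw [← mul_assoc, h1.eq, mul_assoc, h2, mul_smul_comm, mul_assoc]

theorem serre_I32_I21 (hq : q ≠ 0) (hs : q - q⁻¹ ≠ 0) : serre q D.I32 D.I21 = -D.I32 := by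
  have hc : (Complex.I / (q - q⁻¹)) ^ 2 * (q - q⁻¹) ^ 2 = -1 := by
    rw [← mul_pow, div_mul_cancel₀ _ hs, Complex.I_sq]
  have h1 := serre_weight hq hc D.sum_inv D.inv_sum
    (weight_smul (D.sum_s (-1)) D.weight_up) (weight_smul (D.sum'_s (-1)) D.weight'_up)
  -- The lowering part has weight q⁻¹; the coefficient t + t⁻¹ and the condition on c do not change
  -- under t ↦ t⁻¹.
  have h2 := serre_weight (t := q⁻¹) (c := Complex.I / (q - q⁻¹)) (inv_ne_zero hq)
    (by rw [inv_inv, ← hc]; ring) D.sum_inv D.inv_sum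
    (weight_smul (D.sum_s 1) D.weight_down)
    (by rw [inv_inv]; exact weight_smul (D.sum'_s 1) D.weight'_down)
  rw [inv_inv, add_comm q⁻¹] at h2
  rw [I32, neg_add]
  rw [← h1, ← h2]
  simp only [serre, I21, mul_add, add_mul, smul_add]
  abel

/-- By `serre_bracket` only the products of the raising and the lowering part matter. The outer
inverse denominators cancel, `s 0` is left in front of the commutator from `bracket_up_down`, and `s
0` divides K² - K'² by K + K', where K, K' stand for `k 0 * k 1` and its inverse. -/
theorem serre_I21_I32 (hq : q ≠ 0) (hs : q - q⁻¹ ≠ 0) : serre q D.I21 D.I32 = -D.I21 := by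
  refine serre_bracket hq (weight_smul (D.sum_s (-1)) D.weight_up)
    (weight_smul (D.sum'_s (-1)) D.weight'_up) (weight_smul (D.sum_s 1) D.weight_down)
    (weight_smul (D.sum'_s 1) D.weight'_down) ?_
  have c1 : Commute (D.k 0 * D.k 1) (D.up * D.down) := by
    rw [Commute, SemiconjBy, ← mul_assoc, D.weight_up, smul_mul_assoc, mul_assoc, D.weight_down,
      mul_smul_comm, smul_smul, mul_inv_cancel₀ hq, one_smul, mul_assoc]
  have c2 : Commute (D.k' 0 * D.k' 1) (D.up * D.down) := by
    rw [Commute, SemiconjBy, ← mul_assoc, D.weight'_up, smul_mul_assoc, mul_assoc, D.weight'_down,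
      mul_smul_comm, smul_smul, inv_mul_cancel₀ hq, one_smul, mul_assoc]
  have c3 : Commute (D.k 0 * D.k 1) (D.down * D.up) := by
    rw [Commute, SemiconjBy, ← mul_assoc, D.weight_down, smul_mul_assoc, mul_assoc, D.weight_up,
      mul_smul_comm, smul_smul, inv_mul_cancel₀ hq, one_smul, mul_assoc]
  have c4 : Commute (D.k' 0 * D.k' 1) (D.down * D.up) := by
    rw [Commute, SemiconjBy, ← mul_assoc, D.weight'_down, smul_mul_assoc, mul_assoc, D.weight'_up,
      mul_smul_comm, smul_smul, mul_inv_cancel₀ hq, one_smul, mul_assoc]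
  -- Passing `up` turns `s 1` into `s 0`, while `s (-1)` inverts the weight factor on the right,
  -- which commutes with `up * down`.
  have a1 : D.s (-1) * D.up * (D.s 1 * D.down) *
      (q⁻¹ • (D.k 0 * D.k 1) + q • (D.k' 0 * D.k' 1)) = D.s 0 * (D.up * D.down) := by
    have h1 : D.up * D.s 1 = D.s 0 * D.up := (D.s_up 0).symm
    have h2 := D.s_mul (-1)
    simp only [Int.reduceNeg, zpow_neg, zpow_one] at h2
    rw [mul_assoc (D.s (-1)), ← mul_assoc D.up, h1, mul_assoc (D.s 0), ← mul_assoc,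
      (D.ss _ 0).eq, mul_assoc, ((c1.smul_left _).add_left (c2.smul_left _)).symm.eq, mul_assoc,
      ← mul_assoc (D.s (-1)), h2, one_mul]
  have a2 : D.s 1 * D.down * (D.s (-1) * D.up) *
      (q • (D.k 0 * D.k 1) + q⁻¹ • (D.k' 0 * D.k' 1)) = D.s 0 * (D.down * D.up) := by
    have h1 : D.down * D.s (-1) = D.s 0 * D.down := (D.s_down 0).symm
    have h2 := D.s_mul 1
    simp only [zpow_neg, zpow_one] at h2
    rw [mul_assoc (D.s 1), ← mul_assoc D.down, h1, mul_assoc (D.s 0), ← mul_assoc,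
      (D.ss _ 0).eq, mul_assoc, ((c3.smul_left _).add_left (c4.smul_left _)).symm.eq, mul_assoc,
      ← mul_assoc (D.s 1), h2, one_mul]
  have h0 := D.s_mul 0
  simp only [neg_zero, zpow_zero, one_smul] at h0
  have e : (D.k 0 * D.k 1) ^ 2 - (D.k' 0 * D.k' 1) ^ 2 =
      (D.k 0 * D.k 1 + D.k' 0 * D.k' 1) * (D.k 0 * D.k 1 - D.k' 0 * D.k' 1) := by
    rw [add_mul, mul_sub, mul_sub, D.sum_inv, D.inv_sum, pow_two, pow_two]
    abel
  rw [a1, a2, ← mul_sub, ← mul_smul_comm, D.bracket_up_down hs, e, mul_neg, ← mul_assoc, h0,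
    one_mul]

end ShiftSystem

/-! ### The extended algebra is a shift system; existence and uniqueness of φ -/

section ExtRelations

variable {q : ℂ}

theorem ext_k_kinv (i : Fin 2) : ext q (.s i .k) * ext q (.s i .kinv) = 1 := by
  simp only [← extOf_gen, ← map_mul, sl2_k_kinv, map_one]

theorem ext_kinv_k (i : Fin 2) : ext q (.s i .kinv) * ext q (.s i .k) = 1 := by
  simp only [← extOf_gen, ← map_mul, sl2_kinv_k, map_one]

theorem ext_k_e (i : Fin 2) :
    ext q (.s i .k) * ext q (.s i .e) = q • (ext q (.s i .e) * ext q (.s i .k)) := by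
  simp only [← extOf_gen, ← map_mul, sl2_k_e, map_smul]

theorem ext_k_f (i : Fin 2) :
    ext q (.s i .k) * ext q (.s i .f) = q⁻¹ • (ext q (.s i .f) * ext q (.s i .k)) := by
  simp only [← extOf_gen, ← map_mul, sl2_k_f, map_smul]

theorem ext_kinv_e (hq : q ≠ 0) (i : Fin 2) :
    ext q (.s i .kinv) * ext q (.s i .e) = q⁻¹ • (ext q (.s i .e) * ext q (.s i .kinv)) := by
  simp only [← extOf_gen, ← map_mul, sl2_kinv_e hq, map_smul]

theorem ext_kinv_f (hq : q ≠ 0) (i : Fin 2) :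
    ext q (.s i .kinv) * ext q (.s i .f) = q • (ext q (.s i .f) * ext q (.s i .kinv)) := by
  simp only [← extOf_gen, ← map_mul, sl2_kinv_f hq, map_smul]

theorem ext_e_f (i : Fin 2) :
    ext q (.s i .e) * ext q (.s i .f) - ext q (.s i .f) * ext q (.s i .e) =
      (q - q⁻¹)⁻¹ • (ext q (.s i .k) ^ 2 - ext q (.s i .kinv) ^ 2) := by
  simp only [← extOf_gen, ← map_mul, ← map_sub, ← map_pow, sl2_e_f, map_smul]

theorem ext_comm {i j : Fin 2} (hij : i ≠ j) (g h : Sl2Gen) :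
    Commute (ext q (.s i g)) (ext q (.s j h)) := by
  simp only [← extOf_gen]
  fin_cases i <;> fin_cases j
  · exact absurd rfl hij
  · exact extOf_commute q _ _
  · exact (extOf_commute q _ _).symm
  · exact absurd rfl hij

theorem ext_k_comm_kinv (i j : Fin 2) : Commute (ext q (.s i .k)) (ext q (.s j .kinv)) := by
  rcases eq_or_ne i j with rfl | h
  · rw [Commute, SemiconjBy, ext_k_kinv, ext_kinv_k]
  · exact ext_comm h _ _

theorem ext_k_comm_k (i j : Fin 2) : Commute (ext q (.s i .k)) (ext q (.s j .k)) := by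
  rcases eq_or_ne i j with rfl | h
  · exact Commute.refl _
  · exact ext_comm h _ _

theorem ext_kinv_comm_kinv (i j : Fin 2) :
    Commute (ext q (.s i .kinv)) (ext q (.s j .kinv)) := by
  rcases eq_or_ne i j with rfl | h
  · exact Commute.refl _
  · exact ext_comm h _ _

theorem ext_x_s (i j : Fin 2) (g : Sl2Gen) : Commute (ext q (.x i)) (ext q (.s j g)) := by
  simpa [ext, Commute, SemiconjBy] using RingQuot.mkAlgHom_rel ℂ (ExtRel.x_s (q := q) i j g)

theorem ext_x_x (i j : Fin 2) : Commute (ext q (.x i)) (ext q (.x j)) := by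
  have h : Commute (ext q (.x 0)) (ext q (.x 1)) := by
    simpa [ext, Commute, SemiconjBy] using RingQuot.mkAlgHom_rel ℂ (ExtRel.x_x (q := q))
  fin_cases i <;> fin_cases j
  · exact Commute.refl _
  · exact h
  · exact h.symm
  · exact Commute.refl _

theorem ext_x_extOf (i j : Fin 2) (u : UqSl2 q) : Commute (ext q (.x i)) (extOf q j u) := by
  induction u using sl2_induction with
  | hc c => simpa using Algebra.commute_algebraMap_right c (ext q (.x i))
  | hg g => rw [extOf_gen]; exact ext_x_s i j g
  | hm a b h1 h2 => simpa using h1.mul_right h2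
  | ha a b h1 h2 => simpa using h1.add_right h2

theorem ext_quartic (i : Fin 2) :
    q⁻¹ • ext q (.x i) ^ 4 + q • (1 : UqExt q) =
      (q - q⁻¹) ^ 2 • (extOf q i (casimir q) * ext q (.x i) ^ 2) := by
  have := RingQuot.mkAlgHom_rel ℂ (ExtRel.quartic (q := q) i)
  simpa [ext, casimir, extOf, sl2] using this

/-- The quartic equation solved for its constant term q exhibits a factor x_i. -/
theorem xInv_mul (hq : q ≠ 0) (i : Fin 2) : xInv q i * ext q (.x i) = 1 := by
  have h := ext_quartic (q := q) i
  have e : ∀ a b c : UqExt q, (-a + b) * c = b * c - a * c := fun a b c =>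
    (add_mul _ _ _).trans ((congrArg (· + b * c) (neg_mul a c)).trans (neg_add_eq_sub _ _))
  rw [xInv, smul_mul_assoc, e, smul_mul_assoc, smul_mul_assoc, ← pow_succ,
    mul_assoc, ← pow_two, ← h, add_sub_cancel_left, smul_smul, inv_mul_cancel₀ hq, one_smul]

theorem ext_x_comm_xInv (i : Fin 2) : Commute (ext q (.x i)) (xInv q i) :=
  (((((ext_x_x i i).pow_right 3).smul_right _).neg_right).add_right
    (((ext_x_extOf i i _).mul_right (ext_x_x i i)).smul_right _)).smul_right _

theorem mul_xInv (hq : q ≠ 0) (i : Fin 2) : ext q (.x i) * xInv q i = 1 := by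
  rw [(ext_x_comm_xInv i).eq, xInv_mul hq]

theorem commute_inv {B : Type*} [Monoid B] {x y a : B} (h1 : x * y = 1) (h2 : y * x = 1)
    (h : Commute a x) : Commute a y := by
  have : Commute a ((⟨x, y, h1, h2⟩ : Bˣ) : B) := h
  exact this.units_inv_right

theorem commute_xInv (hq : q ≠ 0) {i : Fin 2} {a : UqExt q} (h : Commute a (ext q (.x i))) :
    Commute a (xInv q i) :=
  commute_inv (mul_xInv hq i) (xInv_mul hq i) h

theorem sumInv_mul (j : ℤ) : ext q (.sumInv j) *
    (q ^ j • (ext q (.s 0 .k) * ext q (.s 1 .k)) +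
      q ^ (-j) • (ext q (.s 0 .kinv) * ext q (.s 1 .kinv))) = 1 := by
  simpa [ext] using RingQuot.mkAlgHom_rel ℂ (ExtRel.sumInv_mul (q := q) j)

theorem diffInv_mul (j : ℤ) : ext q (.diffInv j) *
    (q ^ j • (ext q (.s 0 .k) * ext q (.s 1 .kinv)) +
      q ^ (-j) • (ext q (.s 0 .kinv) * ext q (.s 1 .k))) = 1 := by
  simpa [ext] using RingQuot.mkAlgHom_rel ℂ (ExtRel.diffInv_mul (q := q) j)

theorem sumInv_k (i : Fin 2) (j : ℤ) : Commute (ext q (.sumInv j)) (ext q (.s i .k)) := by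
  simpa [ext, Commute, SemiconjBy] using RingQuot.mkAlgHom_rel ℂ (ExtRel.sumInv_k (q := q) i j)

theorem sumInv_kinv (i : Fin 2) (j : ℤ) : Commute (ext q (.sumInv j)) (ext q (.s i .kinv)) := by
  simpa [ext, Commute, SemiconjBy] using
    RingQuot.mkAlgHom_rel ℂ (ExtRel.sumInv_kinv (q := q) i j)

theorem diffInv_k (i : Fin 2) (j : ℤ) : Commute (ext q (.diffInv j)) (ext q (.s i .k)) := by
  simpa [ext, Commute, SemiconjBy] using RingQuot.mkAlgHom_rel ℂ (ExtRel.diffInv_k (q := q) i j)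

theorem diffInv_kinv (i : Fin 2) (j : ℤ) :
    Commute (ext q (.diffInv j)) (ext q (.s i .kinv)) := by
  simpa [ext, Commute, SemiconjBy] using
    RingQuot.mkAlgHom_rel ℂ (ExtRel.diffInv_kinv (q := q) i j)

theorem sumInv_e (i : Fin 2) (j : ℤ) :
    ext q (.sumInv j) * ext q (.s i .e) = ext q (.s i .e) * ext q (.sumInv (j + 1)) := by
  simpa [ext] using RingQuot.mkAlgHom_rel ℂ (ExtRel.sumInv_e (q := q) i j)

theorem sumInv_f (i : Fin 2) (j : ℤ) :
    ext q (.sumInv j) * ext q (.s i .f) = ext q (.s i .f) * ext q (.sumInv (j - 1)) := by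
  simpa [ext] using RingQuot.mkAlgHom_rel ℂ (ExtRel.sumInv_f (q := q) i j)

theorem diffInv_e (i : Fin 2) (j : ℤ) :
    ext q (.diffInv j) * ext q (.s i .e) = ext q (.s i .e) * ext q (.diffInv (j + eps i)) := by
  simpa [ext] using RingQuot.mkAlgHom_rel ℂ (ExtRel.diffInv_e (q := q) i j)

theorem diffInv_f (i : Fin 2) (j : ℤ) :
    ext q (.diffInv j) * ext q (.s i .f) = ext q (.s i .f) * ext q (.diffInv (j - eps i)) := by
  simpa [ext] using RingQuot.mkAlgHom_rel ℂ (ExtRel.diffInv_f (q := q) i j)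

theorem sumInv_sumInv (j k : ℤ) : Commute (ext q (.sumInv j)) (ext q (.sumInv k)) := by
  simpa [ext, Commute, SemiconjBy] using
    RingQuot.mkAlgHom_rel ℂ (ExtRel.sumInv_sumInv (q := q) j k)

theorem sumInv_diffInv (j k : ℤ) : Commute (ext q (.sumInv j)) (ext q (.diffInv k)) := by
  simpa [ext, Commute, SemiconjBy] using
    RingQuot.mkAlgHom_rel ℂ (ExtRel.sumInv_diffInv (q := q) j k)

theorem diffInv_diffInv (j k : ℤ) : Commute (ext q (.diffInv j)) (ext q (.diffInv k)) := by
  simpa [ext, Commute, SemiconjBy] using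
    RingQuot.mkAlgHom_rel ℂ (ExtRel.diffInv_diffInv (q := q) j k)

theorem mul_sumInv (j : ℤ) :
    (q ^ j • (ext q (.s 0 .k) * ext q (.s 1 .k)) +
      q ^ (-j) • (ext q (.s 0 .kinv) * ext q (.s 1 .kinv))) * ext q (.sumInv j) = 1 := by
  rw [← sumInv_mul j]
  exact ((((sumInv_k 0 j).mul_right (sumInv_k 1 j)).smul_right _).add_right
    (((sumInv_kinv 0 j).mul_right (sumInv_kinv 1 j)).smul_right _)).symm.eq

theorem mul_diffInv (j : ℤ) :
    (q ^ j • (ext q (.s 0 .k) * ext q (.s 1 .kinv)) +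
      q ^ (-j) • (ext q (.s 0 .kinv) * ext q (.s 1 .k))) * ext q (.diffInv j) = 1 := by
  rw [← diffInv_mul j]
  exact ((((diffInv_k 0 j).mul_right (diffInv_kinv 1 j)).smul_right _).add_right
    (((diffInv_kinv 0 j).mul_right (diffInv_k 1 j)).smul_right _)).symm.eq

/-- No defining relation says this: x_i commutes with the denominator, hence with its inverse. -/
theorem x_sumInv (i : Fin 2) (j : ℤ) : Commute (ext q (.x i)) (ext q (.sumInv j)) :=
  commute_inv (mul_sumInv j) (sumInv_mul j)
    ((((ext_x_s i 0 _).mul_right (ext_x_s i 1 _)).smul_right _).add_right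
      (((ext_x_s i 0 _).mul_right (ext_x_s i 1 _)).smul_right _))

theorem x_diffInv (i : Fin 2) (j : ℤ) : Commute (ext q (.x i)) (ext q (.diffInv j)) :=
  commute_inv (mul_diffInv j) (diffInv_mul j)
    ((((ext_x_s i 0 _).mul_right (ext_x_s i 1 _)).smul_right _).add_right
      (((ext_x_s i 0 _).mul_right (ext_x_s i 1 _)).smul_right _))

/-- The multiple `(q - q⁻¹)² c_i` of the Casimir element, in terms of the root `x_i`. -/
def gam (q : ℂ) (i : Fin 2) : UqExt q := q⁻¹ • ext q (.x i) ^ 2 + q • xInv q i ^ 2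

/-- This is the quartic equation divided by x_i². -/
theorem gam_eq (hq : q ≠ 0) (i : Fin 2) : gam q i = (q - q⁻¹) ^ 2 • extOf q i (casimir q) := by
  have h := congrArg (· * xInv q i ^ 2) (ext_quartic (q := q) i)
  have h2 : ext q (.x i) ^ 2 * xInv q i ^ 2 = 1 := by
    rw [← (ext_x_comm_xInv i).mul_pow, mul_xInv hq, one_pow]
  simp only [add_mul, smul_mul_assoc, one_mul] at h
  rwa [show 4 = 2 + 2 from rfl, pow_add, mul_assoc, mul_assoc, h2, mul_one, mul_one] at h

theorem commute_gam (hq : q ≠ 0) {i : Fin 2} {a : UqExt q} (h : Commute a (ext q (.x i))) :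
    Commute a (gam q i) :=
  ((h.pow_right 2).smul_right _).add_right (((commute_xInv hq h).pow_right 2).smul_right _)

theorem commute_numDown (hq : q ≠ 0) {i m : Fin 2} {a : UqExt q}
    (h : Commute a (ext q (.x i))) (h1 : Commute a (ext q (.s m .k)))
    (h2 : Commute a (ext q (.s m .kinv))) : Commute a (numDown q i m) :=
  (((commute_xInv hq h).mul_right h2).smul_right _).add_right ((h.mul_right h1).smul_right _)

theorem commute_numUp (hq : q ≠ 0) {i m : Fin 2} {a : UqExt q}
    (h : Commute a (ext q (.x i))) (h1 : Commute a (ext q (.s m .k)))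
    (h2 : Commute a (ext q (.s m .kinv))) : Commute a (numUp q i m) :=
  (((commute_xInv hq h).mul_right h1).smul_right _).add_right ((h.mul_right h2).smul_right _)

theorem gam_ef (hq : q ≠ 0) (hs : q - q⁻¹ ≠ 0) (i : Fin 2) :
    (q - q⁻¹) ^ 2 • (ext q (.s i .e) * ext q (.s i .f)) =
      gam q i - (q⁻¹ • ext q (.s i .k) ^ 2 + q • ext q (.s i .kinv) ^ 2) := by
  rw [gam_eq hq, casimir]
  simp only [map_add, map_smul, map_mul, map_pow, extOf_gen, smul_add, smul_smul]
  rw [mul_inv_cancel_left₀ (pow_ne_zero 2 hs), mul_inv_cancel_left₀ (pow_ne_zero 2 hs)]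
  abel

theorem gam_fe (hq : q ≠ 0) (hs : q - q⁻¹ ≠ 0) (i : Fin 2) :
    (q - q⁻¹) ^ 2 • (ext q (.s i .f) * ext q (.s i .e)) =
      gam q i - (q • ext q (.s i .k) ^ 2 + q⁻¹ • ext q (.s i .kinv) ^ 2) := by
  have h := congrArg ((q - q⁻¹) ^ 2 • ·) (ext_e_f (q := q) i)
  simp only [smul_sub, smul_smul, gam_ef hq hs] at h
  rw [pow_two (q - q⁻¹), mul_assoc, mul_inv_cancel₀ hs, mul_one, ← pow_two] at h
  rw [← sub_sub_self (gam q i - (q⁻¹ • ext q (.s i .k) ^ 2 + q • ext q (.s i .kinv) ^ 2))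
    ((q - q⁻¹) ^ 2 • _), h]
  module

theorem ext_e_k (hq : q ≠ 0) (i : Fin 2) :
    ext q (.s i .e) * ext q (.s i .k) = q⁻¹ • (ext q (.s i .k) * ext q (.s i .e)) := by
  rw [ext_k_e, smul_smul, inv_mul_cancel₀ hq, one_smul]

theorem ext_e_kinv (hq : q ≠ 0) (i : Fin 2) :
    ext q (.s i .e) * ext q (.s i .kinv) = q • (ext q (.s i .kinv) * ext q (.s i .e)) := by
  rw [ext_kinv_e hq, smul_smul, mul_inv_cancel₀ hq, one_smul]

theorem ext_f_k (hq : q ≠ 0) (i : Fin 2) :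
    ext q (.s i .f) * ext q (.s i .k) = q • (ext q (.s i .k) * ext q (.s i .f)) := by
  rw [ext_k_f, smul_smul, mul_inv_cancel₀ hq, one_smul]

theorem ext_f_kinv (hq : q ≠ 0) (i : Fin 2) :
    ext q (.s i .f) * ext q (.s i .kinv) = q⁻¹ • (ext q (.s i .kinv) * ext q (.s i .f)) := by
  rw [ext_kinv_f hq, smul_smul, inv_mul_cancel₀ hq, one_smul]

/-- In each of the four products one pair of inverse elements cancels, so only squares of single
elements remain: the x-part becomes γ, separated from the weight part. This is where the form of the
numerators in φ(I₃₂) is used. -/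
theorem num_mul {B : Type*} [Ring B] [Algebra ℂ B] {x y k l : B}
    (hxy : x * y = 1) (hyx : y * x = 1) (hkl : k * l = 1) (hlk : l * k = 1)
    (hxk : Commute x k) (hxl : Commute x l) (hyk : Commute y k) (hyl : Commute y l) :
    (q • (y * l) + q⁻¹ • (x * k)) * (y * k + x * l) =
      q⁻¹ • x ^ 2 + q • y ^ 2 + (q⁻¹ • k ^ 2 + q • l ^ 2) := by
  have h1 : ∀ z, x * (y * z) = z := fun z => by rw [← mul_assoc, hxy, one_mul]
  have h2 : ∀ z, y * (x * z) = z := fun z => by rw [← mul_assoc, hyx, one_mul]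
  have h3 : ∀ z, k * (x * z) = x * (k * z) := fun z => by rw [← mul_assoc, ← hxk.eq, mul_assoc]
  have h4 : ∀ z, l * (x * z) = x * (l * z) := fun z => by rw [← mul_assoc, ← hxl.eq, mul_assoc]
  have h5 : ∀ z, k * (y * z) = y * (k * z) := fun z => by rw [← mul_assoc, ← hyk.eq, mul_assoc]
  have h6 : ∀ z, l * (y * z) = y * (l * z) := fun z => by rw [← mul_assoc, ← hyl.eq, mul_assoc]
  simp only [mul_add, add_mul, smul_mul_assoc, mul_assoc, h1, h2, h3, h4, h5, h6, hkl, hlk,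
    mul_one, pow_two]
  module

theorem xk_comm (hq : q ≠ 0) (i m : Fin 2) (g : Sl2Gen) :
    Commute (xInv q i) (ext q (.s m g)) :=
  (commute_xInv hq (ext_x_s i m g).symm).symm

/-- The factors q^{±1} in the numerator are exactly undone by the shift caused by e, which leaves
the factor required by `num_mul`. -/
theorem e_numUp (hq : q ≠ 0) (i m : Fin 2) : ext q (.s m .e) * numUp q i m =
    (xInv q i * ext q (.s m .k) + ext q (.x i) * ext q (.s m .kinv)) * ext q (.s m .e) := by
  rw [numUp, mul_add, mul_smul_comm, mul_smul_comm, ← mul_assoc, ← mul_assoc,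
    ← (xk_comm hq i m .e).eq, ← (ext_x_s i m .e).eq, mul_assoc, mul_assoc, ext_e_k hq,
    ext_e_kinv hq, mul_smul_comm, mul_smul_comm, smul_smul, smul_smul, mul_inv_cancel₀ hq,
    inv_mul_cancel₀ hq, one_smul, one_smul, add_mul, mul_assoc, mul_assoc]

theorem f_numDown (hq : q ≠ 0) (i m : Fin 2) : ext q (.s m .f) * numDown q i m =
    (xInv q i * ext q (.s m .kinv) + ext q (.x i) * ext q (.s m .k)) * ext q (.s m .f) := by
  rw [numDown, mul_add, mul_smul_comm, mul_smul_comm, ← mul_assoc, ← mul_assoc,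
    ← (xk_comm hq i m .f).eq, ← (ext_x_s i m .f).eq, mul_assoc, mul_assoc, ext_f_k hq,
    ext_f_kinv hq, mul_smul_comm, mul_smul_comm, smul_smul, smul_smul, mul_inv_cancel₀ hq,
    inv_mul_cancel₀ hq, one_smul, one_smul, add_mul, mul_assoc, mul_assoc]

/-- The two numerators multiply to the factor with γ_i, and e f supplies the factor with γ_m through
the Casimir element. This is the product rule `U_W` of the shift system, in which the roots survive
only through γ. -/
theorem numDown_e_numUp_f (hq : q ≠ 0) (hs : q - q⁻¹ ≠ 0) (i m : Fin 2) :
    (q - q⁻¹) ^ 2 • (numDown q i m * ext q (.s m .e) * (numUp q i m * ext q (.s m .f))) =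
      (gam q i + (q⁻¹ • ext q (.s m .k) ^ 2 + q • ext q (.s m .kinv) ^ 2)) *
        (gam q m - (q⁻¹ • ext q (.s m .k) ^ 2 + q • ext q (.s m .kinv) ^ 2)) := by
  rw [mul_assoc, ← mul_assoc (ext q (.s m .e)), e_numUp hq, mul_assoc _ (ext q (.s m .e)),
    ← mul_assoc, numDown, num_mul (mul_xInv hq i) (xInv_mul hq i) (ext_k_kinv m)
      (ext_kinv_k m) (ext_x_s i m _) (ext_x_s i m _) (xk_comm hq i m _) (xk_comm hq i m _),
    ← mul_smul_comm, gam_ef hq hs, gam.eq_def q i]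

theorem numUp_f_numDown_e (hq : q ≠ 0) (hs : q - q⁻¹ ≠ 0) (i m : Fin 2) :
    (q - q⁻¹) ^ 2 • (numUp q i m * ext q (.s m .f) * (numDown q i m * ext q (.s m .e))) =
      (gam q i + (q • ext q (.s m .k) ^ 2 + q⁻¹ • ext q (.s m .kinv) ^ 2)) *
        (gam q m - (q • ext q (.s m .k) ^ 2 + q⁻¹ • ext q (.s m .kinv) ^ 2)) := by
  rw [mul_assoc, ← mul_assoc (ext q (.s m .f)), f_numDown hq, mul_assoc _ (ext q (.s m .f)),
    ← mul_assoc, numUp, num_mul (mul_xInv hq i) (xInv_mul hq i) (ext_kinv_k m)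
      (ext_k_kinv m) (ext_x_s i m _) (ext_x_s i m _) (xk_comm hq i m _) (xk_comm hq i m _),
    ← mul_smul_comm, gam_fe hq hs, gam.eq_def q i, add_comm (q • ext q (.s m .k) ^ 2)]

theorem commute_numDown_mul (hq : q ≠ 0) {i m : Fin 2} {g : Sl2Gen} {a : UqExt q}
    (h : Commute a (ext q (.x i))) (h1 : Commute a (ext q (.s m .k)))
    (h2 : Commute a (ext q (.s m .kinv))) (h3 : Commute a (ext q (.s m g))) :
    Commute a (numDown q i m * ext q (.s m g)) :=
  (commute_numDown hq h h1 h2).mul_right h3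

theorem commute_numUp_mul (hq : q ≠ 0) {i m : Fin 2} {g : Sl2Gen} {a : UqExt q}
    (h : Commute a (ext q (.x i))) (h1 : Commute a (ext q (.s m .k)))
    (h2 : Commute a (ext q (.s m .kinv))) (h3 : Commute a (ext q (.s m g))) :
    Commute a (numUp q i m * ext q (.s m g)) :=
  (commute_numUp hq h h1 h2).mul_right h3

/-- The elements of the extended algebra in the definition of the image of `I₃₂`. -/
def extSystem (hq : q ≠ 0) (hs : q - q⁻¹ ≠ 0) : ShiftSystem q (UqExt q) where
  k i := ext q (.s i .k)
  k' i := ext q (.s i .kinv)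
  U i := numDown q (1 - i) i * ext q (.s i .e)
  W i := numUp q (1 - i) i * ext q (.s i .f)
  γ := gam q
  s j := ext q (.sumInv j)
  d j := ext q (.diffInv j)
  k_k' := ext_k_kinv
  k'_k := ext_kinv_k
  kk := ext_k_comm_k 0 1
  kk' := ext_k_comm_kinv 0 1
  k'k := (ext_k_comm_kinv 1 0).symm
  k'k' := ext_kinv_comm_kinv 0 1
  k_U i := by
    rw [← mul_assoc, (commute_numDown hq (ext_x_s _ i _).symm (ext_k_comm_k i i)
      (ext_k_comm_kinv i i)).eq, mul_assoc, ext_k_e, mul_smul_comm, mul_assoc]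
  k_W i := by
    rw [← mul_assoc, (commute_numUp hq (ext_x_s _ i _).symm (ext_k_comm_k i i)
      (ext_k_comm_kinv i i)).eq, mul_assoc, ext_k_f, mul_smul_comm, mul_assoc]
  k'_U i := by
    rw [← mul_assoc, (commute_numDown hq (ext_x_s _ i _).symm (ext_k_comm_kinv i i).symm
      (ext_kinv_comm_kinv i i)).eq, mul_assoc, ext_kinv_e hq, mul_smul_comm, mul_assoc]
  k'_W i := by
    rw [← mul_assoc, (commute_numUp hq (ext_x_s _ i _).symm (ext_k_comm_kinv i i).symm
      (ext_kinv_comm_kinv i i)).eq, mul_assoc, ext_kinv_f hq, mul_smul_comm, mul_assoc]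
  kU i j h := (commute_numDown hq (ext_x_s _ i _).symm (ext_k_comm_k i j)
      (ext_k_comm_kinv i j)).mul_right (ext_comm h _ _)
  kW i j h := (commute_numUp hq (ext_x_s _ i _).symm (ext_k_comm_k i j)
      (ext_k_comm_kinv i j)).mul_right (ext_comm h _ _)
  k'U i j h := (commute_numDown hq (ext_x_s _ i _).symm (ext_k_comm_kinv j i).symm
      (ext_kinv_comm_kinv i j)).mul_right (ext_comm h _ _)
  k'W i j h := (commute_numUp hq (ext_x_s _ i _).symm (ext_k_comm_kinv j i).symm
      (ext_kinv_comm_kinv i j)).mul_right (ext_comm h _ _)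
  UU := commute_numDown_mul hq
    (commute_numDown_mul hq (ext_x_x 0 1) (ext_x_s 0 0 _) (ext_x_s 0 0 _) (ext_x_s 0 0 _)).symm
    (commute_numDown_mul hq (ext_x_s 1 1 _).symm (ext_comm (by decide) _ _)
      (ext_comm (by decide) _ _) (ext_comm (by decide) _ _)).symm
    (commute_numDown_mul hq (ext_x_s 1 1 _).symm (ext_comm (by decide) _ _)
      (ext_comm (by decide) _ _) (ext_comm (by decide) _ _)).symm
    (commute_numDown_mul hq (ext_x_s 1 1 _).symm (ext_comm (by decide) _ _)
      (ext_comm (by decide) _ _) (ext_comm (by decide) _ _)).symm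
  UW := commute_numUp_mul hq
    (commute_numDown_mul hq (ext_x_x 0 1) (ext_x_s 0 0 _) (ext_x_s 0 0 _) (ext_x_s 0 0 _)).symm
    (commute_numDown_mul hq (ext_x_s 1 1 _).symm (ext_comm (by decide) _ _)
      (ext_comm (by decide) _ _) (ext_comm (by decide) _ _)).symm
    (commute_numDown_mul hq (ext_x_s 1 1 _).symm (ext_comm (by decide) _ _)
      (ext_comm (by decide) _ _) (ext_comm (by decide) _ _)).symm
    (commute_numDown_mul hq (ext_x_s 1 1 _).symm (ext_comm (by decide) _ _)
      (ext_comm (by decide) _ _) (ext_comm (by decide) _ _)).symm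
  WU := commute_numDown_mul hq
    (commute_numUp_mul hq (ext_x_x 0 1) (ext_x_s 0 0 _) (ext_x_s 0 0 _) (ext_x_s 0 0 _)).symm
    (commute_numUp_mul hq (ext_x_s 1 1 _).symm (ext_comm (by decide) _ _)
      (ext_comm (by decide) _ _) (ext_comm (by decide) _ _)).symm
    (commute_numUp_mul hq (ext_x_s 1 1 _).symm (ext_comm (by decide) _ _)
      (ext_comm (by decide) _ _) (ext_comm (by decide) _ _)).symm
    (commute_numUp_mul hq (ext_x_s 1 1 _).symm (ext_comm (by decide) _ _)
      (ext_comm (by decide) _ _) (ext_comm (by decide) _ _)).symm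
  WW := commute_numUp_mul hq
    (commute_numUp_mul hq (ext_x_x 0 1) (ext_x_s 0 0 _) (ext_x_s 0 0 _) (ext_x_s 0 0 _)).symm
    (commute_numUp_mul hq (ext_x_s 1 1 _).symm (ext_comm (by decide) _ _)
      (ext_comm (by decide) _ _) (ext_comm (by decide) _ _)).symm
    (commute_numUp_mul hq (ext_x_s 1 1 _).symm (ext_comm (by decide) _ _)
      (ext_comm (by decide) _ _) (ext_comm (by decide) _ _)).symm
    (commute_numUp_mul hq (ext_x_s 1 1 _).symm (ext_comm (by decide) _ _)
      (ext_comm (by decide) _ _) (ext_comm (by decide) _ _)).symm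
  sk i j := sumInv_k i j
  sk' i j := sumInv_kinv i j
  dk i j := diffInv_k i j
  dk' i j := diffInv_kinv i j
  ss := sumInv_sumInv
  sd := sumInv_diffInv
  dd := diffInv_diffInv
  s_mul := sumInv_mul
  d_mul := diffInv_mul
  s_U i j := by
    rw [← mul_assoc, (commute_numDown hq (x_sumInv _ j).symm (sumInv_k i j)
      (sumInv_kinv i j)).eq, mul_assoc, sumInv_e, mul_assoc]
  s_W i j := by
    rw [← mul_assoc, (commute_numUp hq (x_sumInv _ j).symm (sumInv_k i j)
      (sumInv_kinv i j)).eq, mul_assoc, sumInv_f, mul_assoc]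
  d_U0 j := by
    rw [← mul_assoc, (commute_numDown hq (x_diffInv _ j).symm (diffInv_k 0 j)
      (diffInv_kinv 0 j)).eq, mul_assoc, diffInv_e, mul_assoc, eps]
  d_W0 j := by
    rw [← mul_assoc, (commute_numUp hq (x_diffInv _ j).symm (diffInv_k 0 j)
      (diffInv_kinv 0 j)).eq, mul_assoc, diffInv_f, mul_assoc, eps]
  d_U1 j := by
    rw [← mul_assoc, (commute_numDown hq (x_diffInv _ j).symm (diffInv_k 1 j)
      (diffInv_kinv 1 j)).eq, mul_assoc, diffInv_e, mul_assoc, eps, ← sub_eq_add_neg]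
  d_W1 j := by
    rw [← mul_assoc, (commute_numUp hq (x_diffInv _ j).symm (diffInv_k 1 j)
      (diffInv_kinv 1 j)).eq, mul_assoc, diffInv_f, mul_assoc, eps, sub_neg_eq_add]
  γk i j := (commute_gam hq (ext_x_s i j _).symm).symm
  γk' i j := (commute_gam hq (ext_x_s i j _).symm).symm
  γs i j := (commute_gam hq (x_sumInv i j).symm).symm
  γd i j := (commute_gam hq (x_diffInv i j).symm).symm
  γγ := commute_gam hq (commute_gam hq (ext_x_x 1 0)).symm
  U_W i j h := by
    obtain rfl : j = 1 - i := by revert i j; decide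
    exact numDown_e_numUp_f hq hs _ _
  W_U i j h := by
    obtain rfl : j = 1 - i := by revert i j; decide
    exact numUp_f_numDown_e hq hs _ _

theorem extSystem_I32 (hq : q ≠ 0) (hs : q - q⁻¹ ≠ 0) : (extSystem hq hs).I32 =
    -(numDown q 0 1 * ext q (.sumInv (-1)) * ext q (.diffInv 1) * ext q (.s 1 .e))
    + numUp q 0 1 * ext q (.sumInv 1) * ext q (.diffInv (-1)) * ext q (.s 1 .f)
    + numDown q 1 0 * ext q (.sumInv (-1)) * ext q (.diffInv (-1)) * ext q (.s 0 .e)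
    - numUp q 1 0 * ext q (.sumInv 1) * ext q (.diffInv 1) * ext q (.s 0 .f) := by
  have h1 : ∀ i m j, numDown q i m * ext q (.sumInv j) = ext q (.sumInv j) * numDown q i m :=
    fun i m j => (commute_numDown hq (x_sumInv _ j).symm (sumInv_k _ j) (sumInv_kinv _ j)).symm.eq
  have h2 : ∀ i m j, numUp q i m * ext q (.sumInv j) = ext q (.sumInv j) * numUp q i m :=
    fun i m j => (commute_numUp hq (x_sumInv _ j).symm (sumInv_k _ j) (sumInv_kinv _ j)).symm.eq
  have h3 : ∀ i m j z, numDown q i m * (ext q (.diffInv j) * z) =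
      ext q (.diffInv j) * (numDown q i m * z) := fun i m j z => by
    rw [← mul_assoc, ← mul_assoc, (commute_numDown hq (x_diffInv _ j).symm (diffInv_k _ j)
      (diffInv_kinv _ j)).eq]
  have h4 : ∀ i m j z, numUp q i m * (ext q (.diffInv j) * z) =
      ext q (.diffInv j) * (numUp q i m * z) := fun i m j z => by
    rw [← mul_assoc, ← mul_assoc, (commute_numUp hq (x_diffInv _ j).symm (diffInv_k _ j)
      (diffInv_kinv _ j)).eq]
  simp only [ShiftSystem.I32, ShiftSystem.up, ShiftSystem.down, extSystem, sub_zero, sub_self,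
    mul_sub, h1, h2, mul_assoc, h3, h4]
  abel

theorem so4_algHom_ext {B : Type*} [Semiring B] [Algebra ℂ B] {f g : UqSo4 q →ₐ[ℂ] B}
    (h : ∀ x, f (so4 q x) = g (so4 q x)) : f = g := by
  refine RingQuot.ringQuot_ext' ℂ _ _ (FreeAlgebra.hom_ext ?_)
  funext x
  exact h x

/-- The values of `φ` on the generators. -/
def phiGen (hq : q ≠ 0) (hs : q - q⁻¹ ≠ 0) : So4Gen → UqExt q
  | .I21 => (extSystem hq hs).I21
  | .I32 => (extSystem hq hs).I32
  | .I43 => (extSystem hq hs).flip.I21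

/-- The homomorphism `φ`. -/
def phi (hq : q ≠ 0) (hs : q - q⁻¹ ≠ 0) : UqSo4 q →ₐ[ℂ] UqExt q :=
  RingQuot.liftAlgHom ℂ ⟨FreeAlgebra.lift ℂ (phiGen hq hs), by
    intro a b h
    have h1 := (extSystem hq hs).flip.serre_I21_I32 hq hs
    -- The relations with I₄₃ are those with I₂₁ in the flipped system, whose I₃₂ is the same
    -- element.
    have h2 := (extSystem hq hs).flip.serre_I32_I21 hq hs
    rw [ShiftSystem.I32_flip] at h1 h2
    cases h with
    | r2132 => simpa [serre, phiGen] using (extSystem hq hs).serre_I21_I32 hq hs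
    | r3221 => simpa [serre, phiGen] using (extSystem hq hs).serre_I32_I21 hq hs
    | r3243 => simpa [serre, phiGen] using h2
    | r4332 => simpa [serre, phiGen] using h1
    | comm =>
      have hk : ∀ g h : Sl2Gen, (g = .k ∨ g = .kinv) → (h = .k ∨ h = .kinv) → ∀ i j,
          Commute (ext q (.s i g)) (ext q (.s j h)) := by
        rintro g h (rfl | rfl) (rfl | rfl) i j
        · exact ext_k_comm_k i j
        · exact ext_k_comm_kinv i j
        · exact (ext_k_comm_kinv j i).symm
        · exact ext_kinv_comm_kinv i j
      have hm : ∀ g h g' h' : Sl2Gen, (g = .k ∨ g = .kinv) → (h = .k ∨ h = .kinv) →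
          (g' = .k ∨ g' = .kinv) → (h' = .k ∨ h' = .kinv) →
          Commute (ext q (.s 0 g) * ext q (.s 1 h)) (ext q (.s 0 g') * ext q (.s 1 h')) :=
        fun g h g' h' a b a' b' =>
          ((hk _ _ a a' _ _).mul_right (hk _ _ a b' _ _)).mul_left
            ((hk _ _ b a' _ _).mul_right (hk _ _ b b' _ _))
      simp only [map_mul, FreeAlgebra.lift_ι_apply, phiGen, ShiftSystem.I21, extSystem,
        ShiftSystem.flip, Matrix.cons_val_zero, Matrix.cons_val_one]
      refine (Commute.smul_left (Commute.smul_right ?_ _) _).eq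
      refine Commute.sub_left (Commute.sub_right ?_ ?_) (Commute.sub_right ?_ ?_) <;>
        apply hm <;> simp⟩

theorem phi_gen (hq : q ≠ 0) (hs : q - q⁻¹ ≠ 0) (g : So4Gen) :
    phi hq hs (so4 q g) = phiGen hq hs g := by
  rw [phi, so4, RingQuot.liftAlgHom_mkAlgHom_apply]
  simp

theorem isPhi_phi (hq : q ≠ 0) (hs : q - q⁻¹ ≠ 0) : IsPhi q (phi hq hs) where
  I21 := phi_gen hq hs _
  I43 := phi_gen hq hs _
  I32 := (phi_gen hq hs _).trans (extSystem_I32 hq hs)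

theorem IsPhi.eq {φ ψ : UqSo4 q →ₐ[ℂ] UqExt q} (h : IsPhi q φ) (h' : IsPhi q ψ) : φ = ψ := by
  refine so4_algHom_ext fun x => ?_
  cases x
  · rw [h.I21, h'.I21]
  · rw [h.I32, h'.I32]
  · rw [h.I43, h'.I43]

end ExtRelations

/-! ### Simultaneously diagonal operators with simple joint spectrum -/

section Diagonal

variable {ι σ V : Type*} [AddCommGroup V] [Module ℂ V] (b : Module.Basis ι ℂ V)
  {A : σ → Module.End ℂ V} {μ : σ → ι → ℂ}

theorem repr_diagonal {A : Module.End ℂ V} {μ : ι → ℂ} (hA : ∀ i, A (b i) = μ i • b i)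
    (v : V) (i : ι) : b.repr (A v) i = μ i * b.repr v i := by
  have : (b.coord i).comp A = μ i • b.coord i := by
    refine b.ext fun j => ?_
    rcases eq_or_ne j i with rfl | h
    · simp [hA]
    · simp [hA, h]
  exact DFunLike.congr_fun this v

/-- A subspace invariant under simultaneously diagonal operators that separate the vectors of a
basis contains the components of its elements. -/
theorem repr_smul_mem (hA : ∀ c i, A c (b i) = μ c i • b i)
    (hμ : ∀ i j, i ≠ j → ∃ c, μ c i ≠ μ c j) (W : Submodule ℂ V)
    (hW : ∀ c, ∀ v ∈ W, A c v ∈ W) {w : V} (hw : w ∈ W) (i : ι) :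
    b.repr w i • b i ∈ W := by
  classical
  -- Components in S are removed one at a time without creating new ones; S will be the support of w
  -- without i.
  have key : ∀ S : Finset ι, i ∉ S → ∃ w' ∈ W, b.repr w' i = b.repr w i ∧
      (∀ j ∈ S, b.repr w' j = 0) ∧ ∀ j, b.repr w j = 0 → b.repr w' j = 0 := by
    intro S
    induction S using Finset.induction_on with
    | empty => exact fun _ => ⟨w, hw, rfl, by simp, fun _ h => h⟩
    | insert j S hj ih =>
      intro hi
      rw [Finset.mem_insert, not_or] at hi
      obtain ⟨w', hw', h1, h2, h3⟩ := ih hi.2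
      obtain ⟨c, hc⟩ := hμ i j hi.1
      -- The operator (A_c - μ_c(j)) / (μ_c(i) - μ_c(j)) preserves W, fixes b_i and kills b_j.
      have hr : ∀ l, b.repr ((μ c i - μ c j)⁻¹ • (A c w' - μ c j • w')) l =
          (μ c i - μ c j)⁻¹ * ((μ c l - μ c j) * b.repr w' l) := by
        intro l
        simp only [map_smul, map_sub, Finsupp.smul_apply, Finsupp.sub_apply, smul_eq_mul,
          repr_diagonal b (hA c)]
        ring
      refine ⟨_, W.smul_mem (μ c i - μ c j)⁻¹
        (W.sub_mem (hW c w' hw') (W.smul_mem (μ c j) hw')), ?_, ?_, ?_⟩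
      · rw [hr, inv_mul_cancel_left₀ (sub_ne_zero.mpr hc), h1]
      · intro l hl
        rcases Finset.mem_insert.mp hl with rfl | hl
        · rw [hr, sub_self, zero_mul, mul_zero]
        · rw [hr, h2 l hl, mul_zero, mul_zero]
      · intro l hl
        rw [hr, h3 l hl, mul_zero, mul_zero]
  obtain ⟨w', hw', h1, h2, h3⟩ := key ((b.repr w).support.erase i) (by simp)
  have : w' = b.repr w i • b i := by
    refine b.ext_elem fun j => ?_
    rcases eq_or_ne j i with rfl | h
    · simp [h1]
    · rw [map_smul, b.repr_self, Finsupp.smul_apply, Finsupp.single_eq_of_ne h, smul_zero]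
      by_cases hj : b.repr w j = 0
      · exact h3 j hj
      · exact h2 j (by simp [h, hj])
  rwa [← this]

theorem basis_mem_of_repr_ne_zero (hA : ∀ c i, A c (b i) = μ c i • b i)
    (hμ : ∀ i j, i ≠ j → ∃ c, μ c i ≠ μ c j) (W : Submodule ℂ V)
    (hW : ∀ c, ∀ v ∈ W, A c v ∈ W) {w : V} (hw : w ∈ W) {i : ι} (hi : b.repr w i ≠ 0) :
    b i ∈ W :=
  (W.smul_mem_iff hi).mp (repr_smul_mem b hA hμ W hW hw i)

theorem exists_basis_mem (hA : ∀ c i, A c (b i) = μ c i • b i)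
    (hμ : ∀ i j, i ≠ j → ∃ c, μ c i ≠ μ c j) (W : Submodule ℂ V)
    (hW : ∀ c, ∀ v ∈ W, A c v ∈ W) (h : W ≠ ⊥) : ∃ i, b i ∈ W := by
  obtain ⟨w, hw, hw0⟩ := W.exists_mem_ne_zero_of_ne_bot h
  obtain ⟨i, hi⟩ : ∃ i, b.repr w i ≠ 0 := by
    by_contra! h0
    exact hw0 (b.ext_elem fun i => by simpa using h0 i)
  exact ⟨i, basis_mem_of_repr_ne_zero b hA hμ W hW hw hi⟩

/-- An operator commuting with simultaneously diagonal operators that separate the vectors of a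
basis is diagonal. -/
theorem diagonal_of_commute (hA : ∀ c i, A c (b i) = μ c i • b i)
    (hμ : ∀ i j, i ≠ j → ∃ c, μ c i ≠ μ c j) {X : Module.End ℂ V}
    (hX : ∀ c, Commute X (A c)) (i : ι) : X (b i) = b.repr (X (b i)) i • b i := by
  refine b.ext_elem fun j => ?_
  rcases eq_or_ne j i with rfl | h
  · simp
  · obtain ⟨c, hc⟩ := hμ j i h
    have h1 := repr_diagonal b (hA c) (X (b i)) j
    have h2 : A c (X (b i)) = X (A c (b i)) := DFunLike.congr_fun (hX c).eq.symm (b i)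
    rw [h2, hA, map_smul, map_smul, Finsupp.smul_apply, smul_eq_mul] at h1
    have h3 : b.repr (X (b i)) j = 0 := by
      have : (μ c j - μ c i) * b.repr (X (b i)) j = 0 := by rw [sub_mul, ← h1, sub_self]
      exact (mul_eq_zero.mp this).resolve_left (sub_ne_zero.mpr hc)
    rw [h3, map_smul, b.repr_self, Finsupp.smul_apply, Finsupp.single_eq_of_ne h, smul_zero]

end Diagonal

/-! ### Consequences of q not being a root of unity; matrix coefficients of I₃₂ -/

section Numbers

variable {p : ℂ}

theorem zpow_ne_one (hq : NotRootOfUnity (p ^ 2)) {a : ℤ} (ha : a ≠ 0) : p ^ a ≠ 1 := by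
  intro h
  apply hq a.natAbs (by omega)
  have : p ^ (a.natAbs : ℤ) = 1 := by
    rcases Int.natAbs_eq a with h' | h'
    · rw [← h', h]
    · rw [show (a.natAbs : ℤ) = -a by omega, zpow_neg, h, inv_one]
  rw [zpow_natCast] at this
  rw [← pow_mul, mul_comm, pow_mul, this, one_pow]

theorem zpow_injective (hp : p ≠ 0) (hq : NotRootOfUnity (p ^ 2)) {a b : ℤ}
    (h : p ^ a = p ^ b) : a = b := by
  by_contra hab
  apply zpow_ne_one hq (sub_ne_zero.mpr hab)
  rw [zpow_sub₀ hp, h, div_self (zpow_ne_zero _ hp)]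

theorem zpow_ne_neg_one (hp : p ≠ 0) (hq : NotRootOfUnity (p ^ 2)) (a : ℤ) : p ^ a ≠ -1 := by
  intro h
  rcases eq_or_ne a 0 with rfl | ha
  · norm_num at h
  · apply zpow_ne_one hq (show a + a ≠ 0 by omega)
    rw [zpow_add₀ hp, h]
    norm_num

/-- The difference of the two sides factors as (p^a - p^b)(1 + p^{-(a+b)}), and -1 is not a power of
p. This separates the eigenvalues of I₂₁ and of I₄₃. -/
theorem zpow_sub_zpow_neg_injective (hp : p ≠ 0) (hq : NotRootOfUnity (p ^ 2)) {a b : ℤ}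
    (h : p ^ a - p ^ (-a) = p ^ b - p ^ (-b)) : a = b := by
  have h1 : (p ^ a - p ^ b) * (1 + p ^ (-(a + b))) = 0 := by
    have h2 : p ^ a * p ^ (-(a + b)) = p ^ (-b) := by rw [← zpow_add₀ hp]; congr 1; ring
    have h3 : p ^ b * p ^ (-(a + b)) = p ^ (-a) := by rw [← zpow_add₀ hp]; congr 1; ring
    linear_combination h + h2 - h3
  rcases mul_eq_zero.mp h1 with h2 | h2
  · exact zpow_injective hp hq (sub_eq_zero.mp h2)
  · exact absurd (by linear_combination h2) (zpow_ne_neg_one hp hq (-(a + b)))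

/-- The difference of the two sides factors as (p^a - p^b)(1 - p^{-(a+b)}); positivity excludes a =
-b. This separates the Casimir eigenvalues of different spins. -/
theorem zpow_add_zpow_neg_injective (hp : p ≠ 0) (hq : NotRootOfUnity (p ^ 2)) {a b : ℤ}
    (ha : 0 < a) (hb : 0 < b) (h : p ^ a + p ^ (-a) = p ^ b + p ^ (-b)) : a = b := by
  have h1 : (p ^ a - p ^ b) * (1 - p ^ (-(a + b))) = 0 := by
    have h2 : p ^ a * p ^ (-(a + b)) = p ^ (-b) := by rw [← zpow_add₀ hp]; congr 1; ring
    have h3 : p ^ b * p ^ (-(a + b)) = p ^ (-a) := by rw [← zpow_add₀ hp]; congr 1; ring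
    linear_combination h - h2 + h3
  rcases mul_eq_zero.mp h1 with h2 | h2
  · exact zpow_injective hp hq (sub_eq_zero.mp h2)
  · exact absurd (by linear_combination -h2) (zpow_ne_one hq (show -(a + b) ≠ 0 by omega))

theorem sq_zpow (a : ℤ) : (p ^ 2) ^ a = p ^ (2 * a) := by
  rw [zpow_mul]; norm_cast

theorem qnum_ne_zero (hp : p ≠ 0) (hq : NotRootOfUnity (p ^ 2)) {a : ℤ} (ha : a ≠ 0) :
    qnum (p ^ 2) a ≠ 0 := by
  refine div_ne_zero (fun h => ha ?_) (hq.sub_inv_ne_zero (pow_ne_zero 2 hp))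
  rw [sq_zpow, sq_zpow] at h
  have := zpow_injective hp hq (sub_eq_zero.mp h)
  omega

/-- The matrix coefficient `x⁻¹ p^{-a} + x p^a`. -/
def alpha (p x : ℂ) (a : ℤ) : ℂ := x⁻¹ * p ^ (-a) + x * p ^ a

/-- For the standard root x = p^{-n} the coefficient is p^{n-a} + p^{-(n-a)}. -/
theorem alpha_ne_zero (hp : p ≠ 0) (hq : NotRootOfUnity (p ^ 2)) (n a : ℤ) :
    alpha p (p ^ (-n)) a ≠ 0 := by
  have h := zpow_add_zpow_neg_ne_zero hp hq (n - a)
  rwa [neg_sub, zpow_sub₀ hp, zpow_sub₀ hp, div_eq_mul_inv, div_eq_mul_inv, ← zpow_neg,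
    ← zpow_neg, mul_comm (p ^ a), ← inv_inv (p ^ n), ← zpow_neg] at h

/-- The coefficient of a step up from weight a times that of the step back from a+2 sees x only
through q⁻¹x² + q x⁻², the combination fixed by the Casimir element. Different roots of the quartic
therefore give the same products. -/
theorem alpha_mul (hp : p ≠ 0) {x : ℂ} (hx : x ≠ 0) (a : ℤ) :
    alpha p x a * alpha p x (-(a + 2)) =
      (p ^ 2)⁻¹ * x ^ 2 + p ^ 2 * (x ^ 2)⁻¹ + (p ^ (2 * a + 2) + p ^ (-(2 * a + 2))) := by
  have e : ∀ t : ℤ, p ^ (2 * t + 2) = p ^ t * p ^ t * p ^ 2 := by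
    intro t
    rw [zpow_add₀ hp, two_mul, zpow_add₀ hp]; norm_cast
  have e' : p ^ (a + 2) = p ^ a * p ^ 2 := by rw [zpow_add₀ hp]; norm_cast
  simp only [alpha, neg_neg, zpow_neg, e, e']
  have : p ^ a ≠ 0 := zpow_ne_zero _ hp
  field_simp
  ring

end Numbers

/-! ### Weight vectors -/

section Weights

variable {p : ℂ} {n : ℕ}

/-- `u` is a weight vector, `q^H u = p^a u`. -/
def IsWeight (p : ℂ) (n : ℕ) (a : ℤ) (u : SpinSpace n) : Prop :=
  spinGen p n .k u = p ^ a • u ∧ spinGen p n .kinv u = p ^ (-a) • u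

theorem IsWeight.smul {a : ℤ} {u : SpinSpace n} (h : IsWeight p n a u) (c : ℂ) :
    IsWeight p n a (c • u) :=
  ⟨by rw [map_smul, h.1, smul_comm], by rw [map_smul, h.2, smul_comm]⟩

theorem isWeight_single (i : Fin (n + 1)) : IsWeight p n (2 * i - n) (Pi.single i 1) :=
  ⟨spinGen_k p n i, spinGen_kinv p n i⟩

theorem IsWeight.e (hp : p ≠ 0) {a : ℤ} {u : SpinSpace n} (h : IsWeight p n a u) :
    IsWeight p n (a + 2) (spinGen p n .e u) := by
  have h1 := congrArg (spinRep p hp n) (sl2_k_e (p ^ 2))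
  have h2 := congrArg (spinRep p hp n) (sl2_kinv_e (q := p ^ 2) (pow_ne_zero 2 hp))
  simp only [map_mul, map_smul, spinRep_gen] at h1 h2
  have h1' := DFunLike.congr_fun h1 u
  have h2' := DFunLike.congr_fun h2 u
  simp only [Module.End.mul_apply, LinearMap.smul_apply, h.1, h.2, map_smul, smul_smul] at h1' h2'
  refine ⟨by rw [h1', zpow_add₀ hp, mul_comm]; norm_cast, ?_⟩
  rw [h2', neg_add, zpow_add₀ hp, mul_comm, zpow_neg p 2]; norm_cast

theorem IsWeight.f (hp : p ≠ 0) {a : ℤ} {u : SpinSpace n} (h : IsWeight p n a u) :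
    IsWeight p n (a - 2) (spinGen p n .f u) := by
  have h1 := congrArg (spinRep p hp n) (sl2_k_f (p ^ 2))
  have h2 := congrArg (spinRep p hp n) (sl2_kinv_f (q := p ^ 2) (pow_ne_zero 2 hp))
  simp only [map_mul, map_smul, spinRep_gen] at h1 h2
  have h1' := DFunLike.congr_fun h1 u
  have h2' := DFunLike.congr_fun h2 u
  simp only [Module.End.mul_apply, LinearMap.smul_apply, h.1, h.2, map_smul, smul_smul] at h1' h2'
  refine ⟨by rw [h1', sub_eq_add_neg, zpow_add₀ hp, mul_comm, zpow_neg p 2]; norm_cast, ?_⟩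
  rw [h2', neg_sub, sub_eq_add_neg, zpow_add₀ hp]; norm_cast

end Weights

/-! ### Existence and uniqueness of extensions to the extended algebra -/

section Extensions

theorem extIncl_incl (q : ℂ) (i : Fin 2) (u : UqSl2 q) : extIncl q (incl q i u) = extOf q i u := by
  fin_cases i <;> simp [extIncl, incl]

variable {q : ℂ} {B : Type*} [Semiring B] [Algebra ℂ B] {ρ : UqSl2Two q →ₐ[ℂ] B}
  {X : Fin 2 → B} {T : UqExt q →ₐ[ℂ] B}

theorem IsExtension.apply (h : IsExtension ρ X T) (u : UqSl2Two q) : T (extIncl q u) = ρ u :=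
  DFunLike.congr_fun h.1 u

theorem IsExtension.ext_s (h : IsExtension ρ X T) (i : Fin 2) (g : Sl2Gen) :
    T (ext q (.s i g)) = ρ (incl q i (sl2 q g)) := by
  rw [← h.apply, extIncl_incl, extOf_gen]

theorem extIncl_sumEl (q : ℂ) (j : ℤ) : extIncl q (sumEl q j) =
    q ^ j • (ext q (.s 0 .k) * ext q (.s 1 .k)) +
      q ^ (-j) • (ext q (.s 0 .kinv) * ext q (.s 1 .kinv)) := by
  simp only [sumEl_eq, map_add, map_smul, map_mul, extIncl_incl, extOf_gen]

theorem extIncl_diffEl (q : ℂ) (j : ℤ) : extIncl q (diffEl q j) =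
    q ^ j • (ext q (.s 0 .k) * ext q (.s 1 .kinv)) +
      q ^ (-j) • (ext q (.s 0 .kinv) * ext q (.s 1 .k)) := by
  simp only [diffEl_eq, map_add, map_smul, map_mul, extIncl_incl, extOf_gen]

theorem IsExtension.sumInv_mul (h : IsExtension ρ X T) (j : ℤ) :
    T (ext q (.sumInv j)) * ρ (sumEl q j) = 1 := by
  rw [← h.apply, ← map_mul, extIncl_sumEl, QSo4.sumInv_mul, map_one]

theorem IsExtension.diffInv_mul (h : IsExtension ρ X T) (j : ℤ) :
    T (ext q (.diffInv j)) * ρ (diffEl q j) = 1 := by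
  rw [← h.apply, ← map_mul, extIncl_diffEl, QSo4.diffInv_mul, map_one]

theorem ext_algHom_ext {f g : UqExt q →ₐ[ℂ] B} (h : ∀ x, f (ext q x) = g (ext q x)) :
    f = g := by
  refine RingQuot.ringQuot_ext' ℂ _ _ (FreeAlgebra.hom_ext ?_)
  funext x
  exact h x

/-- The values on `sumInv j` and `diffInv j` are left inverses of units, so they leave no freedom.
-/
theorem IsExtension.unique {T' : UqExt q →ₐ[ℂ] B} (h : IsExtension ρ X T)
    (h' : IsExtension ρ X T') (hs : ∀ j, IsUnit (ρ (sumEl q j)))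
    (hd : ∀ j, IsUnit (ρ (diffEl q j))) : T = T' := by
  refine ext_algHom_ext fun x => ?_
  cases x with
  | s i g => rw [h.ext_s, h'.ext_s]
  | x i => rw [h.2, h'.2]
  | sumInv j => exact (hs j).mul_right_cancel ((h.sumInv_mul j).trans (h'.sumInv_mul j).symm)
  | diffInv j => exact (hd j).mul_right_cancel ((h.diffInv_mul j).trans (h'.diffInv_mul j).symm)

theorem isExtension_extLift (hq : q ≠ 0) (hX : IsQuarticSolution ρ X)
    (hs : ∀ j, IsUnit (ρ (sumEl q j))) (hd : ∀ j, IsUnit (ρ (diffEl q j))) :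
    IsExtension ρ X (extLift hq ρ X hX hs hd) := by
  refine ⟨Algebra.TensorProduct.ext' fun u v => ?_, fun i => extLift_gen ..⟩
  have h : ∀ i, (extLift hq ρ X hX hs hd).comp (extOf q i) = ρ.comp (incl q i) := by
    intro i
    refine RingQuot.ringQuot_ext' ℂ _ _ (FreeAlgebra.hom_ext ?_)
    funext g
    exact (congrArg _ (extOf_gen q i g)).trans (extLift_gen ..)
  have h0 := DFunLike.congr_fun (h 0) u
  have h1 := DFunLike.congr_fun (h 1) v
  simp only [AlgHom.comp_apply] at h0 h1 ⊢
  rw [← incl_zero_mul_one, map_mul, map_mul, map_mul, extIncl_incl, extIncl_incl, h0, h1]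

end Extensions

/-! ### Action of the generators when x₁ and x₂ are scalars -/

section MatrixElements

/-- `p^a + p^{-a}`. -/
def sig (p : ℂ) (a : ℤ) : ℂ := p ^ a + p ^ (-a)

variable {p : ℂ} {hp : p ≠ 0} {n n' : ℕ} {x : Fin 2 → ℂ}
  {T : UqExt (p ^ 2) →ₐ[ℂ] Module.End ℂ (SpinSpace n ⊗[ℂ] SpinSpace n')}

theorem ext_s_zero_tmul (hT : IsExtension (spinRepTwo p hp n n') (fun i => x i • 1) T)
    (g : Sl2Gen) (u : SpinSpace n) (w : SpinSpace n') :
    T (ext _ (.s 0 g)) (u ⊗ₜ w) = spinGen p n g u ⊗ₜ w := by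
  rw [hT.ext_s]
  simp [incl, spinRepTwo, repTensor_tmul, spinRep_gen]

theorem ext_s_one_tmul (hT : IsExtension (spinRepTwo p hp n n') (fun i => x i • 1) T)
    (g : Sl2Gen) (u : SpinSpace n) (w : SpinSpace n') :
    T (ext _ (.s 1 g)) (u ⊗ₜ w) = u ⊗ₜ spinGen p n' g w := by
  rw [hT.ext_s]
  simp [incl, spinRepTwo, repTensor_tmul, spinRep_gen]

theorem ext_x_apply (hT : IsExtension (spinRepTwo p hp n n') (fun i => x i • 1) T) (i : Fin 2)
    (z : SpinSpace n ⊗[ℂ] SpinSpace n') : T (ext _ (.x i)) z = x i • z := by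
  rw [hT.2]; simp

theorem root_ne_zero (hT : IsExtension (spinRepTwo p hp n n') (fun i => x i • 1) T) (i : Fin 2) :
    x i ≠ 0 := by
  intro h
  have h1 := congrArg T (xInv_mul (pow_ne_zero 2 hp) i)
  rw [map_mul, hT.2, map_one] at h1
  simp only [h, zero_smul, mul_zero] at h1
  exact zero_ne_one h1

theorem xInv_apply (hT : IsExtension (spinRepTwo p hp n n') (fun i => x i • 1) T) (i : Fin 2)
    (z : SpinSpace n ⊗[ℂ] SpinSpace n') : T (xInv _ i) z = (x i)⁻¹ • z := by
  have h1 := congrArg T (xInv_mul (pow_ne_zero 2 hp) i)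
  rw [map_mul, hT.2, map_one, mul_smul_comm, mul_one] at h1
  rw [eq_inv_smul_iff₀ (root_ne_zero hT i)]
  exact DFunLike.congr_fun h1 z

theorem sumInv_apply (hq : NotRootOfUnity (p ^ 2))
    (hT : IsExtension (spinRepTwo p hp n n') (fun i => x i • 1) T) (j : ℤ) {a a' : ℤ}
    {u : SpinSpace n} {w : SpinSpace n'} (hu : IsWeight p n a u) (hw : IsWeight p n' a' w) :
    T (ext _ (.sumInv j)) (u ⊗ₜ w) = (sig p (2 * j + a + a'))⁻¹ • (u ⊗ₜ w) := by
  have h1 : spinRepTwo p hp n n' (sumEl (p ^ 2) j) (u ⊗ₜ w) =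
      sig p (2 * j + a + a') • (u ⊗ₜ w) := by
    simp only [spinRepTwo, sumEl, map_add, map_smul, repTensor_tmul, spinRep_gen,
      LinearMap.add_apply, LinearMap.smul_apply, TensorProduct.map_tmul, hu.1, hu.2, hw.1, hw.2,
      TensorProduct.smul_tmul', TensorProduct.tmul_smul, smul_smul]
    rw [← TensorProduct.add_tmul, ← add_smul, sig, sq_zpow, sq_zpow, ← zpow_add₀ hp,
      ← zpow_add₀ hp, ← zpow_add₀ hp, ← zpow_add₀ hp]
    congr 4 <;> ring
  have h2 := DFunLike.congr_fun (hT.sumInv_mul j) (u ⊗ₜ w)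
  rw [Module.End.mul_apply, h1, map_smul, Module.End.one_apply] at h2
  have h3 : sig p (2 * j + a + a') ≠ 0 := zpow_add_zpow_neg_ne_zero hp hq _
  rwa [eq_inv_smul_iff₀ h3]

theorem diffInv_apply (hq : NotRootOfUnity (p ^ 2))
    (hT : IsExtension (spinRepTwo p hp n n') (fun i => x i • 1) T) (j : ℤ) {a a' : ℤ}
    {u : SpinSpace n} {w : SpinSpace n'} (hu : IsWeight p n a u) (hw : IsWeight p n' a' w) :
    T (ext _ (.diffInv j)) (u ⊗ₜ w) = (sig p (2 * j + a - a'))⁻¹ • (u ⊗ₜ w) := by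
  have h1 : spinRepTwo p hp n n' (diffEl (p ^ 2) j) (u ⊗ₜ w) =
      sig p (2 * j + a - a') • (u ⊗ₜ w) := by
    simp only [spinRepTwo, diffEl, map_add, map_smul, repTensor_tmul, spinRep_gen,
      LinearMap.add_apply, LinearMap.smul_apply, TensorProduct.map_tmul, hu.1, hu.2, hw.1, hw.2,
      TensorProduct.smul_tmul', TensorProduct.tmul_smul, smul_smul]
    rw [← TensorProduct.add_tmul, ← add_smul, sig, sq_zpow, sq_zpow, ← zpow_add₀ hp,
      ← zpow_add₀ hp, ← zpow_add₀ hp, ← zpow_add₀ hp]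
    congr 4 <;> ring
  have h2 := DFunLike.congr_fun (hT.diffInv_mul j) (u ⊗ₜ w)
  rw [Module.End.mul_apply, h1, map_smul, Module.End.one_apply] at h2
  have h3 : sig p (2 * j + a - a') ≠ 0 := zpow_add_zpow_neg_ne_zero hp hq _
  rwa [eq_inv_smul_iff₀ h3]

theorem numDown_one (hT : IsExtension (spinRepTwo p hp n n') (fun i => x i • 1) T) (i : Fin 2)
    {a : ℤ} (u : SpinSpace n) {w : SpinSpace n'} (hw : IsWeight p n' a w) :
    T (numDown _ i 1) (u ⊗ₜ w) = alpha p (x i) (a - 2) • (u ⊗ₜ w) := by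
  simp only [numDown, map_add, map_smul, map_mul, LinearMap.add_apply, LinearMap.smul_apply,
    Module.End.mul_apply, ext_s_one_tmul hT, hw.1, hw.2, TensorProduct.tmul_smul, xInv_apply hT,
    ext_x_apply hT, smul_smul, ← add_smul, alpha, neg_sub, zpow_sub₀ hp, zpow_neg]
  norm_cast
  congr 1
  field_simp

theorem numUp_one (hT : IsExtension (spinRepTwo p hp n n') (fun i => x i • 1) T) (i : Fin 2)
    {a : ℤ} (u : SpinSpace n) {w : SpinSpace n'} (hw : IsWeight p n' a w) :
    T (numUp _ i 1) (u ⊗ₜ w) = alpha p (x i) (-(a + 2)) • (u ⊗ₜ w) := by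
  simp only [numUp, map_add, map_smul, map_mul, LinearMap.add_apply, LinearMap.smul_apply,
    Module.End.mul_apply, ext_s_one_tmul hT, hw.1, hw.2, TensorProduct.tmul_smul, xInv_apply hT,
    ext_x_apply hT, smul_smul, ← add_smul, alpha, neg_neg, zpow_add₀ hp, zpow_neg]
  norm_cast
  congr 1
  field_simp

theorem numDown_zero (hT : IsExtension (spinRepTwo p hp n n') (fun i => x i • 1) T) (i : Fin 2)
    {a : ℤ} {u : SpinSpace n} (w : SpinSpace n') (hu : IsWeight p n a u) :
    T (numDown _ i 0) (u ⊗ₜ w) = alpha p (x i) (a - 2) • (u ⊗ₜ w) := by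
  simp only [numDown, map_add, map_smul, map_mul, LinearMap.add_apply, LinearMap.smul_apply,
    Module.End.mul_apply, ext_s_zero_tmul hT, hu.1, hu.2, ← TensorProduct.smul_tmul',
    xInv_apply hT,
    ext_x_apply hT, smul_smul, ← add_smul, alpha, neg_sub, zpow_sub₀ hp, zpow_neg]
  norm_cast
  congr 1
  field_simp

theorem numUp_zero (hT : IsExtension (spinRepTwo p hp n n') (fun i => x i • 1) T) (i : Fin 2)
    {a : ℤ} {u : SpinSpace n} (w : SpinSpace n') (hu : IsWeight p n a u) :
    T (numUp _ i 0) (u ⊗ₜ w) = alpha p (x i) (-(a + 2)) • (u ⊗ₜ w) := by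
  simp only [numUp, map_add, map_smul, map_mul, LinearMap.add_apply, LinearMap.smul_apply,
    Module.End.mul_apply, ext_s_zero_tmul hT, hu.1, hu.2, ← TensorProduct.smul_tmul',
    xInv_apply hT,
    ext_x_apply hT, smul_smul, ← add_smul, alpha, neg_neg, zpow_add₀ hp, zpow_neg]
  norm_cast
  congr 1
  field_simp

variable {φ : UqSo4 (p ^ 2) →ₐ[ℂ] UqExt (p ^ 2)}

/-- The exponents a, a' are twice the weights. Each denominator acts after e or f has moved a
weight, and its index ±1 undoes that move, so all four terms share the denominator of the initial
vector. The shifts in the numerators are undone in the same way. -/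
theorem I32_apply (hq : NotRootOfUnity (p ^ 2)) (hφ : IsPhi (p ^ 2) φ)
    (hT : IsExtension (spinRepTwo p hp n n') (fun i => x i • 1) T) {a a' : ℤ}
    {u : SpinSpace n} {w : SpinSpace n'} (hu : IsWeight p n a u) (hw : IsWeight p n' a' w) :
    T (φ (so4 _ .I32)) (u ⊗ₜ w) = (sig p (a + a') * sig p (a - a'))⁻¹ •
      (-(alpha p (x 0) a' • (u ⊗ₜ spinGen p n' .e w))
        + alpha p (x 0) (-a') • (u ⊗ₜ spinGen p n' .f w)
        + alpha p (x 1) a • (spinGen p n .e u ⊗ₜ w)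
        - alpha p (x 1) (-a) • (spinGen p n .f u ⊗ₜ w)) := by
  rw [hφ.I32]
  simp only [map_add, map_sub, map_neg, map_mul, LinearMap.add_apply, LinearMap.sub_apply,
    LinearMap.neg_apply, Module.End.mul_apply, ext_s_zero_tmul hT, ext_s_one_tmul hT,
    diffInv_apply hq hT _ hu (hw.e hp), diffInv_apply hq hT _ hu (hw.f hp),
    diffInv_apply hq hT _ (hu.e hp) hw, diffInv_apply hq hT _ (hu.f hp) hw,
    sumInv_apply hq hT _ hu (hw.e hp), sumInv_apply hq hT _ hu (hw.f hp),
    sumInv_apply hq hT _ (hu.e hp) hw, sumInv_apply hq hT _ (hu.f hp) hw, map_smul,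
    numDown_one hT _ _ (hw.e hp), numUp_one hT _ _ (hw.f hp),
    numDown_zero hT _ _ (hu.e hp), numUp_zero hT _ _ (hu.f hp), smul_smul]
  rw [show 2 * 1 + a - (a' + 2) = a - a' by ring, show 2 * -1 + a + (a' + 2) = a + a' by ring,
    show 2 * -1 + a - (a' - 2) = a - a' by ring, show 2 * 1 + a + (a' - 2) = a + a' by ring,
    show 2 * -1 + (a + 2) - a' = a - a' by ring, show 2 * -1 + (a + 2) + a' = a + a' by ring,
    show 2 * 1 + (a - 2) - a' = a - a' by ring, show 2 * 1 + (a - 2) + a' = a + a' by ring,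
    add_sub_cancel_right, add_sub_cancel_right, sub_add_cancel, sub_add_cancel, mul_inv]
  module

theorem I21_apply (hφ : IsPhi (p ^ 2) φ)
    (hT : IsExtension (spinRepTwo p hp n n') (fun i => x i • 1) T) {a a' : ℤ}
    {u : SpinSpace n} {w : SpinSpace n'} (hu : IsWeight p n a u) (hw : IsWeight p n' a' w) :
    T (φ (so4 _ .I21)) (u ⊗ₜ w) = (Complex.I / (p ^ 2 - (p ^ 2)⁻¹) *
      (p ^ (a + a') - p ^ (-(a + a')))) • (u ⊗ₜ w) := by
  rw [hφ.I21]
  simp only [map_sub, map_mul, map_smul, LinearMap.sub_apply, LinearMap.smul_apply,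
    Module.End.mul_apply, ext_s_zero_tmul hT, ext_s_one_tmul hT, hu.1, hu.2, hw.1, hw.2,
    ← TensorProduct.smul_tmul', TensorProduct.tmul_smul, smul_smul, ← sub_smul,
    ← zpow_add₀ hp]
  congr 4 <;> ring

theorem I43_apply (hφ : IsPhi (p ^ 2) φ)
    (hT : IsExtension (spinRepTwo p hp n n') (fun i => x i • 1) T) {a a' : ℤ}
    {u : SpinSpace n} {w : SpinSpace n'} (hu : IsWeight p n a u) (hw : IsWeight p n' a' w) :
    T (φ (so4 _ .I43)) (u ⊗ₜ w) = (Complex.I / (p ^ 2 - (p ^ 2)⁻¹) *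
      (p ^ (a - a') - p ^ (-(a - a')))) • (u ⊗ₜ w) := by
  rw [hφ.I43]
  simp only [map_sub, map_mul, map_smul, LinearMap.sub_apply, LinearMap.smul_apply,
    Module.End.mul_apply, ext_s_zero_tmul hT, ext_s_one_tmul hT, hu.1, hu.2, hw.1, hw.2,
    ← TensorProduct.smul_tmul', TensorProduct.tmul_smul, smul_smul, ← sub_smul,
    ← zpow_add₀ hp]
  congr 4 <;> ring

end MatrixElements

/-! ### Irreducibility of R_{jj'} -/

section Irreducible

/-- The basis `|l,m⟩ ⊗ |l',m'⟩`. -/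
def spinBasis (n n' : ℕ) :
    Module.Basis (Fin (n + 1) × Fin (n' + 1)) ℂ (SpinSpace n ⊗[ℂ] SpinSpace n') :=
  (Pi.basisFun ℂ (Fin (n + 1))).tensorProduct (Pi.basisFun ℂ (Fin (n' + 1)))

theorem spinBasis_apply (n n' : ℕ) (i : Fin (n + 1) × Fin (n' + 1)) :
    spinBasis n n' i = Pi.single i.1 1 ⊗ₜ Pi.single i.2 1 := by
  rw [spinBasis, Module.Basis.tensorProduct_apply', Pi.basisFun_apply, Pi.basisFun_apply]

theorem spinBasis_repr_tmul (n n' : ℕ) (u : SpinSpace n) (w : SpinSpace n')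
    (i : Fin (n + 1) × Fin (n' + 1)) : (spinBasis n n').repr (u ⊗ₜ w) i = u i.1 * w i.2 := by
  rw [spinBasis]
  exact (Module.Basis.tensorProduct_repr_tmul_apply ..).trans (by simp [mul_comm])

theorem isExtension_extRep (p : ℂ) (hp : p ≠ 0) (hq : NotRootOfUnity (p ^ 2)) (n n' : ℕ) :
    IsExtension (spinRepTwo p hp n n')
      (fun i => (![p ^ (-(n : ℤ)), p ^ (-(n' : ℤ))] i) • 1) (extRep p hp hq n n') := by
  have : (fun i => (![p ^ (-(n : ℤ)), p ^ (-(n' : ℤ))] i) •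
      (1 : Module.End ℂ (SpinSpace n ⊗[ℂ] SpinSpace n'))) = spinX p n n' := by
    funext i
    fin_cases i <;> rfl
  rw [this]
  exact isExtension_extLift ..

theorem fin_forall_of_iff {n : ℕ} {P : Fin (n + 1) → Prop}
    (h : ∀ i : ℕ, ∀ hi : i < n, P ⟨i, by omega⟩ ↔ P ⟨i + 1, by omega⟩) {i : Fin (n + 1)}
    (hi : P i) (j : Fin (n + 1)) : P j := by
  have key : ∀ k : ℕ, ∀ hk : k < n + 1, P ⟨k, hk⟩ ↔ P 0 := by
    intro k
    induction k with
    | zero => exact fun _ => Iff.rfl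
    | succ k ih => exact fun hk => (h k (by omega)).symm.trans (ih _)
  exact (key j j.2).mpr ((key i i.2).mp hi)

theorem spinGen_e_apply (p : ℂ) (n : ℕ) (i j : Fin (n + 1)) :
    spinGen p n .e (Pi.single i 1) j =
      if (j : ℕ) = i + 1 then qnum (p ^ 2) ((n : ℤ) - i) else 0 := by
  rw [spinGen_e]
  split_ifs with h1 h2 h2
  · have : j = ⟨i + 1, by omega⟩ := Fin.ext h2
    simp [this]
  · have : j ≠ ⟨i + 1, by omega⟩ := fun h => h2 (congrArg Fin.val h)
    simp [this]
  · omega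
  · rfl

theorem spinGen_f_apply (p : ℂ) (n : ℕ) (i j : Fin (n + 1)) :
    spinGen p n .f (Pi.single i 1) j =
      if (j : ℕ) + 1 = i then qnum (p ^ 2) i else 0 := by
  rw [spinGen_f]
  split_ifs with h1 h2 h2
  · have : j = ⟨i - 1, by omega⟩ := Fin.ext (by simp; omega)
    simp [this]
  · have : j ≠ ⟨i - 1, by omega⟩ := fun h => h2 (by rw [h]; simp; omega)
    simp [this]
  · omega
  · rfl

variable {p : ℂ} {hp : p ≠ 0} {n n' : ℕ} {φ : UqSo4 (p ^ 2) →ₐ[ℂ] UqExt (p ^ 2)}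

/-- I₂₁ and I₄₃ have simple joint spectrum on the basis vectors, so a nonzero invariant subspace
contains one of them. I₃₂ maps it to a vector with nonzero components along all its neighbours,
which hence also lie in the subspace, and the grid of indices is connected. -/
theorem so4Rep_irreducible (hq : NotRootOfUnity (p ^ 2)) (hφ : IsPhi (p ^ 2) φ) :
    RepIrreducible (so4Rep p hp hq φ n n') := by
  refine ⟨inferInstance, fun W hW => ?_⟩
  have hT := isExtension_extRep p hp hq n n'
  have hc : Complex.I / (p ^ 2 - (p ^ 2)⁻¹) ≠ 0 :=
    div_ne_zero Complex.I_ne_zero (hq.sub_inv_ne_zero (pow_ne_zero 2 hp))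
  let A : Bool → Module.End ℂ (SpinSpace n ⊗[ℂ] SpinSpace n') := fun c =>
    so4Rep p hp hq φ n n' (so4 _ (if c then .I21 else .I43))
  let μ : Bool → Fin (n + 1) × Fin (n' + 1) → ℂ := fun c i =>
    Complex.I / (p ^ 2 - (p ^ 2)⁻¹) *
      (if c then p ^ ((2 * (i.1 : ℤ) - n) + (2 * (i.2 : ℤ) - n')) -
          p ^ (-((2 * (i.1 : ℤ) - n) + (2 * (i.2 : ℤ) - n')))
        else p ^ ((2 * (i.1 : ℤ) - n) - (2 * (i.2 : ℤ) - n')) -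
          p ^ (-((2 * (i.1 : ℤ) - n) - (2 * (i.2 : ℤ) - n'))))
  have hA : ∀ c i, A c (spinBasis n n' i) = μ c i • spinBasis n n' i := by
    intro c i
    rw [spinBasis_apply]
    cases c
    · exact I43_apply hφ hT (isWeight_single i.1) (isWeight_single i.2)
    · exact I21_apply hφ hT (isWeight_single i.1) (isWeight_single i.2)
  -- The two eigenvalues determine the sum and the difference of the weights, hence both weights.
  have hμ : ∀ i j, i ≠ j → ∃ c, μ c i ≠ μ c j := by
    intro i j hij
    by_contra! h
    apply hij
    have h1 := zpow_sub_zpow_neg_injective hp hq (mul_left_cancel₀ hc (h true))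
    have h2 := zpow_sub_zpow_neg_injective hp hq (mul_left_cancel₀ hc (h false))
    exact Prod.ext (Fin.ext (by omega)) (Fin.ext (by omega))
  have hWA : ∀ c, ∀ v ∈ W, A c v ∈ W := fun c v hv => hW _ v hv
  rcases eq_or_ne W ⊥ with h0 | h0
  · exact Or.inl h0
  right
  have hα : ∀ (i : Fin 2) a, alpha p (![p ^ (-(n : ℤ)), p ^ (-(n' : ℤ))] i) a ≠ 0 := by
    intro i a
    fin_cases i
    · exact alpha_ne_zero hp hq n a
    · exact alpha_ne_zero hp hq n' a
  unfold so4Rep at hW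
  -- From here on only the nonvanishing of the coefficients matters, not the values of the roots.
  generalize ![p ^ (-(n : ℤ)), p ^ (-(n' : ℤ))] = x at hT hα
  have step : ∀ i j : Fin (n + 1) × Fin (n' + 1), spinBasis n n' i ∈ W →
      ((i.1 = j.1 ∧ ((j.2 : ℕ) = i.2 + 1 ∨ (i.2 : ℕ) = j.2 + 1)) ∨
        (i.2 = j.2 ∧ ((j.1 : ℕ) = i.1 + 1 ∨ (i.1 : ℕ) = j.1 + 1))) →
      spinBasis n n' j ∈ W := by
    intro i j hi hij
    refine basis_mem_of_repr_ne_zero _ hA hμ W hWA (hW (so4 _ .I32) _ hi) ?_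
    rw [spinBasis_apply, AlgHom.comp_apply,
      I32_apply hq hφ hT (isWeight_single i.1) (isWeight_single i.2)]
    simp only [map_smul, map_add, map_sub, map_neg, Finsupp.smul_apply, Finsupp.add_apply,
      Finsupp.sub_apply, Finsupp.neg_apply, spinBasis_repr_tmul, smul_eq_mul, spinGen_e_apply,
      spinGen_f_apply]
    refine mul_ne_zero (inv_ne_zero (mul_ne_zero (zpow_add_zpow_neg_ne_zero hp hq _)
      (zpow_add_zpow_neg_ne_zero hp hq _))) ?_
    obtain ⟨i, i'⟩ := i
    obtain ⟨j, j'⟩ := j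
    rcases hij with ⟨rfl, h | h⟩ | ⟨rfl, h | h⟩ <;> dsimp only at h
    · have h' : ¬ (i' : ℕ) + 1 + 1 = i' := by omega
      have := qnum_ne_zero hp hq (a := (n' : ℤ) - i') (by omega)
      simp [h, h', hα 0, this]
    · have h' : ¬ (j' : ℕ) = i' + 1 := by omega
      have := qnum_ne_zero hp hq (a := (i' : ℤ)) (by omega)
      simp [← h, h', hα 0, this]
    · have h' : ¬ (i : ℕ) + 1 + 1 = i := by omega
      have := qnum_ne_zero hp hq (a := (n : ℤ) - i) (by omega)
      simp [h, h', hα 1, this]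
    · have h' : ¬ (j : ℕ) = i + 1 := by omega
      have := qnum_ne_zero hp hq (a := (i : ℤ)) (by omega)
      simp [← h, h', hα 1, this]
  obtain ⟨i, hi⟩ := exists_basis_mem _ hA hμ W hWA h0
  have h1 : ∀ j', spinBasis n n' (i.1, j') ∈ W := fun j' =>
    fin_forall_of_iff (P := fun j' => spinBasis n n' (i.1, j') ∈ W) (i := i.2)
      (fun k hk => ⟨fun h => step _ _ h (by simp), fun h => step _ _ h (by simp)⟩) hi j'
  have h2 : ∀ j j', spinBasis n n' (j, j') ∈ W := fun j j' =>
    fin_forall_of_iff (P := fun j => spinBasis n n' (j, j') ∈ W) (i := i.1)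
      (fun k hk => ⟨fun h => step _ _ h (by simp), fun h => step _ _ h (by simp)⟩) (h1 j') j
  rw [eq_top_iff, ← (spinBasis n n').span_eq, Submodule.span_le]
  rintro _ ⟨j, rfl⟩
  exact h2 j.1 j.2

end Irreducible

/-! ### Independence of the choice of the roots x₁, x₂ -/

section Gauge

/-- Two representations of `U'_q(so₄)` intertwined on the generators are equivalent. -/
theorem repEquiv_of_gen {q : ℂ} {V W : Type*} [AddCommGroup V] [Module ℂ V] [AddCommGroup W]
    [Module ℂ W] {ρ : UqSo4 q →ₐ[ℂ] Module.End ℂ V} {σ : UqSo4 q →ₐ[ℂ] Module.End ℂ W}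
    (Ψ : V ≃ₗ[ℂ] W) (h : ∀ g v, Ψ (ρ (so4 q g) v) = σ (so4 q g) (Ψ v)) : RepEquiv ρ σ := by
  have : ((Ψ.conjAlgEquiv ℂ).toAlgHom).comp ρ = σ := by
    refine so4_algHom_ext fun g => LinearMap.ext fun v => ?_
    simpa using h g (Ψ.symm v)
  refine ⟨Ψ, fun a v => ?_⟩
  rw [← this]
  simp

/-- The diagonal operator with entries `d i`. -/
def diagEquiv (n : ℕ) (d : Fin (n + 1) → ℂˣ) : SpinSpace n ≃ₗ[ℂ] SpinSpace n :=
  LinearEquiv.piCongrRight fun i => LinearEquiv.smulOfUnit (d i)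

theorem diagEquiv_single (n : ℕ) (d : Fin (n + 1) → ℂˣ) (i : Fin (n + 1)) :
    diagEquiv n d (Pi.single i 1) = (d i : ℂ) • Pi.single i 1 := by
  ext j
  rcases eq_or_ne j i with rfl | h
  · simp only [diagEquiv, LinearEquiv.piCongrRight_apply, Pi.single_eq_same, Pi.smul_apply]
    rfl
  · simp [diagEquiv, h]

/-- A diagonal rescaling can adjust every raising coefficient at will. The lowering coefficients
then agree automatically, since for both roots a step up and the step back have the same product by
`alpha_mul`. The exponent m belongs to the other tensor factor and is independent of n. -/
theorem exists_gauge {p : ℂ} (hp : p ≠ 0) (hq : NotRootOfUnity (p ^ 2)) (n : ℕ) (m : ℤ) {x : ℂ}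
    (hx : x ≠ 0) (h : (p ^ 2)⁻¹ * x ^ 2 + p ^ 2 * (x ^ 2)⁻¹ =
      (p ^ 2)⁻¹ * (p ^ (-m)) ^ 2 + p ^ 2 * ((p ^ (-m)) ^ 2)⁻¹) :
    ∃ d : Fin (n + 1) → ℂˣ, ∀ i : Fin (n + 1),
      alpha p x (2 * i - n) • diagEquiv n d (spinGen p n .e (Pi.single i 1)) =
        alpha p (p ^ (-m)) (2 * i - n) • spinGen p n .e (diagEquiv n d (Pi.single i 1)) ∧
      alpha p x (-(2 * i - n)) • diagEquiv n d (spinGen p n .f (Pi.single i 1)) =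
        alpha p (p ^ (-m)) (-(2 * i - n)) • spinGen p n .f (diagEquiv n d (Pi.single i 1)) := by
  have h1 : ∀ a, alpha p x a * alpha p x (-(a + 2)) =
      alpha p (p ^ (-m)) a * alpha p (p ^ (-m)) (-(a + 2)) := fun a => by
    rw [alpha_mul hp hx, alpha_mul hp (zpow_ne_zero _ hp), h]
  -- The coefficients for the arbitrary root do not vanish, because their products equal those for
  -- the standard root.
  have h2 : ∀ a, alpha p x a ≠ 0 := fun a ha => by
    have := h1 a
    rw [ha, zero_mul] at this
    exact mul_ne_zero (alpha_ne_zero hp hq _ _) (alpha_ne_zero hp hq _ _) this.symm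
  -- The ratio of consecutive diagonal entries is dictated by the equation for e.
  let r : ℕ → ℂˣ := fun t => Units.mk0 _ (div_ne_zero
    (alpha_ne_zero hp hq m (2 * t - n)) (h2 (2 * t - n)))
  have hr : ∀ t : ℕ, (r t : ℂ) = alpha p (p ^ (-m)) (2 * t - n) / alpha p x (2 * t - n) :=
    fun t => rfl
  refine ⟨fun i => ∏ t ∈ Finset.range i, r t, fun i => ⟨?_, ?_⟩⟩
  · rw [diagEquiv_single, map_smul, spinGen_e]
    split_ifs with hi
    · rw [map_smul, diagEquiv_single, Finset.prod_range_succ, Units.val_mul, hr]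
      simp only [smul_smul]
      congr 1
      have := h2 (2 * i - n)
      field_simp
    · simp
  · rw [diagEquiv_single, map_smul, spinGen_f]
    split_ifs with hi
    · obtain ⟨k, hk⟩ : ∃ k, (i : ℕ) = k + 1 := ⟨i - 1, by omega⟩
      rw [map_smul, diagEquiv_single]
      simp only [hk, Nat.add_sub_cancel, Finset.prod_range_succ, Units.val_mul, hr, smul_smul]
      congr 1
      have h3 := h2 (2 * k - n)
      -- The equation for f from index k+1 to k is the product identity at the lower weight.
      have h4 := h1 (2 * k - n)
      rw [show 2 * ((k + 1 : ℕ) : ℤ) - n = 2 * k - n + 2 by push_cast; ring]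
      field_simp
      linear_combination (↑(∏ t ∈ Finset.range k, r t) * qnum (p ^ 2) ((k + 1 : ℕ) : ℤ)) * h4
    · simp

variable {p : ℂ} {hp : p ≠ 0} {n n' : ℕ} {φ : UqSo4 (p ^ 2) →ₐ[ℂ] UqExt (p ^ 2)} {x : Fin 2 → ℂ}
  {T : UqExt (p ^ 2) →ₐ[ℂ] Module.End ℂ (SpinSpace n ⊗[ℂ] SpinSpace n')}

/-- Both sides are the eigenvalue of (q-q⁻¹)²c_i on one nonzero vector: once through the root, by
`gam_eq`, and once through the known value of the Casimir element. -/
theorem root_equation (hq : NotRootOfUnity (p ^ 2))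
    (hT : IsExtension (spinRepTwo p hp n n') (fun i => x i • 1) T) (i : Fin 2) :
    (p ^ 2)⁻¹ * x i ^ 2 + p ^ 2 * (x i ^ 2)⁻¹ =
      (p ^ 2) ^ ((![n, n'] i : ℤ) + 1) + (p ^ 2) ^ (-((![n, n'] i : ℤ) + 1)) := by
  have hs := hq.sub_inv_ne_zero (pow_ne_zero 2 hp)
  have h := congrArg T (gam_eq (pow_ne_zero 2 hp) i)
  rw [map_smul, ← extIncl_incl, hT.apply] at h
  have hv : (Pi.single 0 1 ⊗ₜ Pi.single 0 1 : SpinSpace n ⊗[ℂ] SpinSpace n') ≠ 0 := by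
    rw [← spinBasis_apply n n' (0, 0)]
    exact (spinBasis n n').ne_zero _
  have h1 := DFunLike.congr_fun h (Pi.single 0 1 ⊗ₜ Pi.single 0 1)
  have h2 : spinRepTwo p hp n n' (incl _ i (casimir _)) (Pi.single 0 1 ⊗ₜ Pi.single 0 1) =
      (((p ^ 2) ^ ((![n, n'] i : ℤ) + 1) + (p ^ 2) ^ (-((![n, n'] i : ℤ) + 1))) /
        (p ^ 2 - (p ^ 2)⁻¹) ^ 2) • (Pi.single 0 1 ⊗ₜ Pi.single 0 1) := by
    fin_cases i
    · simp only [spinRepTwo, incl, Fin.zero_eta, Algebra.TensorProduct.includeLeft_apply,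
        repTensor_tmul, spinRep_casimir hp hq, map_one, TensorProduct.map_tmul,
        LinearMap.smul_apply, Module.End.one_apply, TensorProduct.smul_tmul',
        Matrix.cons_val_zero]
    · simp only [spinRepTwo, incl, Fin.mk_one, Algebra.TensorProduct.includeRight_apply,
        repTensor_tmul, spinRep_casimir hp hq, map_one, TensorProduct.map_tmul,
        LinearMap.smul_apply, Module.End.one_apply, TensorProduct.tmul_smul,
        Matrix.cons_val_one, Matrix.cons_val_fin_one]
  rw [LinearMap.smul_apply, h2, smul_smul, mul_div_cancel₀ _ (pow_ne_zero 2 hs)] at h1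
  simp only [gam, map_add, map_smul, map_pow, pow_two (T _), LinearMap.add_apply,
    LinearMap.smul_apply, Module.End.mul_apply, ext_x_apply hT, xInv_apply hT, smul_smul,
    ← add_smul] at h1
  rw [← smul_left_injective ℂ hv h1]
  ring

/-- In `I32_apply` the denominators depend on weights only, the coefficients of e₂, f₂ only on x₁
and the second weight, and those of e₁, f₁ only on x₂ and the first weight. A tensor product of two
diagonal maps therefore intertwines, and it commutes with the diagonal I₂₁, I₄₃ automatically. -/
theorem repEquiv_extension (hq : NotRootOfUnity (p ^ 2)) (hφ : IsPhi (p ^ 2) φ)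
    (hT : IsExtension (spinRepTwo p hp n n') (fun i => x i • 1) T) :
    RepEquiv (T.comp φ) (so4Rep p hp hq φ n n') := by
  have hT' := isExtension_extRep p hp hq n n'
  have e0 := (root_equation hq hT 0).trans (root_equation hq hT' 0).symm
  have e1 := (root_equation hq hT 1).trans (root_equation hq hT' 1).symm
  -- The roots act crosswise: the second factor is rescaled because of x₁, whose standard value
  -- comes from n, and conversely.
  obtain ⟨d', hd'⟩ := exists_gauge hp hq n' n (root_ne_zero hT 0) e0
  obtain ⟨d, hd⟩ := exists_gauge hp hq n n' (root_ne_zero hT 1) e1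
  refine repEquiv_of_gen (TensorProduct.congr (diagEquiv n d) (diagEquiv n' d')) fun g => ?_
  refine DFunLike.congr_fun (f := (TensorProduct.congr (diagEquiv n d) (diagEquiv n' d')).toLinearMap
    ∘ₗ T (φ (so4 _ g))) (g := so4Rep p hp hq φ n n' (so4 _ g) ∘ₗ
    (TensorProduct.congr (diagEquiv n d) (diagEquiv n' d')).toLinearMap)
    ((spinBasis n n').ext fun i => ?_)
  have hw : IsWeight p n (2 * i.1 - n) (diagEquiv n d (Pi.single i.1 1)) := by
    rw [diagEquiv_single]; exact (isWeight_single i.1).smul _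
  have hw' : IsWeight p n' (2 * i.2 - n') (diagEquiv n' d' (Pi.single i.2 1)) := by
    rw [diagEquiv_single]; exact (isWeight_single i.2).smul _
  rw [spinBasis_apply, LinearMap.comp_apply, LinearMap.comp_apply, LinearEquiv.coe_coe,
    TensorProduct.congr_tmul, so4Rep, AlgHom.comp_apply]
  cases g with
  | I21 =>
    rw [I21_apply hφ hT (isWeight_single i.1) (isWeight_single i.2), I21_apply hφ hT' hw hw',
      map_smul, TensorProduct.congr_tmul]
  | I43 =>
    rw [I43_apply hφ hT (isWeight_single i.1) (isWeight_single i.2), I43_apply hφ hT' hw hw',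
      map_smul, TensorProduct.congr_tmul]
  | I32 =>
    rw [I32_apply hq hφ hT (isWeight_single i.1) (isWeight_single i.2),
      I32_apply hq hφ hT' hw hw']
    simp only [map_smul, map_add, map_sub, map_neg, TensorProduct.congr_tmul]
    have f1 := (hd' i.2).1
    have f2 := (hd' i.2).2
    have f3 := (hd i.1).1
    have f4 := (hd i.1).2
    simp only [← TensorProduct.tmul_smul (_ : ℂ) (diagEquiv n d (Pi.single i.1 1)), f1, f2]
    simp only [TensorProduct.smul_tmul', f3, f4]
    rfl

end Gauge

/-! ### Highest weight vectors of U_q(sl₂) -/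

section HighestWeight

variable {p : ℂ} {V : Type*} [AddCommGroup V]
  [Module ℂ V] {ρ : UqSl2 (p ^ 2) →ₐ[ℂ] Module.End ℂ V} {N : ℕ} {v : V}

/-- The vector `f^t v`. -/
def lowered (ρ : UqSl2 (p ^ 2) →ₐ[ℂ] Module.End ℂ V) (v : V) (t : ℕ) : V :=
  (ρ (sl2 _ .f) ^ t) v

theorem lowered_succ (t : ℕ) : lowered ρ v (t + 1) = ρ (sl2 _ .f) (lowered ρ v t) := by
  rw [lowered, pow_succ', Module.End.mul_apply, lowered]

theorem k_lowered (hp : p ≠ 0) (hk : ρ (sl2 _ .k) v = p ^ (N : ℤ) • v) (t : ℕ) :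
    ρ (sl2 _ .k) (lowered ρ v t) = p ^ ((N : ℤ) - 2 * t) • lowered ρ v t := by
  induction t with
  | zero => simpa [lowered] using hk
  | succ t ih =>
    have h := DFunLike.congr_fun (congrArg ρ (sl2_k_f (p ^ 2))) (lowered ρ v t)
    rw [map_mul, map_smul, map_mul, Module.End.mul_apply, LinearMap.smul_apply,
      Module.End.mul_apply, ih, map_smul, ← lowered_succ, smul_smul] at h
    rw [h]
    congr 1
    rw [show (N : ℤ) - 2 * ((t + 1 : ℕ) : ℤ) = (N : ℤ) - 2 * t - 2 by push_cast; ring,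
      zpow_sub₀ hp _ 2, mul_comm, div_eq_mul_inv]
    norm_cast

theorem kinv_lowered (hp : p ≠ 0) (hk : ρ (sl2 _ .k) v = p ^ (N : ℤ) • v) (t : ℕ) :
    ρ (sl2 _ .kinv) (lowered ρ v t) = p ^ (-((N : ℤ) - 2 * t)) • lowered ρ v t := by
  have h := DFunLike.congr_fun (congrArg ρ (sl2_kinv_k (p ^ 2))) (lowered ρ v t)
  rw [map_mul, map_one, Module.End.mul_apply, k_lowered hp hk, map_smul] at h
  rw [zpow_neg, eq_inv_smul_iff₀ (zpow_ne_zero _ hp), h, Module.End.one_apply]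

/-- Commuting e past one f at a time adds [N-t][t+1] - [t][N-t+1] at step t, by `qnum_identity`, so
the sum telescopes. -/
theorem e_lowered (hp : p ≠ 0) (he : ρ (sl2 _ .e) v = 0) (hk : ρ (sl2 _ .k) v = p ^ (N : ℤ) • v) (t : ℕ) :
    ρ (sl2 _ .e) (lowered ρ v (t + 1)) =
      (qnum (p ^ 2) ((N : ℤ) - t) * qnum (p ^ 2) (t + 1)) • lowered ρ v t := by
  have step : ∀ t, ρ (sl2 _ .e) (lowered ρ v (t + 1)) =
      ρ (sl2 _ .f) (ρ (sl2 _ .e) (lowered ρ v t)) + (qnum (p ^ 2) ((N : ℤ) - t) *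
        qnum (p ^ 2) (t + 1) - qnum (p ^ 2) t * qnum (p ^ 2) ((N : ℤ) - t + 1)) •
          lowered ρ v t := by
    intro t
    have h := DFunLike.congr_fun (congrArg ρ (sl2_e_f (p ^ 2))) (lowered ρ v t)
    simp only [map_sub, map_mul, map_smul, pow_two (sl2 _ _), LinearMap.sub_apply,
      Module.End.mul_apply, LinearMap.smul_apply, k_lowered hp hk, kinv_lowered hp hk,
      smul_smul, ← sub_smul, ← lowered_succ] at h
    rw [sub_eq_iff_eq_add'] at h
    rw [h, ← neg_sub (qnum _ _ * _), qnum_identity hp]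
    congr 2
    rw [show -(2 * (t : ℤ) - N) = (N : ℤ) - 2 * t by ring,
      show 2 * (t : ℤ) - N = -((N : ℤ) - 2 * t) by ring]
    ring
  induction t with
  | zero =>
    rw [step, lowered, pow_zero, Module.End.one_apply, he, map_zero, zero_add]
    congr 1
    simp [qnum]
  | succ t ih =>
    rw [step, ih, map_smul, ← lowered_succ, ← add_smul]
    congr 1
    push_cast
    rw [show (N : ℤ) - (t + 1) + 1 = N - t by ring]
    ring

/-- If f^{s+1} v is the first power to vanish, applying e gives [N-s][s+1] = 0, and q-numbers of
nonzero integers do not vanish; so s = N. -/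
theorem lowered_ne_zero (hp : p ≠ 0) (hq : NotRootOfUnity (p ^ 2)) [FiniteDimensional ℂ V] (hv : v ≠ 0) (he : ρ (sl2 _ .e) v = 0)
    (hk : ρ (sl2 _ .k) v = p ^ (N : ℤ) • v) :
    lowered ρ v (N + 1) = 0 ∧ ∀ t ≤ N, lowered ρ v t ≠ 0 := by
  -- Otherwise the f^t v would be infinitely many eigenvectors of q^H with distinct eigenvalues in a
  -- finite-dimensional space.
  have hex : ∃ t, lowered ρ v t = 0 := by
    by_contra! h
    have := Module.End.eigenvectors_linearIndependent' (ρ (sl2 _ .k))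
      (fun t : ℕ => p ^ ((N : ℤ) - 2 * t))
      (fun s t hst => by have := zpow_injective hp hq hst; omega) (lowered ρ v)
      (fun t => ⟨Module.End.mem_eigenspace_iff.mpr (k_lowered hp hk t), h t⟩)
    exact not_finite_iff_infinite.mpr inferInstance this.finite
  classical
  obtain ⟨s, hs⟩ : ∃ s, Nat.find hex = s + 1 := by
    refine Nat.exists_eq_succ_of_ne_zero fun h0 => hv ?_
    have := Nat.find_spec hex
    rwa [h0, lowered, pow_zero, Module.End.one_apply] at this
  have h1 : lowered ρ v (s + 1) = 0 := hs ▸ Nat.find_spec hex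
  have h2 : ∀ t ≤ s, lowered ρ v t ≠ 0 := fun t ht => Nat.find_min hex (by omega)
  have h3 := e_lowered hp he hk s
  rw [h1, map_zero, eq_comm, smul_eq_zero, or_iff_left (h2 s le_rfl), mul_eq_zero,
    or_iff_left (qnum_ne_zero hp hq (by omega))] at h3
  have : s = N := by
    by_contra hne
    exact qnum_ne_zero hp hq (by omega) h3
  exact this ▸ ⟨h1, h2⟩

/-- The map from `T_l` to a representation determined by a highest weight vector. -/
def hwMap (ρ : UqSl2 (p ^ 2) →ₐ[ℂ] Module.End ℂ V) (v : V) (N : ℕ) : SpinSpace N →ₗ[ℂ] V :=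
  (Pi.basisFun ℂ (Fin (N + 1))).constr ℂ fun i =>
    (∏ k ∈ Finset.range i, qnum (p ^ 2) (k + 1)) • lowered ρ v (N - i)

theorem hwMap_single (i : Fin (N + 1)) : hwMap ρ v N (Pi.single i 1) =
    (∏ k ∈ Finset.range i, qnum (p ^ 2) (k + 1)) • lowered ρ v (N - i) := by
  have := (Pi.basisFun ℂ (Fin (N + 1))).constr_basis ℂ (fun i : Fin (N + 1) =>
    (∏ k ∈ Finset.range i, qnum (p ^ 2) (k + 1)) • lowered ρ v (N - i)) i
  simpa only [hwMap, Pi.basisFun_apply] using this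

theorem hwMap_single_ne_zero (hp : p ≠ 0) (hq : NotRootOfUnity (p ^ 2)) [FiniteDimensional ℂ V] (hv : v ≠ 0) (he : ρ (sl2 _ .e) v = 0)
    (hk : ρ (sl2 _ .k) v = p ^ (N : ℤ) • v) (i : Fin (N + 1)) :
    hwMap ρ v N (Pi.single i 1) ≠ 0 := by
  rw [hwMap_single]
  exact smul_ne_zero (Finset.prod_ne_zero_iff.mpr fun k _ => qnum_ne_zero hp hq (by omega))
    ((lowered_ne_zero hp hq hv he hk).2 _ (by omega))

/-- The q-factorial [i]! in `hwMap` absorbs the factor in f|i⟩ = [i]|i-1⟩, and the relation for e is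
then `e_lowered`. At the two ends one needs e v = 0 and f^{N+1} v = 0. -/
theorem hwMap_intertwines (hp : p ≠ 0) (hq : NotRootOfUnity (p ^ 2)) [FiniteDimensional ℂ V] (hv : v ≠ 0) (he : ρ (sl2 _ .e) v = 0)
    (hk : ρ (sl2 _ .k) v = p ^ (N : ℤ) • v) (u : UqSl2 (p ^ 2)) (w : SpinSpace N) :
    hwMap ρ v N (spinRep p hp N u w) = ρ u (hwMap ρ v N w) := by
  induction u using sl2_induction generalizing w with
  | hc c => simp [Module.algebraMap_end_apply]
  | hm a b h1 h2 => rw [map_mul, map_mul, Module.End.mul_apply, Module.End.mul_apply, h1, h2]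
  | ha a b h1 h2 => rw [map_add, map_add, LinearMap.add_apply, LinearMap.add_apply, map_add,
      h1, h2]
  | hg g =>
    rw [spinRep_gen]
    refine DFunLike.congr_fun (f := hwMap ρ v N ∘ₗ spinGen p N g)
      (g := ρ (sl2 _ g) ∘ₗ hwMap ρ v N) (spin_ext fun i => ?_) w
    rw [LinearMap.comp_apply, LinearMap.comp_apply, hwMap_single, map_smul]
    obtain ⟨i, hi⟩ := i
    cases g with
    | k =>
      rw [spinGen_k, map_smul, hwMap_single, k_lowered hp hk, smul_comm]
      congr 3
      push_cast [Nat.cast_sub (Nat.lt_succ_iff.mp hi)]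
      ring
    | kinv =>
      rw [spinGen_kinv, map_smul, hwMap_single, kinv_lowered hp hk, smul_comm]
      congr 3
      push_cast [Nat.cast_sub (Nat.lt_succ_iff.mp hi)]
      ring
    | e =>
      rw [spinGen_e]
      split_ifs with h
      · dsimp only at h
        obtain ⟨t, ht⟩ : ∃ t, N - i = t + 1 := ⟨N - i - 1, by omega⟩
        rw [map_smul, hwMap_single]
        dsimp only
        rw [ht, e_lowered hp he hk, Finset.prod_range_succ, smul_smul, smul_smul,
          show N - (i + 1) = t by omega, show (N : ℤ) - t = i + 1 by omega,
          show (N : ℤ) - i = t + 1 by omega]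
        congr 1
        ring
      · dsimp only at h ⊢
        obtain rfl : i = N := by omega
        rw [Nat.sub_self, lowered, pow_zero, Module.End.one_apply, he, smul_zero, map_zero]
    | f =>
      rw [spinGen_f]
      split_ifs with h
      · dsimp only at h
        obtain ⟨k, rfl⟩ : ∃ k, i = k + 1 := ⟨i - 1, by omega⟩
        rw [map_smul, hwMap_single]
        dsimp only
        rw [← lowered_succ, Finset.prod_range_succ, smul_smul, Nat.add_sub_cancel,
          show N - (k + 1) + 1 = N - k by omega, mul_comm]
        push_cast
        rfl
      · dsimp only at h ⊢
        obtain rfl : i = 0 := by omega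
        rw [← lowered_succ, Nat.sub_zero, (lowered_ne_zero hp hq hv he hk).1, smul_zero,
          map_zero]

end HighestWeight

/-! ### Clebsch–Gordan decomposition -/

section ClebschGordan

/-- The basis vectors of `T_l`, extended by zero. -/
def ket (n i : ℕ) : SpinSpace n := if h : i < n + 1 then Pi.single ⟨i, h⟩ 1 else 0

theorem ket_of_lt {n i : ℕ} (h : n < i) : ket n i = 0 := dif_neg (by omega)

theorem ket_of_le {n i : ℕ} (h : i ≤ n) : ket n i = Pi.single ⟨i, by omega⟩ 1 :=
  dif_pos (by omega)

variable {p : ℂ}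

theorem k_ket (n i : ℕ) : spinGen p n .k (ket n i) = p ^ (2 * (i : ℤ) - n) • ket n i := by
  rcases le_or_gt i n with h | h
  · rw [ket_of_le h, spinGen_k]
  · rw [ket_of_lt h, map_zero, smul_zero]

theorem kinv_ket (n i : ℕ) :
    spinGen p n .kinv (ket n i) = p ^ (-(2 * (i : ℤ) - n)) • ket n i := by
  rcases le_or_gt i n with h | h
  · rw [ket_of_le h, spinGen_kinv]
  · rw [ket_of_lt h, map_zero, smul_zero]

theorem e_ket (n i : ℕ) :
    spinGen p n .e (ket n i) = qnum (p ^ 2) ((n : ℤ) - i) • ket n (i + 1) := by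
  rcases lt_trichotomy i n with h | rfl | h
  · rw [ket_of_le h.le, ket_of_le h, spinGen_e, dif_pos h]
  · rw [ket_of_le le_rfl, spinGen_e, dif_neg (by simp), ket_of_lt (Nat.lt_succ_self i), smul_zero]
  · rw [ket_of_lt h, ket_of_lt (by omega), map_zero, smul_zero]

/-- The tensor product `T_j ⊗ T_s` formed by means of the comultiplication. -/
def coupledRep (p : ℂ) (hp : p ≠ 0) (a b : ℕ) :
    UqSl2 (p ^ 2) →ₐ[ℂ] Module.End ℂ (SpinSpace a ⊗[ℂ] SpinSpace b) :=
  (repTensor (spinRep p hp a) (spinRep p hp b)).comp (comul (p ^ 2) (pow_ne_zero 2 hp))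

theorem coupledRep_k (hp : p ≠ 0) (a b : ℕ) (u : SpinSpace a) (w : SpinSpace b) :
    coupledRep p hp a b (sl2 _ .k) (u ⊗ₜ w) = spinGen p a .k u ⊗ₜ spinGen p b .k w := by
  simp [coupledRep, comul_gen, comulGen, repTensor_tmul, spinRep_gen]

theorem coupledRep_e (hp : p ≠ 0) (a b : ℕ) (u : SpinSpace a) (w : SpinSpace b) :
    coupledRep p hp a b (sl2 _ .e) (u ⊗ₜ w) =
      spinGen p a .e u ⊗ₜ spinGen p b .k w + spinGen p a .kinv u ⊗ₜ spinGen p b .e w := by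
  simp [coupledRep, comul_gen, comulGen, repTensor_tmul, spinRep_gen]

/-- Solve forward from c 0 = 1 and restart with the value 1 wherever P fails; no entry up to a can
then vanish. -/
theorem exists_recursion {x y : ℕ → ℂ} {a : ℕ} {P : ℕ → Prop} (hx : ∀ j < a, x j ≠ 0)
    (hy : ∀ j, P j → y j ≠ 0) : ∃ c : ℕ → ℂ, (∀ j ≤ a, c j ≠ 0) ∧
      ∀ j, P j → c j * x j + c (j + 1) * y j = 0 := by
  classical
  let c : ℕ → ℂ := fun j => Nat.rec 1 (fun j r => if P j then -(r * x j) / y j else 1) j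
  have hc : ∀ j, c (j + 1) = if P j then -(c j * x j) / y j else 1 := fun j => rfl
  refine ⟨c, fun j => ?_, fun j hj => ?_⟩
  · induction j with
    | zero => exact fun _ => one_ne_zero
    | succ j ih =>
      intro hj
      rw [hc]
      split_ifs with h
      · exact div_ne_zero (neg_ne_zero.mpr (mul_ne_zero (ih (by omega)) (hx j (by omega)))) (hy j h)
      · exact one_ne_zero
  · rw [hc, if_pos hj, div_mul_cancel₀ _ (hy j hj), add_neg_cancel]

/-- Make the ansatz Σ c_j |j⟩ ⊗ |s-j⟩ with total index s. Vanishing of e on it is a two-term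
recursion for the c_j, whose coefficients are nonzero where both kets occur. -/
theorem exists_highestWeight (hp : p ≠ 0) (hq : NotRootOfUnity (p ^ 2)) {a b s : ℕ} (ha : a ≤ s)
    (hb : b ≤ s) (hs : s ≤ a + b) : ∃ v, v ≠ 0 ∧ coupledRep p hp a b (sl2 _ .e) v = 0 ∧
      coupledRep p hp a b (sl2 _ .k) v = p ^ (((2 * s - a - b : ℕ)) : ℤ) • v := by
  obtain ⟨c, hc0, hc⟩ := exists_recursion (a := a) (P := fun j => s ≤ b + j ∧ j < a)
    (x := fun j => qnum (p ^ 2) ((a : ℤ) - j) * p ^ (2 * ((s : ℤ) - j) - b))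
    (y := fun j => p ^ (-(2 * ((j : ℤ) + 1) - a)) * qnum (p ^ 2) ((b : ℤ) - (s - j - 1)))
    (fun j hj => mul_ne_zero (qnum_ne_zero hp hq (by omega)) (zpow_ne_zero _ hp))
    (fun j hj => mul_ne_zero (zpow_ne_zero _ hp) (qnum_ne_zero hp hq (by omega)))
  refine ⟨∑ j ∈ Finset.range (a + 1), c j • (ket a j ⊗ₜ ket b (s - j)), ?_, ?_, ?_⟩
  · intro h0
    -- The term j = a lies inside the range because s - a ≤ b, and its coefficient is c a ≠ 0.
    have h1 := congrArg (fun v => (spinBasis a b).repr v (⟨a, by omega⟩, ⟨s - a, by omega⟩)) h0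
    simp only [map_sum, map_smul, Finsupp.coe_finsetSum, Finset.sum_apply, Finsupp.smul_apply,
      spinBasis_repr_tmul, map_zero, Finsupp.zero_apply, smul_eq_mul] at h1
    rw [Finset.sum_eq_single a] at h1
    · rw [ket_of_le le_rfl, ket_of_le (show s - a ≤ b by omega), Pi.single_eq_same,
        Pi.single_eq_same, mul_one, mul_one] at h1
      exact hc0 a le_rfl h1
    · intro j hj hja
      rw [ket_of_le (by rw [Finset.mem_range] at hj; omega), Pi.single_eq_of_ne, zero_mul, mul_zero]
      intro h
      exact hja (congrArg Fin.val h).symm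
    · intro h
      exact absurd (Finset.self_mem_range_succ a) h
  · have e1 : ∀ j ∈ Finset.range (a + 1),
        coupledRep p hp a b (sl2 _ .e) (c j • (ket a j ⊗ₜ ket b (s - j))) =
        (c j * (qnum (p ^ 2) ((a : ℤ) - j) * p ^ (2 * ((s : ℤ) - j) - b))) •
            (ket a (j + 1) ⊗ₜ[ℂ] ket b (s - j)) +
          (c j * (p ^ (-(2 * (j : ℤ) - a)) * qnum (p ^ 2) ((b : ℤ) - (s - j)))) •
            (ket a j ⊗ₜ[ℂ] ket b (s - j + 1)) := by
      intro j hj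
      rw [Finset.mem_range] at hj
      rw [map_smul, coupledRep_e, e_ket, k_ket, kinv_ket, e_ket, smul_add]
      simp only [← TensorProduct.smul_tmul', TensorProduct.tmul_smul, smul_smul]
      push_cast [Nat.cast_sub (show j ≤ s by omega)]
      congr 2 <;> ring
    -- The top term of the first sum contains |a+1⟩ and the bottom term of the second |s+1⟩ with s ≥
    -- b; both are zero. After an index shift the remaining terms pair off.
    rw [map_sum, Finset.sum_congr rfl e1, Finset.sum_add_distrib, Finset.sum_range_succ,
      Finset.sum_range_succ' (fun j => _ • (ket a j ⊗ₜ[ℂ] ket b (s - j + 1))),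
      ket_of_lt (Nat.lt_succ_self a), Nat.sub_zero, ket_of_lt (Nat.lt_succ_of_le hb),
      TensorProduct.zero_tmul, TensorProduct.tmul_zero, smul_zero, smul_zero, add_zero, add_zero,
      ← Finset.sum_add_distrib]
    refine Finset.sum_eq_zero fun j hj => ?_
    rw [Finset.mem_range] at hj
    rw [show s - (j + 1) + 1 = s - j by omega, ← add_smul]
    -- Where the recursion is not imposed, the second ket is already zero.
    rcases le_or_gt s (b + j) with h | h
    · have := hc j ⟨h, hj⟩
      push_cast
      rw [show (s : ℤ) - (j + 1) = s - j - 1 by ring, this, zero_smul]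
    · rw [ket_of_lt (show b < s - j by omega), TensorProduct.tmul_zero, smul_zero]
  · rw [map_sum, Finset.smul_sum]
    refine Finset.sum_congr rfl fun j hj => ?_
    rw [Finset.mem_range] at hj
    rw [map_smul, coupledRep_k, k_ket, k_ket, ← TensorProduct.smul_tmul', TensorProduct.tmul_smul,
      smul_smul, smul_smul, smul_smul, mul_assoc, ← zpow_add₀ hp, mul_comm]
    congr 3
    omega

/-- This is the dimension count of Clebsch–Gordan: the summands are K = |a-b| + 2t with 0 ≤ t ≤
min(a, b). -/
theorem sum_spinRange (a b : ℕ) : ∑ K ∈ spinRange a b, (K + 1) = (a + 1) * (b + 1) := by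
  have h1 : spinRange a b = (Finset.range (min a b + 1)).image
      fun t => max a b - min a b + 2 * t := by
    ext K
    simp only [spinRange, Finset.mem_filter, Finset.mem_Icc, Finset.mem_image, Finset.mem_range]
    constructor
    · rintro ⟨⟨h1, h2⟩, h3⟩
      exact ⟨(K - (max a b - min a b)) / 2, by omega, by omega⟩
    · rintro ⟨t, ht, rfl⟩
      omega
  have h2 : ∀ d m : ℕ, ∑ t ∈ Finset.range (m + 1), (d + 2 * t + 1) = (d + m + 1) * (m + 1) := by
    intro d m
    induction m with
    | zero => simp
    | succ m ih => rw [Finset.sum_range_succ, ih]; ring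
  rw [h1, Finset.sum_image (fun s _ t _ h => by simpa using h), h2]
  rcases le_total a b with h | h
  · rw [max_eq_right h, min_eq_left h, Nat.sub_add_cancel h, mul_comm]
  · rw [max_eq_left h, min_eq_right h, Nat.sub_add_cancel h]

/-- The Clebsch–Gordan decomposition for `U_q(sl₂)`. -/
theorem coupledRep_equiv (hp : p ≠ 0) (hq : NotRootOfUnity (p ^ 2)) (a b : ℕ) :
    RepEquiv (repSum fun κ : spinRange a b => spinRep p hp κ) (coupledRep p hp a b) := by
  have hex : ∀ κ : spinRange a b, ∃ v, v ≠ 0 ∧ coupledRep p hp a b (sl2 _ .e) v = 0 ∧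
      coupledRep p hp a b (sl2 _ .k) v = p ^ ((κ : ℕ) : ℤ) • v := by
    rintro ⟨K, hK⟩
    simp only [spinRange, Finset.mem_filter, Finset.mem_Icc] at hK
    -- The total index with highest weight K is (a+b+K)/2, an integer by the parity condition in
    -- `spinRange`.
    have := exists_highestWeight hp hq (a := a) (b := b) (s := (a + b + K) / 2) (by omega)
      (by omega) (by omega)
    rwa [show 2 * ((a + b + K) / 2) - a - b = K by omega] at this
  choose v hv he hk using hex
  let Φ : (∀ κ : spinRange a b, SpinSpace κ) →ₗ[ℂ] SpinSpace a ⊗[ℂ] SpinSpace b :=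
    ∑ κ : spinRange a b, hwMap (coupledRep p hp a b) (v κ) κ ∘ₗ LinearMap.proj κ
  have hΦ : ∀ u z, Φ (repSum (fun κ : spinRange a b => spinRep p hp κ) u z) =
      coupledRep p hp a b u (Φ z) := by
    intro u z
    simp only [Φ, LinearMap.sum_apply, LinearMap.comp_apply, map_sum]
    exact Finset.sum_congr rfl fun κ _ => hwMap_intertwines hp hq (hv κ) (he κ) (hk κ) u _
  have hΦs : ∀ κ w, Φ (Pi.single κ w) = hwMap (coupledRep p hp a b) (v κ) κ w := by
    intro κ w
    simp only [Φ, LinearMap.sum_apply, LinearMap.comp_apply, LinearMap.proj_apply]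
    rw [Finset.sum_eq_single κ]
    · rw [Pi.single_eq_same]
    · intro l _ hl
      rw [Pi.single_eq_of_ne hl, map_zero]
    · simp
  let B := Pi.basis fun κ : spinRange a b => Pi.basisFun ℂ (Fin ((κ : ℕ) + 1))
  have hB : ∀ x, B x = Pi.single x.1 (Pi.single x.2 1) := fun x => by
    rw [Pi.basis_apply, Pi.basisFun_apply]
  let R := repSum fun κ : spinRange a b => spinRep p hp κ
  have hR : ∀ u κ w, R u (Pi.single κ w) = Pi.single κ (spinRep p hp κ u w) := by
    intro u κ w
    ext l
    rcases eq_or_ne l κ with rfl | h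
    · simp [R, repSum]
    · simp [R, repSum, Pi.single_eq_of_ne h]
  -- The Casimir element tells the summands apart and q^H the vectors within a summand.
  let A : Bool → Module.End ℂ (∀ κ : spinRange a b, SpinSpace κ) := fun c =>
    R (if c then casimir _ else sl2 _ .k)
  let μ : Bool → (Σ κ : spinRange a b, Fin ((κ : ℕ) + 1)) → ℂ := fun c x =>
    if c then ((p ^ 2) ^ ((x.1 : ℤ) + 1) + (p ^ 2) ^ (-((x.1 : ℤ) + 1))) /
      (p ^ 2 - (p ^ 2)⁻¹) ^ 2 else p ^ (2 * (x.2 : ℤ) - (x.1 : ℕ))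
  have hA : ∀ c x, A c (B x) = μ c x • B x := by
    intro c x
    rw [hB, ← Pi.single_smul]
    cases c
    · exact (hR _ _ _).trans (congrArg _ (by
        rw [if_neg (by decide), spinRep_gen]; exact spinGen_k ..))
    · exact (hR _ _ _).trans (congrArg _ (by simp [spinRep_casimir hp hq, μ]))
  have hμ : ∀ x y, x ≠ y → ∃ c, μ c x ≠ μ c y := by
    intro x y hxy
    by_contra! h
    apply hxy
    obtain ⟨κ, i⟩ := x
    obtain ⟨l, j⟩ := y
    have h1 := h true
    have h2 := zpow_injective hp hq (h false)
    simp only [μ, if_true, sq_zpow] at h1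
    rw [div_left_inj' (pow_ne_zero 2 (hq.sub_inv_ne_zero (pow_ne_zero 2 hp))), mul_neg,
      mul_neg] at h1
    have h3 := zpow_add_zpow_neg_injective hp hq (by omega) (by omega) h1
    obtain rfl : κ = l := Subtype.ext (by omega)
    dsimp only at h2
    congr
    omega
  -- The kernel is invariant under both operators, so a nonzero kernel would contain a basis vector,
  -- but `hwMap` kills none.
  have hker : LinearMap.ker Φ = ⊥ := by
    by_contra h
    obtain ⟨x, hx⟩ := exists_basis_mem B hA hμ (LinearMap.ker Φ) (fun c z hz => by
      rw [LinearMap.mem_ker] at hz ⊢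
      rw [hΦ, hz, map_zero]) h
    rw [hB, LinearMap.mem_ker, hΦs] at hx
    exact hwMap_single_ne_zero hp hq (hv _) (he _) (hk _) _ hx
  have hdim : Module.finrank ℂ (∀ κ : spinRange a b, SpinSpace κ) =
      Module.finrank ℂ (SpinSpace a ⊗[ℂ] SpinSpace b) := by
    rw [Module.finrank_pi_fintype, Module.finrank_tensorProduct]
    simp only [Module.finrank_fin_fun]
    rw [← sum_spinRange]
    exact Finset.sum_coe_sort (spinRange a b) (fun K => K + 1)
  exact ⟨LinearEquiv.ofBijective Φ ⟨LinearMap.ker_eq_bot.mp hker,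
    (LinearMap.injective_iff_surjective_of_finrank_eq_finrank hdim).mp
      (LinearMap.ker_eq_bot.mp hker)⟩, hΦ⟩

end ClebschGordan

/-! ### Equivalence of representations, sums and outer products -/

section Equivalence

variable {A : Type*} [Semiring A] [Algebra ℂ A]

theorem RepEquiv.symm {V W : Type*} [AddCommMonoid V] [Module ℂ V] [AddCommMonoid W] [Module ℂ W]
    {ρ : A →ₐ[ℂ] Module.End ℂ V} {σ : A →ₐ[ℂ] Module.End ℂ W} (h : RepEquiv ρ σ) :
    RepEquiv σ ρ := by
  obtain ⟨Ψ, hΨ⟩ := h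
  exact ⟨Ψ.symm, fun a v => by rw [Ψ.symm_apply_eq, hΨ, Ψ.apply_symm_apply]⟩

theorem RepEquiv.trans {V W U : Type*} [AddCommMonoid V] [Module ℂ V] [AddCommMonoid W]
    [Module ℂ W] [AddCommMonoid U] [Module ℂ U] {ρ : A →ₐ[ℂ] Module.End ℂ V}
    {σ : A →ₐ[ℂ] Module.End ℂ W} {τ : A →ₐ[ℂ] Module.End ℂ U} (h : RepEquiv ρ σ)
    (h' : RepEquiv σ τ) : RepEquiv ρ τ := by
  obtain ⟨Ψ, hΨ⟩ := h
  obtain ⟨Φ, hΦ⟩ := h'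
  exact ⟨Ψ.trans Φ, fun a v => by simp [hΨ, hΦ]⟩

theorem repSum_equiv {ι : Type*} {V W : ι → Type*} [∀ i, AddCommMonoid (V i)]
    [∀ i, Module ℂ (V i)] [∀ i, AddCommMonoid (W i)] [∀ i, Module ℂ (W i)]
    {ρ : ∀ i, A →ₐ[ℂ] Module.End ℂ (V i)} {σ : ∀ i, A →ₐ[ℂ] Module.End ℂ (W i)}
    (h : ∀ i, RepEquiv (ρ i) (σ i)) : RepEquiv (repSum ρ) (repSum σ) := by
  choose Ψ hΨ using h
  exact ⟨LinearEquiv.piCongrRight Ψ, fun a v => funext fun i => hΨ i a (v i)⟩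

variable {B : Type*} [Semiring B] [Algebra ℂ B]

theorem repTensor_equiv {V W V' W' : Type*} [AddCommMonoid V] [Module ℂ V] [AddCommMonoid W]
    [Module ℂ W] [AddCommMonoid V'] [Module ℂ V'] [AddCommMonoid W'] [Module ℂ W']
    {ρ : A →ₐ[ℂ] Module.End ℂ V} {σ : B →ₐ[ℂ] Module.End ℂ W}
    {ρ' : A →ₐ[ℂ] Module.End ℂ V'} {σ' : B →ₐ[ℂ] Module.End ℂ W'} (h : RepEquiv ρ ρ')
    (h' : RepEquiv σ σ') : RepEquiv (repTensor ρ σ) (repTensor ρ' σ') := by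
  obtain ⟨Ψ, hΨ⟩ := h
  obtain ⟨Φ, hΦ⟩ := h'
  refine ⟨TensorProduct.congr Ψ Φ, fun a v => ?_⟩
  induction a with
  | zero => simp
  | add a b h1 h2 => rw [map_add, map_add, LinearMap.add_apply, map_add, h1, h2,
      LinearMap.add_apply]
  | tmul a b =>
    rw [repTensor_tmul, repTensor_tmul]
    induction v with
    | zero => simp
    | add v w h1 h2 => rw [map_add, map_add, map_add, map_add, h1, h2]
    | tmul v w => simp [hΨ, hΦ]

/-- The tensor product of two finite products of spaces. -/
def piTensorPi {ι κ : Type*} [Fintype ι] [Fintype κ] [DecidableEq ι] [DecidableEq κ]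
    (V : ι → Type*) (W : κ → Type*) [∀ i, AddCommMonoid (V i)] [∀ i, Module ℂ (V i)]
    [∀ i, AddCommMonoid (W i)] [∀ i, Module ℂ (W i)] :
    (∀ i, V i) ⊗[ℂ] (∀ k, W k) ≃ₗ[ℂ] ∀ x : ι × κ, V x.1 ⊗[ℂ] W x.2 :=
  LinearEquiv.ofLinearMap
    (LinearMap.pi fun x : ι × κ => TensorProduct.map (LinearMap.proj x.1) (LinearMap.proj x.2))
    (∑ x : ι × κ, TensorProduct.map (LinearMap.single ℂ V x.1) (LinearMap.single ℂ W x.2) ∘ₗ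
      LinearMap.proj x)
    (by
      refine LinearMap.pi_ext' fun x => TensorProduct.ext' fun v w => ?_
      funext y
      simp only [LinearMap.comp_apply, LinearMap.sum_apply, LinearMap.proj_apply,
        LinearMap.pi_apply, LinearMap.coe_single, LinearMap.id_apply]
      rw [Finset.sum_eq_single x]
      · rw [Pi.single_eq_same, TensorProduct.map_tmul, TensorProduct.map_tmul]
        rcases eq_or_ne y x with rfl | h
        · simp
        · rw [Pi.single_eq_of_ne h]
          have : y.1 ≠ x.1 ∨ y.2 ≠ x.2 := by
            by_contra! h'
            exact h (Prod.ext h'.1 h'.2)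
          rcases this with h' | h'
          · simp [Pi.single_eq_of_ne h']
          · simp [Pi.single_eq_of_ne h']
      · intro z _ hz
        rw [Pi.single_eq_of_ne hz, map_zero]
      · simp)
    (by
      refine TensorProduct.ext' fun v w => ?_
      simp only [LinearMap.comp_apply, LinearMap.sum_apply, LinearMap.proj_apply,
        LinearMap.pi_apply, LinearMap.id_apply, TensorProduct.map_tmul, LinearMap.coe_single]
      rw [Fintype.sum_prod_type]
      simp only [← TensorProduct.tmul_sum, ← TensorProduct.sum_tmul, Finset.univ_sum_single])

theorem piTensorPi_apply {ι κ : Type*} [Fintype ι] [Fintype κ] [DecidableEq ι] [DecidableEq κ]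
    (V : ι → Type*) (W : κ → Type*) [∀ i, AddCommMonoid (V i)] [∀ i, Module ℂ (V i)]
    [∀ i, AddCommMonoid (W i)] [∀ i, Module ℂ (W i)] (v : ∀ i, V i) (w : ∀ k, W k)
    (x : ι × κ) : piTensorPi V W (v ⊗ₜ w) x = v x.1 ⊗ₜ w x.2 := rfl

theorem repTensor_repSum {ι κ : Type*} [Fintype ι] [Fintype κ] [DecidableEq ι] [DecidableEq κ]
    {V : ι → Type*} {W : κ → Type*} [∀ i, AddCommMonoid (V i)] [∀ i, Module ℂ (V i)]
    [∀ i, AddCommMonoid (W i)] [∀ i, Module ℂ (W i)] (ρ : ∀ i, A →ₐ[ℂ] Module.End ℂ (V i))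
    (σ : ∀ k, B →ₐ[ℂ] Module.End ℂ (W k)) :
    RepEquiv (repTensor (repSum ρ) (repSum σ))
      (repSum fun x : ι × κ => repTensor (ρ x.1) (σ x.2)) := by
  refine ⟨piTensorPi V W, fun a v => ?_⟩
  induction a with
  | zero => simp
  | add a b h1 h2 => rw [map_add, map_add, LinearMap.add_apply, map_add, h1, h2,
      LinearMap.add_apply]
  | tmul a b =>
    induction v with
    | zero => simp
    | add v w h1 h2 => rw [map_add, map_add, map_add, map_add, h1, h2]
    | tmul v w =>
      rw [repTensor_tmul, TensorProduct.map_tmul]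
      funext x
      rw [piTensorPi_apply]
      change _ = repTensor (ρ x.1) (σ x.2) (a ⊗ₜ b) (v x.1 ⊗ₜ w x.2)
      rw [repTensor_tmul, TensorProduct.map_tmul]
      rfl

end Equivalence

/-! ### Decomposition of the tensor product over U_q(sl₂)^{⊗2} -/

section TensorProductRepresentation

/-- The exchange of the middle tensor factors of the algebra is implemented by the same exchange on
the spaces. It turns the tensor product via `comulTwo` into an outer product of two tensor products
via `comul`. -/
theorem repTensor_tensorTensorTensorComm {A B C D V W V' W' : Type*} [Semiring A] [Algebra ℂ A]
    [Semiring B] [Algebra ℂ B] [Semiring C] [Algebra ℂ C] [Semiring D] [Algebra ℂ D]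
    [AddCommMonoid V] [Module ℂ V] [AddCommMonoid W] [Module ℂ W] [AddCommMonoid V']
    [Module ℂ V'] [AddCommMonoid W'] [Module ℂ W'] (ρ : A →ₐ[ℂ] Module.End ℂ V)
    (σ : B →ₐ[ℂ] Module.End ℂ W) (ρ' : C →ₐ[ℂ] Module.End ℂ V') (σ' : D →ₐ[ℂ] Module.End ℂ W') :
    RepEquiv ((repTensor (repTensor ρ ρ') (repTensor σ σ')).comp
        (Algebra.TensorProduct.tensorTensorTensorComm ℂ ℂ ℂ ℂ A B C D).toAlgHom)
      (repTensor (repTensor ρ σ) (repTensor ρ' σ')) := by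
  refine ⟨TensorProduct.tensorTensorTensorComm ℂ V V' W W', fun u z => ?_⟩
  induction u with
  | zero => rw [map_zero, map_zero, LinearMap.zero_apply, LinearMap.zero_apply, map_zero]
  | add u v h1 h2 => rw [map_add, map_add, LinearMap.add_apply, map_add, h1, h2,
      LinearMap.add_apply]
  | tmul u v =>
    induction u with
    | zero => rw [TensorProduct.zero_tmul, map_zero, map_zero, LinearMap.zero_apply,
        LinearMap.zero_apply, map_zero]
    | add u u' h1 h2 => rw [TensorProduct.add_tmul, map_add, map_add, LinearMap.add_apply,
        map_add, h1, h2, LinearMap.add_apply]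
    | tmul x y =>
      induction v with
      | zero => rw [TensorProduct.tmul_zero, map_zero, map_zero, LinearMap.zero_apply,
          LinearMap.zero_apply, map_zero]
      | add v v' h1 h2 => rw [TensorProduct.tmul_add, map_add, map_add, LinearMap.add_apply,
          map_add, h1, h2, LinearMap.add_apply]
      | tmul x' y' =>
        have h : ((repTensor (repTensor ρ ρ') (repTensor σ σ')).comp
            (Algebra.TensorProduct.tensorTensorTensorComm ℂ ℂ ℂ ℂ A B C D).toAlgHom)
              ((x ⊗ₜ y) ⊗ₜ (x' ⊗ₜ y')) =
            TensorProduct.map (TensorProduct.map (ρ x) (ρ' x'))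
              (TensorProduct.map (σ y) (σ' y')) := by
          rw [← repTensor_tmul, ← repTensor_tmul, ← repTensor_tmul]
          rfl
        rw [h, repTensor_tmul, repTensor_tmul, repTensor_tmul]
        refine DFunLike.congr_fun (f := (TensorProduct.tensorTensorTensorComm ℂ _ _ _ _).toLinearMap
          ∘ₗ TensorProduct.map (TensorProduct.map (ρ x) (ρ' x'))
            (TensorProduct.map (σ y) (σ' y')))
          (g := TensorProduct.map (TensorProduct.map (ρ x) (σ y))
            (TensorProduct.map (ρ' x') (σ' y')) ∘ₗ
            (TensorProduct.tensorTensorTensorComm ℂ _ _ _ _).toLinearMap) ?_ z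
        exact TensorProduct.ext_fourfold' fun v w v' w' => rfl

variable {p : ℂ}

theorem tensorRep_equiv_coupledRep (hp : p ≠ 0) (a a' b b' : ℕ) :
    RepEquiv (tensorRep p hp a a' b b')
      (repTensor (coupledRep p hp a b) (coupledRep p hp a' b')) := by
  obtain ⟨Ψ, hΨ⟩ := repTensor_tensorTensorTensorComm (spinRep p hp a) (spinRep p hp b)
    (spinRep p hp a') (spinRep p hp b')
  have h : repTensor (coupledRep p hp a b) (coupledRep p hp a' b') =
      (repTensor (repTensor (spinRep p hp a) (spinRep p hp b))
        (repTensor (spinRep p hp a') (spinRep p hp b'))).comp (Algebra.TensorProduct.map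
          (comul (p ^ 2) (pow_ne_zero 2 hp)) (comul (p ^ 2) (pow_ne_zero 2 hp))) := by
    refine Algebra.TensorProduct.ext' fun u v => ?_
    rw [AlgHom.comp_apply, Algebra.TensorProduct.map_tmul, repTensor_tmul, repTensor_tmul]
    rfl
  rw [h]
  exact ⟨Ψ, fun u z => hΨ _ z⟩

theorem tensorRep_equiv (hp : p ≠ 0) (hq : NotRootOfUnity (p ^ 2)) (a a' b b' : ℕ) :
    RepEquiv (tensorRep p hp a a' b b')
      (repSum fun κ : spinRange a b × spinRange a' b' => spinRepTwo p hp κ.1 κ.2) :=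
  ((tensorRep_equiv_coupledRep hp a a' b b').trans
    (repTensor_equiv (coupledRep_equiv hp hq a b).symm (coupledRep_equiv hp hq a' b').symm)).trans
    (repTensor_repSum _ _)

end TensorProductRepresentation

/-! ### Solutions and extensions on direct sums and along homomorphisms -/

section Transport

/-- Componentwise operators on a product of spaces. -/
def piEnd {ι : Type*} (V : ι → Type*) [∀ i, AddCommMonoid (V i)] [∀ i, Module ℂ (V i)] :
    (∀ i, Module.End ℂ (V i)) →ₐ[ℂ] Module.End ℂ (∀ i, V i) :=
  repSum fun i => Pi.evalAlgHom ℂ (fun i => Module.End ℂ (V i)) i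

theorem isUnit_repSum {A : Type*} [Semiring A] [Algebra ℂ A] {ι : Type*} {V : ι → Type*}
    [∀ i, AddCommMonoid (V i)] [∀ i, Module ℂ (V i)] {ρ : ∀ i, A →ₐ[ℂ] Module.End ℂ (V i)}
    {a : A} (h : ∀ i, IsUnit (ρ i a)) : IsUnit (repSum ρ a) :=
  (Pi.isUnit_iff.mpr h : IsUnit fun i => ρ i a).map (piEnd V)

theorem repSum_single {A : Type*} [Semiring A] [Algebra ℂ A] {ι : Type*} [DecidableEq ι]
    {V : ι → Type*} [∀ i, AddCommMonoid (V i)] [∀ i, Module ℂ (V i)]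
    (ρ : ∀ i, A →ₐ[ℂ] Module.End ℂ (V i)) (a : A) (i : ι) (v : V i) :
    repSum ρ a (Pi.single i v) = Pi.single i (ρ i a v) := by
  ext l
  rcases eq_or_ne l i with rfl | h
  · simp [repSum]
  · simp [repSum, Pi.single_eq_of_ne h]

variable {q : ℂ}

theorem IsQuarticSolution.map {B C : Type*} [Semiring B] [Algebra ℂ B] [Semiring C] [Algebra ℂ C]
    {ρ : UqSl2Two q →ₐ[ℂ] B} {X : Fin 2 → B} (h : IsQuarticSolution ρ X) (f : B →ₐ[ℂ] C) :
    IsQuarticSolution (f.comp ρ) (fun i => f (X i)) where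
  comm_rep i u := by rw [AlgHom.comp_apply, ← map_mul, h.comm_rep, map_mul]
  comm := by rw [← map_mul, h.comm, map_mul]
  quartic i := by simpa using congrArg f (h.quartic i)

theorem IsExtension.map {B C : Type*} [Semiring B] [Algebra ℂ B] [Semiring C] [Algebra ℂ C]
    {ρ : UqSl2Two q →ₐ[ℂ] B} {X : Fin 2 → B} {T : UqExt q →ₐ[ℂ] B} (h : IsExtension ρ X T)
    (f : B →ₐ[ℂ] C) : IsExtension (f.comp ρ) (fun i => f (X i)) (f.comp T) :=
  ⟨by rw [← h.1]; rfl, fun i => congrArg f (h.2 i)⟩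

variable {ι : Type*} {V : ι → Type*} [∀ i, AddCommMonoid (V i)] [∀ i, Module ℂ (V i)]
  {ρ : ∀ i, UqSl2Two q →ₐ[ℂ] Module.End ℂ (V i)} {X : ∀ i, Fin 2 → Module.End ℂ (V i)}
  {T : ∀ i, UqExt q →ₐ[ℂ] Module.End ℂ (V i)}

/-- The conditions hold componentwise in the product of the endomorphism algebras, and `piEnd`
carries them to the sum of the spaces. -/
theorem isQuarticSolution_repSum (h : ∀ i, IsQuarticSolution (ρ i) (X i)) :
    IsQuarticSolution (repSum ρ) (fun l => piEnd V fun i => X i l) := by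
  have : IsQuarticSolution (AlgHom.pi ρ) (fun l i => X i l) :=
    ⟨fun l u => funext fun i => (h i).comm_rep l u, funext fun i => (h i).comm,
      fun l => funext fun i => (h i).quartic l⟩
  exact this.map (piEnd V)

theorem isExtension_repSum (h : ∀ i, IsExtension (ρ i) (X i) (T i)) :
    IsExtension (repSum ρ) (fun l => piEnd V fun i => X i l) (repSum T) := by
  have : IsExtension (AlgHom.pi ρ) (fun l i => X i l) (AlgHom.pi T) :=
    ⟨AlgHom.ext fun u => funext fun i => (h i).apply u, fun l => funext fun i => (h i).2 l⟩
  exact this.map (piEnd V)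

end Transport

/-! ### Schur's lemma for the roots, and the decomposition -/

section Scalars

variable {p : ℂ} {hp : p ≠ 0}

/-- A solution of the quartic equations for a multiplicity free sum acts by scalars on the
summands. -/
theorem exists_scalars (hq : NotRootOfUnity (p ^ 2)) (a b a' b' : ℕ) {X : Fin 2 → Module.End ℂ
      (∀ κ : spinRange a b × spinRange a' b', SpinSpace κ.1 ⊗[ℂ] SpinSpace κ.2)}
    (hX : IsQuarticSolution
      (repSum fun κ : spinRange a b × spinRange a' b' => spinRepTwo p hp κ.1 κ.2) X) :
    ∃ x : spinRange a b × spinRange a' b' → Fin 2 → ℂ,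
      ∀ l, X l = piEnd _ fun κ => x κ l • 1 := by
  let R := repSum fun κ : spinRange a b × spinRange a' b' => spinRepTwo p hp κ.1 κ.2
  let B := Pi.basis fun κ : spinRange a b × spinRange a' b' => spinBasis κ.1 κ.2
  have hB : ∀ x, B x = Pi.single x.1 (Pi.single x.2.1 1 ⊗ₜ Pi.single x.2.2 1) := fun x => by
    rw [Pi.basis_apply, spinBasis_apply]
  -- The weights and Casimir elements of both copies separate all basis vectors of the sum because
  -- no pair (K, K') is repeated. Hence X_l, which commutes with them, is diagonal.
  let A : Fin 2 × Bool → Module.End ℂ _ := fun c =>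
    R (incl _ c.1 (if c.2 then casimir _ else sl2 _ .k))
  let μ : Fin 2 × Bool → (Σ κ : spinRange a b × spinRange a' b',
      Fin ((κ.1 : ℕ) + 1) × Fin ((κ.2 : ℕ) + 1)) → ℂ := fun c x =>
    let n : ℤ := ![((x.1.1 : ℕ) : ℤ), ((x.1.2 : ℕ) : ℤ)] c.1
    let i : ℤ := ![(x.2.1 : ℤ), (x.2.2 : ℤ)] c.1
    if c.2 then ((p ^ 2) ^ (n + 1) + (p ^ 2) ^ (-(n + 1))) / (p ^ 2 - (p ^ 2)⁻¹) ^ 2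
    else p ^ (2 * i - n)
  have hA : ∀ c x, A c (B x) = μ c x • B x := by
    rintro ⟨l, c⟩ x
    rw [hB, ← Pi.single_smul]
    refine (repSum_single _ _ _ _).trans (congrArg _ ?_)
    fin_cases l <;> cases c
    · simp [spinRepTwo, incl, repTensor_tmul, spinRep_gen, spinGen_k, μ,
        TensorProduct.smul_tmul']
    · simp [spinRepTwo, incl, repTensor_tmul, spinRep_casimir hp hq, μ,
        TensorProduct.smul_tmul']
    · simp [spinRepTwo, incl, repTensor_tmul, spinRep_gen, spinGen_k, μ]
    · simp [spinRepTwo, incl, repTensor_tmul, spinRep_casimir hp hq, μ]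
  have hμ : ∀ x y, x ≠ y → ∃ c, μ c x ≠ μ c y := by
    intro x y hxy
    by_contra! h
    apply hxy
    obtain ⟨⟨⟨K, hK⟩, ⟨K', hK'⟩⟩, i, i'⟩ := x
    obtain ⟨⟨⟨L, hL⟩, ⟨L', hL'⟩⟩, j, j'⟩ := y
    have hs := pow_ne_zero 2 (hq.sub_inv_ne_zero (pow_ne_zero 2 hp))
    have h1 := h (0, true)
    have h1' := h (1, true)
    have h2 := zpow_injective hp hq (h (0, false))
    have h2' := zpow_injective hp hq (h (1, false))
    simp only [μ, if_true, sq_zpow, Matrix.cons_val_zero, Matrix.cons_val_one] at h1 h1' h2 h2'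
    rw [div_left_inj' hs, mul_neg, mul_neg] at h1 h1'
    have h3 := zpow_add_zpow_neg_injective hp hq (by omega) (by omega) h1
    have h3' := zpow_add_zpow_neg_injective hp hq (by omega) (by omega) h1'
    obtain rfl : K = L := by omega
    obtain rfl : K' = L' := by omega
    obtain rfl : i = j := Fin.ext (by omega)
    obtain rfl : i' = j' := Fin.ext (by omega)
    rfl
  have hdiag : ∀ l, ∃ y : (Σ κ : spinRange a b × spinRange a' b',
      Fin ((κ.1 : ℕ) + 1) × Fin ((κ.2 : ℕ) + 1)) → ℂ, ∀ x, X l (B x) = y x • B x :=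
    fun l => ⟨_, fun x => diagonal_of_commute B hA hμ (fun c => hX.comm_rep l _) x⟩
  choose y hy using hdiag
  -- If some element of the algebra maps one basis vector to a nonzero multiple of another, X_l has
  -- the same eigenvalue on both.
  have key : ∀ l (x x' : Σ κ : spinRange a b × spinRange a' b',
      Fin ((κ.1 : ℕ) + 1) × Fin ((κ.2 : ℕ) + 1)) (u) (c : ℂ), c ≠ 0 → R u (B x) = c • B x' →
      (y l x = y l x') := by
    intro l x x' u c hc h
    have h1 := DFunLike.congr_fun (hX.comm_rep l u) (B x)
    rw [Module.End.mul_apply, Module.End.mul_apply, hy, map_smul] at h1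
    change X l (R u (B x)) = y l x • R u (B x) at h1
    rw [h, map_smul, hy, smul_smul, smul_smul, mul_comm] at h1
    exact (mul_right_cancel₀ hc (smul_left_injective ℂ (B.ne_zero x') h1)).symm
  -- Within a summand e₁ and e₂ connect all basis vectors, so the eigenvalue is constant there.
  have hconst : ∀ l κ i, y l ⟨κ, i⟩ = y l ⟨κ, (0, 0)⟩ := by
    intro l κ i
    have e0 : ∀ j : ℕ, ∀ hj : j < κ.1, ∀ i', y l ⟨κ, (⟨j, by omega⟩, i')⟩ =
        y l ⟨κ, (⟨j + 1, by omega⟩, i')⟩ := by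
      intro j hj i'
      refine key l _ _ (incl _ 0 (sl2 _ .e)) (qnum (p ^ 2) ((κ.1 : ℕ) - j))
        (qnum_ne_zero hp hq (by omega)) ?_
      rw [hB, hB, ← Pi.single_smul]
      refine (repSum_single _ _ _ _).trans (congrArg _ ?_)
      simp [spinRepTwo, incl, repTensor_tmul, spinRep_gen, spinGen_e, hj,
        TensorProduct.smul_tmul']
    have e1 : ∀ j : ℕ, ∀ hj : j < κ.2, ∀ i', y l ⟨κ, (i', ⟨j, by omega⟩)⟩ =
        y l ⟨κ, (i', ⟨j + 1, by omega⟩)⟩ := by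
      intro j hj i'
      refine key l _ _ (incl _ 1 (sl2 _ .e)) (qnum (p ^ 2) ((κ.2 : ℕ) - j))
        (qnum_ne_zero hp hq (by omega)) ?_
      rw [hB, hB, ← Pi.single_smul]
      refine (repSum_single _ _ _ _).trans (congrArg _ ?_)
      simp [spinRepTwo, incl, repTensor_tmul, spinRep_gen, spinGen_e, hj]
    have f0 := fin_forall_of_iff (P := fun j => y l ⟨κ, (j, i.2)⟩ = y l ⟨κ, (0, i.2)⟩)
      (fun j hj => by rw [e0 j hj]) (i := 0) rfl i.1
    have f1 := fin_forall_of_iff (P := fun j => y l ⟨κ, (0, j)⟩ = y l ⟨κ, (0, 0)⟩)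
      (fun j hj => by rw [e1 j hj]) (i := 0) rfl i.2
    exact f0.trans f1
  refine ⟨fun κ l => y l ⟨κ, (0, 0)⟩, fun l => B.ext fun x => ?_⟩
  rw [hy, hB]
  refine Eq.trans ?_ (repSum_single _ _ _ _).symm
  rw [← Pi.single_smul, show y l x = _ from hconst l x.1 x.2]
  rfl

theorem isQuarticSolution_scalars {ι : Type*} {V : ι → Type*} [∀ i, AddCommMonoid (V i)]
    [∀ i, Module ℂ (V i)] {q : ℂ} {ρ : ∀ i, UqSl2Two q →ₐ[ℂ] Module.End ℂ (V i)}
    {x : ι → Fin 2 → ℂ} (h : IsQuarticSolution (repSum ρ) fun l => piEnd V fun i => x i l • 1)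
    (i : ι) : IsQuarticSolution (ρ i) fun l => x i l • 1 where
  comm_rep l u := by simp
  comm := by simp [mul_comm, smul_smul]
  quartic l := by
    classical
    refine LinearMap.ext fun v => ?_
    have h1 := congrArg (fun f => f (Pi.single i v) i) (h.quartic l)
    rw [← map_pow] at h1
    simp only [LinearMap.add_apply, LinearMap.smul_apply, Module.End.mul_apply, piEnd,
      repSum_single, Pi.add_apply, Pi.smul_apply, Pi.single_eq_same, Module.End.one_apply,
      ← map_pow] at h1
    exact h1

/-- X is scalar on each summand, so T is forced to be the sum of the extensions with these scalars.
Each of them gives R_{kk'} up to equivalence, whichever roots occur, by `repEquiv_extension`. -/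
theorem repEquiv_repSum (hq : NotRootOfUnity (p ^ 2)) (a b a' b' : ℕ)
    {φ : UqSo4 (p ^ 2) →ₐ[ℂ] UqExt (p ^ 2)} (hφ : IsPhi (p ^ 2) φ) {X : Fin 2 → Module.End ℂ
      (∀ κ : spinRange a b × spinRange a' b', SpinSpace κ.1 ⊗[ℂ] SpinSpace κ.2)}
    {T : UqExt (p ^ 2) →ₐ[ℂ] Module.End ℂ
      (∀ κ : spinRange a b × spinRange a' b', SpinSpace κ.1 ⊗[ℂ] SpinSpace κ.2)}
    (hX : IsQuarticSolution
      (repSum fun κ : spinRange a b × spinRange a' b' => spinRepTwo p hp κ.1 κ.2) X)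
    (hT : IsExtension
      (repSum fun κ : spinRange a b × spinRange a' b' => spinRepTwo p hp κ.1 κ.2) X T) :
    RepEquiv (T.comp φ) (repSum fun κ : spinRange a b × spinRange a' b' =>
      so4Rep p hp hq φ κ.1 κ.2) := by
  obtain ⟨x, hx⟩ := exists_scalars hq a b a' b' hX
  have hXx : X = fun l => piEnd (fun κ : spinRange a b × spinRange a' b' =>
      SpinSpace κ.1 ⊗[ℂ] SpinSpace κ.2) fun κ => x κ l • 1 := funext hx
  rw [hXx] at hX hT
  let S : ∀ κ : spinRange a b × spinRange a' b', UqExt (p ^ 2) →ₐ[ℂ]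
      Module.End ℂ (SpinSpace κ.1 ⊗[ℂ] SpinSpace κ.2) := fun κ =>
    extLift (pow_ne_zero 2 hp) (spinRepTwo p hp κ.1 κ.2) (fun l => x κ l • 1)
      (isQuarticSolution_scalars hX κ) (isUnit_sumEl hp hq κ.1 κ.2) (isUnit_diffEl hp hq κ.1 κ.2)
  have hS : ∀ κ, IsExtension (spinRepTwo p hp κ.1 κ.2) (fun l => x κ l • 1) (S κ) := fun κ =>
    isExtension_extLift (pow_ne_zero 2 hp) (isQuarticSolution_scalars hX κ)
      (isUnit_sumEl hp hq κ.1 κ.2) (isUnit_diffEl hp hq κ.1 κ.2)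
  have h : T = repSum S := hT.unique (isExtension_repSum hS)
    (fun j => isUnit_repSum fun κ => isUnit_sumEl hp hq κ.1 κ.2 j)
    (fun j => isUnit_repSum fun κ => isUnit_diffEl hp hq κ.1 κ.2 j)
  rw [h]
  change RepEquiv (repSum fun κ => (S κ).comp φ) _
  exact repSum_equiv fun κ => repEquiv_extension hq hφ (hS κ)

end Scalars

end

end QSo4

/-! ### Assembly -/

theorem mainTheorem7 (p : ℂ) (hp : p ≠ 0) (hq : NotRootOfUnity (p ^ 2)) :
    (∃! φ : UqSo4 (p ^ 2) →ₐ[ℂ] UqExt (p ^ 2), IsPhi (p ^ 2) φ) ∧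
    ∀ φ : UqSo4 (p ^ 2) →ₐ[ℂ] UqExt (p ^ 2), IsPhi (p ^ 2) φ →
      (∀ n n' : ℕ, RepIrreducible (so4Rep p hp hq φ n n')) ∧
      ∀ a a' b b' : ℕ,
        (∃ X, IsQuarticSolution (tensorRep p hp a a' b b') X) ∧
        ∀ X, IsQuarticSolution (tensorRep p hp a a' b b') X →
          (∃! T, IsExtension (tensorRep p hp a a' b b') X T) ∧
          ∀ T, IsExtension (tensorRep p hp a a' b b') X T →
            RepEquiv (T.comp φ)
              (repSum fun κ : spinRange a b × spinRange a' b' =>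
                so4Rep p hp hq φ κ.1 κ.2) := by
  have hq0 : p ^ 2 ≠ 0 := pow_ne_zero 2 hp
  have hs := hq.sub_inv_ne_zero hq0
  refine ⟨⟨phi hq0 hs, isPhi_phi hq0 hs, fun ψ hψ => hψ.eq (isPhi_phi hq0 hs)⟩, fun φ hφ =>
    ⟨fun n n' => so4Rep_irreducible hq hφ, fun a a' b b' => ?_⟩⟩
  obtain ⟨Ψ, hΨ⟩ := tensorRep_equiv hp hq a a' b b'
  -- Conjugation by the Clebsch–Gordan isomorphism carries solutions, extensions and units between T
  -- and the direct sum.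
  let C := Ψ.conjAlgEquiv ℂ
  have hC : C.toAlgHom.comp (tensorRep p hp a a' b b') =
      repSum fun κ : spinRange a b × spinRange a' b' => spinRepTwo p hp κ.1 κ.2 := by
    refine AlgHom.ext fun u => LinearMap.ext fun v => ?_
    simpa [C] using hΨ u (Ψ.symm v)
  have hC' : tensorRep p hp a a' b b' = C.symm.toAlgHom.comp
      (repSum fun κ : spinRange a b × spinRange a' b' => spinRepTwo p hp κ.1 κ.2) := by
    rw [← hC]
    exact AlgHom.ext fun u => (C.symm_apply_apply _).symm
  have us : ∀ j, IsUnit (tensorRep p hp a a' b b' (sumEl (p ^ 2) j)) := fun j => by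
    rw [hC']
    exact (isUnit_repSum fun κ => isUnit_sumEl hp hq _ _ j).map C.symm.toAlgHom
  have ud : ∀ j, IsUnit (tensorRep p hp a a' b b' (diffEl (p ^ 2) j)) := fun j => by
    rw [hC']
    exact (isUnit_repSum fun κ => isUnit_diffEl hp hq _ _ j).map C.symm.toAlgHom
  refine ⟨?_, fun X hX => ⟨?_, fun T hT => ?_⟩⟩
  -- A solution exists: take the standard scalars q^{-k}, q^{-k'} on the summands and transport them
  -- back.
  · rw [hC']
    exact ⟨_, (isQuarticSolution_repSum fun κ =>
      isQuarticSolution_spinX hp hq κ.1 κ.2).map C.symm.toAlgHom⟩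
  · exact ⟨_, isExtension_extLift hq0 hX us ud, fun T hT =>
      hT.unique (isExtension_extLift hq0 hX us ud) us ud⟩
  · have hX' := hX.map C.toAlgHom
    have hT' := hT.map C.toAlgHom
    rw [hC] at hX' hT'
    refine RepEquiv.trans ⟨Ψ, fun u v => ?_⟩ (repEquiv_repSum hq a b a' b' hφ hX' hT')
    simp [C]
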